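/- **Setting.** Let $G$ be the adjoint group (over $\mathbb{C}$) of a simple finite-dimensional complex Lie algebra $\mathfrak{g}$ with Chevalley generators $e_s,f_s$ $(s\in S)$, and let $x_s(t)=\exp(te_s)$, $y_s(t)=\exp(tf_s)$ be the root subgroups. Let $U^+\subset B^+=HU^+$ be the corresponding maximal unipotent, Borel and Cartan subgroups. Let $\overline{w_0}\in G$ be the standard lift of the longest Weyl group element; it is the element with $\overline{w_0}\,x_s(t)\,\overline{w_0}^{-1}=y_{s^*}(-t)$ and $\overline{w_0}\,y_s(t)\,\overline{w_0}^{-1}=x_{s^*}(-t)$ for an involution $s\mapsto s^*$ of $S$. Put $B^-=\overline{w_0}B^+\overline{w_0}^{-1}$. A pair of flags in $G/B^+$ is *generic* if it lies in the $G$-orbit of $(B^+,B^-)$. A *pinning* over a generic pair of flags $(B_1,B_2)$ is a pair in $G/U^+\times G/B^+$ lying over it. Every pinning is $g.p_{\mathrm{std}}$ for a unique $g\in G$, where $p_{\mathrm{std}}=([U^+],B^-)$; its opposite is $(g.p_{\mathrm{std}})^*=g\,\overline{w_0}.p_{\mathrm{std}}$, a pinning over $(B_2,B_1)$. Let $\mathrm{Conf}_3\mathcal{P}_G$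 be the set of $G$-orbits $[p_{12},p_{23},p_{31}]$ of triples of pinnings, with $p_{ij}$ over $(B_i,B_j)$ for some flags $B_1,B_2,B_3$. Let $\mathcal{S}_3[p_{12},p_{23},p_{31}]=[p_{23},p_{31},p_{12}]$. The *basic Wilson lines* $b_L,b_R:\mathrm{Conf}_3\mathcal{P}_G\to G$ are defined, for $p_{i,i+1}=g_i.p_{\mathrm{std}}$ (indices modulo $3$), by $$b_L=g_1^{-1}g_3\overline{w_0},\qquad b_R=g_3^{-1}g_1\overline{w_0}.$$ Let $\Sigma$ be a compact oriented marked surface and $\Delta$ an ideal triangulation of $\Sigma$ without self-folded triangles. Let $\mathcal{P}_{G,\Sigma}$ be the set of isomorphism classes of framed $G$-local systems with pinnings $(\mathcal{L},\beta;p)$ on $\Sigma$. Here $\mathcal{L}$ is a $G$-local system on $\Sigma$ minus the punctures, $\beta$ is a flat section of the associated flag bundle near the marked points, and for every boundary interval $E$ (oriented as boundary), $p_E$ is a flat section over $E$ of the bundle of pinnings, over the pair of the flags at the initial and the terminal point of $E$. An *arc class* $[c]:E_{\mathrm{in}}\to E_{\mathrm{out}}$ is a homotopy class of paths from the boundary interval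 $E_{\mathrm{in}}$ to $E_{\mathrm{out}}$, the end points moving in these intervals. The *Wilson line* $g_{[c]}:\mathcal{P}_{G,\Sigma}\to G$ sends $[\mathcal{L},\beta;p]$ to the element $g$ such that, in the flat trivialization of $\mathcal{L}$ along $c$ for which $p_{E_{\mathrm{in}}}=p_{\mathrm{std}}$, one has $p_{E_{\mathrm{out}}}=g.p_{\mathrm{std}}^*$. The *gluing map* $q_\Delta:\prod_{T\in t(\Delta)}\mathcal{P}_{G,T}\to\mathcal{P}_{G,\Sigma}$ sends a family of framed local systems with pinnings on the triangles to the one obtained by gluing them so that along every interior edge the pinning given on one side is identified with the opposite of the pinning given on the other side (the framings and the pinnings on the boundary intervals being kept). For a triangle $T$ and a vertex $m$ of $T$, let $f_m:\mathcal{P}_{G,T}\to\mathrm{Conf}_3\mathcal{P}_G$ send $[\mathcal{L},\beta;p]$ to $[p_E,p_{E'},p_{E''}]$, where $E$ is the side whose initial point is $m$, where $E,E',E''$ is the counterclockwise order of the sides, and the flat sections are compared at a common point. A *dotted triangulation* $\Delta_*$ is $\Delta$ together with a vertex $m_T$ of every triangle $T\in t(\Delta)$. Let $[c]:E_{\mathrm{in}}\to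 E_{\mathrm{out}}$ be an arc class having a representative in minimal position which traverses successively the triangles $T_1,\dots,T_M$ ($M\ge 1$; repetitions allowed), crossing each $T_\nu$ from one side to a different side. (This excludes exactly the arc classes which are homotopic into a boundary interval.) The part of the arc in $T_\nu$ separates one corner $m_\nu$ of $T_\nu$ from the other two. The *turning pattern* is $(\tau_1,\dots,\tau_M)\in\{L,R\}^M$, with $\tau_\nu=L$ if $m_\nu$ lies to the left of the arc and $\tau_\nu=R$ if it lies to the right. Let $t_\nu\in\{0,1,-1\}$ be the number of counterclockwise steps, modulo $3$, from the corner $m_{T_\nu}$ to the corner $m_\nu$ of $T_\nu$, so that $f_{m_\nu}=\mathcal{S}_3^{t_\nu}\circ f_{m_{T_\nu}}$. **Theorem (decomposition formula for Wilson lines).** The gluing map $q_\Delta$ exists, and for every dotted triangulation $\Delta_*$ and every arc class $[c]$ as above, $$q_\Delta^*\,g_{[c]}=\mu_M\circ\prod_{\nu=1}^M\bigl(b_{\tau_\nu}\circ\mathcal{S}_3^{t_\nu}\circ f_{m_{T_\nu}}\circ\mathrm{pr}_{T_\nu}\bigr),$$ that is, for every $d=(d_T)_T\in\prod_{T\in t(\Delta)}\mathcal{P}_{G,T}$,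 $$g_{[c]}(q_\Delta(d))=b_{\tau_1}\bigl(\mathcal{S}_3^{t_1}f_{m_{T_1}}(d_{T_1})\bigr)\cdot b_{\tau_2}\bigl(\mathcal{S}_3^{t_2}f_{m_{T_2}}(d_{T_2})\bigr)\cdots b_{\tau_M}\bigl(\mathcal{S}_3^{t_M}f_{m_{T_M}}(d_{T_M})\bigr).$$ -/

import Mathlib

open scoped unitInterval Topology

namespace WilsonLine

noncomputable section

section Group

variable {S 𝔤 : Type*} [Finite S] [LieRing 𝔤] [LieAlgebra ℂ 𝔤] {𝔥 : LieSubalgebra ℂ 𝔤}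

/-- The exponential of `ad x` for `ad`-nilpotent `x` (on a finite-dimensional Lie algebra the
exponential series stops before the power `dim 𝔤 + 1`). -/
def adExp (x : 𝔤) : Module.End ℂ 𝔤 :=
  ∑ k ∈ Finset.range (Module.finrank ℂ 𝔤 + 1), ((k.factorial : ℂ)⁻¹) • (LieAlgebra.ad ℂ 𝔤 x) ^ k

variable (𝔤) in
/-- The group of automorphisms of the Lie algebra `𝔤`. -/
def lieAut : Subgroup (𝔤 ≃ₗ[ℂ] 𝔤) where
  carrier := {a | ∀ x y : 𝔤, a ⁅x, y⁆ = ⁅a x, a y⁆}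
  mul_mem' ha hb x y := by simp [ha _ _, hb _ _]
  one_mem' x y := rfl
  inv_mem' {a} ha x y := by
    apply a.injective
    rw [ha]
    simp

/-- The root subgroup elements `x_s(t) = exp(t ad e_s)`, `s ∈ S`, `t ∈ ℂ`. -/
def posRootElts (b : LieAlgebra.Basis S 𝔥) : Set (𝔤 ≃ₗ[ℂ] 𝔤) :=
  {a | a ∈ lieAut 𝔤 ∧ ∃ (s : S) (t : ℂ), (a : 𝔤 →ₗ[ℂ] 𝔤) = adExp (t • b.e s)}

/-- The exponentials `exp(ad x)` of the `ad`-nilpotent elements. -/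
def unipotentElts (𝔤 : Type*) [LieRing 𝔤] [LieAlgebra ℂ 𝔤] : Set (𝔤 ≃ₗ[ℂ] 𝔤) :=
  {a | a ∈ lieAut 𝔤 ∧ ∃ x : 𝔤, IsNilpotent (LieAlgebra.ad ℂ 𝔤 x) ∧ (a : 𝔤 →ₗ[ℂ] 𝔤) = adExp x}

/-- The elements `h` of the torus `Hom(ℤΦ, ℂ^×)`: `h e_s = h^{α_s} e_s` and `h f_s = h^{-α_s} f_s`
for all `s ∈ S`, with arbitrary values `h^{α_s}` on the simple roots. -/
def torusElts (b : LieAlgebra.Basis S 𝔥) : Set (𝔤 ≃ₗ[ℂ] 𝔤) :=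
  {a | a ∈ lieAut 𝔤 ∧ ∃ c : S → ℂˣ, ∀ s, a (b.e s) = (c s : ℂ) • b.e s ∧
    a (b.f s) = ((c s)⁻¹ : ℂˣ) • b.f s}

/-- The adjoint group of `𝔤`, realised by its adjoint representation: the subgroup of
`Aut(𝔤)` generated by the `exp(ad x)` with `x` nilpotent and by the maximal torus with character
lattice the root lattice (which is contained in the former subgroup). For `𝔤` simple this is the
group of complex points of the simple algebraic group of adjoint type with Lie algebra `𝔤`. -/
def adjointGroup (b : LieAlgebra.Basis S 𝔥) : Subgroup (𝔤 ≃ₗ[ℂ] 𝔤) :=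
  Subgroup.closure (unipotentElts 𝔤 ∪ torusElts b)

/-- The adjoint group `G`, as a type. -/
abbrev G (b : LieAlgebra.Basis S 𝔥) : Type _ := ↥(adjointGroup b)

variable (b : LieAlgebra.Basis S 𝔥)

/-- The maximal unipotent subgroup `U⁺`, generated by the `x_s(t)`. -/
def Uplus : Subgroup (G b) := Subgroup.closure {u | (u : 𝔤 ≃ₗ[ℂ] 𝔤) ∈ posRootElts b}

/-- The Cartan subgroup `H`: `h e_s = h^{α_s} e_s` and `h f_s = h^{-α_s} f_s` for all `s`. -/
def cartan : Subgroup (G b) where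
  carrier := {h | ∃ c : S → ℂˣ, ∀ s, h.1 (b.e s) = (c s : ℂ) • b.e s ∧
    h.1 (b.f s) = ((c s)⁻¹ : ℂˣ) • b.f s}
  mul_mem' := by
    rintro h k ⟨c, hc⟩ ⟨d, hd⟩
    refine ⟨c * d, fun s => ⟨?_, ?_⟩⟩
    · simp [(hc s).1, (hd s).1, smul_smul, mul_comm]
    · simp [(hc s).2, (hd s).2, smul_smul, Units.smul_def]
  one_mem' := ⟨1, fun s => by simp⟩
  inv_mem' := by
    rintro h ⟨c, hc⟩
    refine ⟨c⁻¹, fun s => ⟨?_, ?_⟩⟩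
    · apply h.1.injective
      simp [(hc s).1, smul_smul]
    · apply h.1.injective
      simp [(hc s).2, smul_smul, Units.smul_def]

/-- The Borel subgroup `B⁺ = H U⁺`. -/
def Bplus : Subgroup (G b) := cartan b ⊔ Uplus b

/-- The lift `\overline{w_0} ∈ G` of the longest element of the Weyl group. In the adjoint group it
is the element which interchanges the two halves of the standard pinning up to sign: there is an
involution `s ↦ s*` of `S` (namely `α_{s*} = - w_0 α_s`) with
`\overline{w_0} x_s(t) \overline{w_0}⁻¹ = y_{s*}(-t)` and
`\overline{w_0} y_s(t) \overline{w_0}⁻¹ = x_{s*}(-t)`. As `𝔤` is generated by the `e_s` and `f_s`,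
and as an element of the adjoint group that merely permutes the `e_s` and the `f_s` is
trivial, this determines the element; its existence is proved below. -/
structure LongestLift where
  /-- the group element -/
  elt : G b
  /-- the involution of the set of simple roots -/
  star : S → S
  star_star : ∀ s, star (star s) = s
  elt_e : ∀ s, elt.1 (b.e s) = - b.f (star s)
  elt_f : ∀ s, elt.1 (b.f s) = - b.e (star s)


/-! ### The pinnings form a principal homogeneous space

The lemmas of this part only serve to show that an element of `G` is determined by its action on
the standard pinning. -/

variable {b}

lemma G.map_lie (g : G b) (x y : 𝔤) : g.1 ⁅x, y⁆ = ⁅g.1 x, g.1 y⁆ := by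
  have : adjointGroup b ≤ lieAut 𝔤 := by
    rw [adjointGroup, Subgroup.closure_le]
    rintro a (ha | ha)
    · exact ha.1
    · exact ha.1
  exact this g.2 x y

/-- The subalgebra of elements with equal images under two elements of `G`. -/
lemma G.ext_gens {g g' : G b} (he : ∀ s, g.1 (b.e s) = g'.1 (b.e s))
    (hf : ∀ s, g.1 (b.f s) = g'.1 (b.f s)) : g = g' := by
  apply Subtype.ext
  apply LinearEquiv.ext
  intro x
  have hx : x ∈ LieSubalgebra.lieSpan ℂ 𝔤 (Set.range b.e ∪ Set.range b.f) := by
    rw [b.span_ef]; trivial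
  induction hx using LieSubalgebra.lieSpan_induction with
  | mem y hy =>
    rcases hy with ⟨s, rfl⟩ | ⟨s, rfl⟩
    · exact he s
    · exact hf s
  | zero => simp
  | add u v _ _ hu hv => simp [hu, hv]
  | smul t v _ hv => simp [hv]
  | lie u v _ _ hu hv => rw [G.map_lie, G.map_lie, hu, hv]

lemma LongestLift.mul_self (w : LongestLift b) : w.elt * w.elt = 1 := by
  apply G.ext_gens
  · intro s
    simp [w.elt_e, w.elt_f, w.star_star]
  · intro s
    simp [w.elt_e, w.elt_f, w.star_star]

variable (b) in
lemma exists_weight (z : S → ℂ) : ∃ Z ∈ Submodule.span ℂ (Set.range b.h),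
    (∀ s, ⁅Z, b.e s⁆ = z s • b.e s) ∧ (∀ s, ⁅Z, b.f s⁆ = - (z s • b.f s)) := by
  classical
  have := Fintype.ofFinite S
  set A : Matrix S S ℂ := b.A.map (Int.cast : ℤ → ℂ) with hA
  have hdet : A.det ≠ 0 := by
    have h1 : b.A.det ≠ 0 := Matrix.nondegenerate_iff_det_ne_zero.1 b.nondegen
    have h2 : A.det = ((b.A.det : ℤ) : ℂ) := by
      have := (Int.castRingHom ℂ).map_det b.A
      simpa [hA, RingHom.mapMatrix_apply] using this.symm
    rw [h2]; exact_mod_cast h1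
  set c : S → ℂ := A⁻¹.mulVec z with hc
  have hAc : A.mulVec c = z := by
    rw [hc, Matrix.mulVec_mulVec, Matrix.mul_nonsing_inv _ (isUnit_iff_ne_zero.2 hdet),
      Matrix.one_mulVec]
  have hs : ∀ s, ∑ j, c j * (b.A s j : ℂ) = z s := by
    intro s
    have := congrFun hAc s
    simp only [Matrix.mulVec, dotProduct, hA, Matrix.map_apply] at this
    rw [← this]
    exact Finset.sum_congr rfl fun j _ => mul_comm _ _
  refine ⟨∑ j, c j • b.h j, ?_, fun s => ?_, fun s => ?_⟩
  · exact Submodule.sum_mem _ fun j _ => Submodule.smul_mem _ _ (Submodule.subset_span ⟨j, rfl⟩)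
  · rw [sum_lie]
    have : ∀ j, ⁅c j • b.h j, b.e s⁆ = (c j * (b.A s j : ℂ)) • b.e s := fun j => by
      rw [smul_lie, b.lie_h_e, mul_smul, Int.cast_smul_eq_zsmul]
    rw [Finset.sum_congr rfl fun j _ => this j, ← Finset.sum_smul, hs]
  · rw [sum_lie]
    have : ∀ j, ⁅c j • b.h j, b.f s⁆ = (c j * (b.A s j : ℂ)) • (- b.f s) := fun j => by
      rw [smul_lie, b.lie_h_f, mul_smul, smul_neg, smul_neg, neg_smul, smul_neg,
        Int.cast_smul_eq_zsmul]
    rw [Finset.sum_congr rfl fun j _ => this j, ← Finset.sum_smul, hs, smul_neg]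

variable (b) in
lemma exists_grading : ∃ D : 𝔤, (∀ s, ⁅D, b.e s⁆ = b.e s) ∧ (∀ s, ⁅D, b.f s⁆ = - b.f s) ∧
    D ∈ Submodule.span ℂ (Set.range b.h) := by
  obtain ⟨D, hD, he, hf⟩ := exists_weight b fun _ => 1
  exact ⟨D, fun s => by simp [he], fun s => by simp [hf], hD⟩

/-- The integral eigenspaces of `ad D`. -/
def gr (D : 𝔤) (k : ℤ) : Submodule ℂ 𝔤 :=
  Module.End.eigenspace (LieAlgebra.ad ℂ 𝔤 D) (k : ℂ)

lemma mem_gr {D : 𝔤} {k : ℤ} {y : 𝔤} : y ∈ gr D k ↔ ⁅D, y⁆ = (k : ℂ) • y := by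
  simp [gr]

/-- The filtration by `ad D`-eigenvalue at least `k`. -/
def up (D : 𝔤) (k : ℤ) : Submodule ℂ 𝔤 := ⨆ j : {j : ℤ // k ≤ j}, gr D j

lemma up_anti {D : 𝔤} {k l : ℤ} (h : k ≤ l) : up D l ≤ up D k :=
  iSup_le fun j => le_iSup (fun j : {j : ℤ // k ≤ j} => gr D j) ⟨j.1, h.trans j.2⟩

lemma gr_le_up {D : 𝔤} {k : ℤ} : gr D k ≤ up D k :=
  le_iSup (fun j : {j : ℤ // k ≤ j} => gr D j) ⟨k, le_rfl⟩

lemma gr_neg {D : 𝔤} {k : ℤ} : gr (-D) k = gr D (-k) := by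
  ext y
  rw [mem_gr, mem_gr, neg_lie]
  push_cast
  rw [neg_smul, neg_eq_iff_eq_neg]

lemma up_inf {D : 𝔤} {k : ℤ} {y : 𝔤} (h1 : y ∈ up D (k + 1)) (h2 : y ∈ up (-D) (-k)) : y = 0 := by
  have ind : iSupIndep (gr D) :=
    (Module.End.eigenspaces_iSupIndep (LieAlgebra.ad ℂ 𝔤 D)).comp
      (f := fun k : ℤ => (k : ℂ)) Int.cast_injective
  have hd : Disjoint {j : ℤ | k + 1 ≤ j} {j : ℤ | j ≤ k} := by
    rw [Set.disjoint_left]; intro j hj hj'; simp only [Set.mem_ofPred_eq] at hj hj'; omega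
  have := ind.disjoint_biSup_biSup hd
  rw [Submodule.disjoint_def] at this
  refine this y ?_ ?_
  · refine (iSup_le fun j => ?_ : up D (k + 1) ≤ _) h1
    exact le_iSup₂_of_le j.1 j.2 le_rfl
  · refine (iSup_le fun j => ?_ : up (-D) (-k) ≤ _) h2
    rw [gr_neg]
    exact le_iSup₂_of_le (-j.1) (by have := j.2; simp only [Set.mem_ofPred_eq]; omega) le_rfl

lemma lie_up {D x : 𝔤} (hx : x ∈ gr D 1) {k : ℤ} {y : 𝔤} (hy : y ∈ up D k) :
    ⁅x, y⁆ ∈ up D (k + 1) := by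
  refine Submodule.iSup_induction (fun j : {j : ℤ // k ≤ j} => gr D j)
    (motive := fun y => ⁅x, y⁆ ∈ up D (k + 1)) hy ?_ (by simp) ?_
  · intro j y hy
    apply up_anti (show k + 1 ≤ j.1 + 1 by have := j.2; omega)
    apply gr_le_up
    rw [mem_gr] at *
    rw [leibniz_lie, hx, hy]
    push_cast
    rw [smul_lie, lie_smul, ← add_smul]
    congr 1; ring
  · intro y z hy hz
    rw [lie_add]; exact add_mem hy hz

lemma adExp_up {D x : 𝔤} (hx : x ∈ gr D 1) {k : ℤ} {y : 𝔤} (hy : y ∈ up D k) :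
    adExp x y - y ∈ up D (k + 1) := by
  rw [adExp, Finset.sum_range_succ']
  simp only [LinearMap.add_apply, LinearMap.sum_apply, LinearMap.smul_apply, pow_zero,
    Nat.factorial_zero, Nat.cast_one, inv_one, one_smul, Module.End.one_apply, add_sub_cancel_right]
  refine Submodule.sum_mem _ fun i _ => Submodule.smul_mem _ _ ?_
  have : ∀ n : ℕ, ((LieAlgebra.ad ℂ 𝔤 x) ^ n) y ∈ up D (k + n) := by
    intro n
    induction n with
    | zero => simpa using hy
    | succ n ih =>
      rw [pow_succ', Module.End.mul_apply, LieAlgebra.ad_apply]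
      have := lie_up hx ih
      push_cast
      rwa [← add_assoc]
  exact up_anti (by push_cast; omega) (this (i + 1))

lemma inv_mem_of_stable [FiniteDimensional ℂ 𝔤] (g : 𝔤 ≃ₗ[ℂ] 𝔤) (V : Submodule ℂ 𝔤)
    (h : ∀ y ∈ V, g y ∈ V) {y : 𝔤} (hy : y ∈ V) : ∃ z ∈ V, g z = y := by
  have hle : V.map (g : 𝔤 →ₗ[ℂ] 𝔤) ≤ V := by
    rintro _ ⟨y, hy, rfl⟩; exact h y hy
  have heq : V.map (g : 𝔤 →ₗ[ℂ] 𝔤) = V :=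
    Submodule.eq_of_le_of_finrank_eq hle (LinearEquiv.finrank_map_eq g V)
  rw [← heq] at hy
  exact hy

lemma Uplus_up [FiniteDimensional ℂ 𝔤] {D : 𝔤} (hD : ∀ s, ⁅D, b.e s⁆ = b.e s) {u : G b}
    (hu : u ∈ Uplus b) : ∀ (k : ℤ), ∀ y ∈ up D k, u.1 y - y ∈ up D (k + 1) := by
  induction hu using Subgroup.closure_induction with
  | mem x hx =>
    obtain ⟨-, s, t, hst⟩ := hx
    intro k y hy
    have : x.1 y = adExp (t • b.e s) y := by rw [← hst]; rfl
    rw [this]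
    refine adExp_up ?_ hy
    rw [mem_gr, lie_smul, hD]; simp
  | one => intro k y _; simp
  | mul g h _ _ hg hh =>
    intro k y hy
    have h1 := hh k y hy
    have h2 : h.1 y ∈ up D k := by
      have := add_mem (up_anti (show k ≤ k + 1 by omega) h1) hy
      simpa using this
    have := add_mem (hg k _ h2) h1
    simpa using this
  | inv g _ hg =>
    intro k y hy
    obtain ⟨z, hz, rfl⟩ := inv_mem_of_stable g.1 (up D k) (fun y hy => by
      have := add_mem (up_anti (show k ≤ k + 1 by omega) (hg k y hy)) hy
      simpa using this) hy
    have := neg_mem (hg k z hz)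
    simpa using this

lemma cartan_fix {D : 𝔤} (hD : D ∈ Submodule.span ℂ (Set.range b.h)) {h : G b}
    (hh : h ∈ cartan b) : h.1 D = D := by
  obtain ⟨c, hc⟩ := hh
  induction hD using Submodule.span_induction with
  | mem x hx =>
    obtain ⟨s, rfl⟩ := hx
    rw [← (b.sl2 s).lie_e_f, G.map_lie, (hc s).1, (hc s).2, Units.smul_def, lie_smul, smul_lie,
      smul_smul]
    simp
  | zero => simp
  | add x y _ _ hx hy => simp [hx, hy]
  | smul t x _ hx => simp [hx]

lemma Bplus_up [FiniteDimensional ℂ 𝔤] {D : 𝔤} (hD : ∀ s, ⁅D, b.e s⁆ = b.e s)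
    (hD' : D ∈ Submodule.span ℂ (Set.range b.h)) {g : G b} (hg : g ∈ Bplus b) (k : ℤ) :
    ∀ y ∈ up D k, g.1 y ∈ up D k := by
  rw [Bplus, Subgroup.sup_eq_closure] at hg
  induction hg using Subgroup.closure_induction with
  | mem x hx =>
    intro y hy
    rcases hx with hx | hx
    · refine Submodule.iSup_induction (fun j : {j : ℤ // k ≤ j} => gr D j)
        (motive := fun y => x.1 y ∈ up D k) hy ?_ (by simp) ?_
      · intro j y hy
        apply up_anti j.2
        apply gr_le_up
        rw [mem_gr] at *
        conv_lhs => rw [← cartan_fix hD' hx]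
        rw [← G.map_lie, hy, map_smul]
      · intro y z hy hz
        rw [map_add]; exact add_mem hy hz
    · have := add_mem (up_anti (show k ≤ k + 1 by omega) (Uplus_up hD hx k y hy)) hy
      simpa using this
  | one => intro y hy; simpa using hy
  | mul g h _ _ hg hh => intro y hy; exact hg _ (hh _ hy)
  | inv g _ hg =>
    intro y hy
    obtain ⟨z, hz, rfl⟩ := inv_mem_of_stable g.1 (up D k) hg hy
    simpa using hz

lemma longest_gr {D : 𝔤} (hD : ∀ s, ⁅D, b.e s⁆ = b.e s) (hD' : ∀ s, ⁅D, b.f s⁆ = - b.f s)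
    (w : LongestLift b) {k : ℤ} {y : 𝔤} (hy : y ∈ gr D k) : w.elt.1 y ∈ gr (-D) k := by
  have h0 : ∀ y : 𝔤, ⁅w.elt.1 D + D, y⁆ = 0 := by
    intro y
    have hx : y ∈ LieSubalgebra.lieSpan ℂ 𝔤 (Set.range b.e ∪ Set.range b.f) := by
      rw [b.span_ef]; trivial
    induction hx using LieSubalgebra.lieSpan_induction with
    | mem y hy =>
      rcases hy with ⟨s, rfl⟩ | ⟨s, rfl⟩
      · have h1 : b.e s = w.elt.1 (- b.f (w.star s)) := by
          rw [map_neg, w.elt_f, w.star_star, neg_neg]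
        have h2 : ⁅w.elt.1 D, b.e s⁆ = - b.e s := by
          rw [h1, ← G.map_lie, lie_neg, hD', map_neg, map_neg]
        rw [add_lie, h2, hD]; simp
      · have h1 : b.f s = w.elt.1 (- b.e (w.star s)) := by
          rw [map_neg, w.elt_e, w.star_star, neg_neg]
        have h2 : ⁅w.elt.1 D, b.f s⁆ = b.f s := by
          rw [h1, ← G.map_lie, lie_neg, hD]
        rw [add_lie, h2, hD']; simp
    | zero => simp
    | add u v _ _ hu hv => simp only [lie_add, hu, hv, add_zero]
    | smul t v _ hv => simp only [lie_smul, hv, smul_zero]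
    | lie u v _ _ hu hv => rw [leibniz_lie, hu, hv]; simp
  rw [mem_gr] at *
  have h1 := h0 (w.elt.1 y)
  rw [add_lie, ← G.map_lie, hy, map_smul] at h1
  rw [neg_lie, ← eq_neg_of_add_eq_zero_left h1]

lemma longest_up {D : 𝔤} (hD : ∀ s, ⁅D, b.e s⁆ = b.e s) (hD' : ∀ s, ⁅D, b.f s⁆ = - b.f s)
    (w : LongestLift b) {k : ℤ} {y : 𝔤} (hy : y ∈ up D k) : w.elt.1 y ∈ up (-D) k := by
  refine Submodule.iSup_induction (fun j : {j : ℤ // k ≤ j} => gr D j)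
    (motive := fun y => w.elt.1 y ∈ up (-D) k) hy ?_ (by simp) ?_
  · intro j y hy
    exact up_anti j.2 (gr_le_up (longest_gr hD hD' w hy))
  · intro y z hy hz
    rw [map_add]; exact add_mem hy hz

/-- `U⁺ ∩ B⁻ = 1`, where `B⁻ = \overline{w_0} B⁺ \overline{w_0}⁻¹`. -/
lemma Uplus_inter [FiniteDimensional ℂ 𝔤] (w : LongestLift b) {u : G b} (hu : u ∈ Uplus b)
    (hu' : w.elt⁻¹ * u * w.elt ∈ Bplus b) : u = 1 := by
  obtain ⟨D, he, hf, hD⟩ := exists_grading b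
  have key : ∀ (k : ℤ) (y : 𝔤), y ∈ gr D k → u.1 y = y := by
    intro k y hy
    rw [← sub_eq_zero]
    refine up_inf (D := D) (k := k) (Uplus_up he hu k y (gr_le_up hy)) ?_
    have hy' : y ∈ gr (-D) (-k) := by rw [gr_neg, neg_neg]; exact hy
    refine sub_mem ?_ (gr_le_up hy')
    have hww : ∀ z, w.elt.1 (w.elt.1 z) = z := fun z => by
      have := congrArg (fun g : G b => g.1 z) w.mul_self
      simpa using this
    have h1 : w.elt.1 y ∈ up D (-k) := by
      apply gr_le_up
      rw [← neg_neg D, gr_neg, neg_neg]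
      exact longest_gr he hf w hy
    have h2 := longest_up he hf w (Bplus_up he hD hu' (-k) _ h1)
    have hinv : w.elt⁻¹ = w.elt := inv_eq_of_mul_eq_one_left w.mul_self
    rw [hinv] at h2
    simpa [hww] using h2
  apply G.ext_gens
  · intro s
    refine key 1 _ ?_
    rw [mem_gr, he]; simp
  · intro s
    refine key (-1) _ ?_
    rw [mem_gr, hf]; simp

/-! ### The existence of the lift of the longest element -/

lemma ad_pow_eq_zero [FiniteDimensional ℂ 𝔤] {x : 𝔤} (hx : IsNilpotent (LieAlgebra.ad ℂ 𝔤 x)) :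
    (LieAlgebra.ad ℂ 𝔤 x) ^ (Module.finrank ℂ 𝔤) = 0 := by
  have h := LinearMap.aeval_self_charpoly (LieAlgebra.ad ℂ 𝔤 x)
  rwa [hx.charpoly_eq_X_pow_finrank, map_pow, Polynomial.aeval_X] at h

lemma exists_adExp [FiniteDimensional ℂ 𝔤] {x : 𝔤} (hx : IsNilpotent (LieAlgebra.ad ℂ 𝔤 x)) :
    ∃ a ∈ lieAut 𝔤, (a : 𝔤 →ₗ[ℂ] 𝔤) = adExp x := by
  let : Module ℚ 𝔤 := Module.compHom 𝔤 (algebraMap ℚ ℂ)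
  have hq : ∀ (q : ℚ) (y : 𝔤), q • y = (q : ℂ) • y := fun _ _ => rfl
  let : LieAlgebra ℚ 𝔤 := { lie_smul := fun q y z => by rw [hq, hq, lie_smul] }
  have h1 : (LieDerivation.inner ℂ 𝔤 𝔤 (-x)).toLinearMap = LieAlgebra.ad ℂ 𝔤 x := by
    ext y; simp [LieDerivation.inner]
  let a := LieDerivation.exp (LieDerivation.inner ℂ 𝔤 𝔤 (-x)) (by rw [h1]; exact hx)
  refine ⟨a.toLinearEquiv, fun y z => a.map_lie y z, ?_⟩
  have h2 : (a.toLinearEquiv : 𝔤 →ₗ[ℂ] 𝔤) = IsNilpotent.exp (LieAlgebra.ad ℂ 𝔤 x) := by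
    rw [← h1]; rfl
  rw [h2, IsNilpotent.exp_eq_sum (k := Module.finrank ℂ 𝔤 + 1) (by
    rw [pow_succ, ad_pow_eq_zero hx, zero_mul]), adExp]
  refine Finset.sum_congr rfl fun k _ => ?_
  ext y
  rw [LinearMap.smul_apply, LinearMap.smul_apply, hq]
  push_cast
  rfl

lemma adExp_apply [FiniteDimensional ℂ 𝔤] {x y : 𝔤} (hx : IsNilpotent (LieAlgebra.ad ℂ 𝔤 x))
    (h : ⁅x, ⁅x, ⁅x, y⁆⁆⁆ = 0) : adExp x y = y + ⁅x, y⁆ + (1 / 2 : ℂ) • ⁅x, ⁅x, y⁆⁆ := by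
  have h3 : ∀ k, 3 ≤ k → ((LieAlgebra.ad ℂ 𝔤 x) ^ k) y = 0 := by
    intro k hk
    obtain ⟨k, rfl⟩ := Nat.exists_eq_add_of_le' hk
    rw [pow_add, Module.End.mul_apply]
    simp [pow_succ, h]
  rw [adExp, LinearMap.sum_apply]
  have h4 : ∑ k ∈ Finset.range 3, (((k.factorial : ℂ)⁻¹) • (LieAlgebra.ad ℂ 𝔤 x) ^ k) y =
      y + ⁅x, y⁆ + (1 / 2 : ℂ) • ⁅x, ⁅x, y⁆⁆ := by
    simp [Finset.sum_range_succ, pow_succ]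
  rw [← h4]
  rcases le_total (Module.finrank ℂ 𝔤 + 1) 3 with hle | hle
  · refine Finset.sum_subset (Finset.range_subset_range.2 hle) fun k _ hk => ?_
    rw [Finset.mem_range, not_lt] at hk
    obtain ⟨j, rfl⟩ := Nat.exists_eq_add_of_le' hk
    rw [pow_add, pow_succ, ad_pow_eq_zero hx]
    simp
  · refine (Finset.sum_subset (Finset.range_subset_range.2 hle) fun k _ hk => ?_).symm
    rw [Finset.mem_range, not_lt] at hk
    rw [LinearMap.smul_apply, h3 k hk, smul_zero]

lemma ad_nilpotent [FiniteDimensional ℂ 𝔤] {Z : 𝔤}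
    (hZ : ⨆ μ, (LieAlgebra.ad ℂ 𝔤 Z).eigenspace μ = ⊤) {x : 𝔤} {c : ℂ} (hc : c ≠ 0)
    (hx : ⁅Z, x⁆ = c • x) : IsNilpotent (LieAlgebra.ad ℂ 𝔤 x) := by
  rw [Module.End.isNilpotent_iff_of_finite]
  intro y
  have hy : y ∈ ⨆ μ, (LieAlgebra.ad ℂ 𝔤 Z).eigenspace μ := by rw [hZ]; trivial
  refine Submodule.iSup_induction _ (motive := fun y => ∃ n : ℕ,
    ((LieAlgebra.ad ℂ 𝔤 x) ^ n) y = 0) hy ?_ ⟨0, by simp⟩ ?_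
  · intro μ y hy
    rw [Module.End.mem_eigenspace_iff, LieAlgebra.ad_apply] at hy
    by_contra! hne
    have key : ∀ n : ℕ, ⁅Z, ((LieAlgebra.ad ℂ 𝔤 x) ^ n) y⁆ =
        (μ + n * c) • ((LieAlgebra.ad ℂ 𝔤 x) ^ n) y := by
      intro n
      induction n with
      | zero => simpa using hy
      | succ n ih =>
        rw [pow_succ', Module.End.mul_apply, LieAlgebra.ad_apply, leibniz_lie, ih, hx, smul_lie,
          lie_smul, ← add_smul]
        push_cast
        congr 1; ring
    have hinj : Function.Injective fun n : ℕ => μ + n * c := by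
      intro m n h
      simpa [hc] using h
    refine Set.infinite_range_of_injective hinj
      ((LieAlgebra.ad ℂ 𝔤 Z).finite_hasEigenvalue.subset ?_)
    rintro _ ⟨n, rfl⟩
    exact Module.End.hasEigenvalue_of_hasEigenvector (x := ((LieAlgebra.ad ℂ 𝔤 x) ^ n) y)
      ⟨Module.End.mem_eigenspace_iff.2 (key n), hne n⟩
  · rintro y z ⟨m, hm⟩ ⟨n, hn⟩
    refine ⟨m + n, ?_⟩
    rw [map_add]
    nth_rewrite 1 [add_comm m n]
    rw [pow_add, pow_add, Module.End.mul_apply, Module.End.mul_apply, hm, hn]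
    simp

lemma exists_adDiag [FiniteDimensional ℂ 𝔤] {Z : 𝔤}
    (hZ : ⨆ μ, (LieAlgebra.ad ℂ 𝔤 Z).eigenspace μ = ⊤) :
    ∃ a ∈ lieAut 𝔤, ∀ (μ : ℂ) (x : 𝔤), ⁅Z, x⁆ = μ • x → a x = Complex.exp μ • x := by
  classical
  set f := LieAlgebra.ad ℂ 𝔤 Z with hf
  set s : Finset ℂ := f.finite_hasEigenvalue.toFinset
  set p : Polynomial ℂ := Lagrange.interpolate s id Complex.exp
  set p' : Polynomial ℂ := Lagrange.interpolate s id fun μ => Complex.exp (-μ)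
  have main : ∀ (r : ℂ → ℂ) (μ : ℂ) (x : 𝔤), ⁅Z, x⁆ = μ • x →
      Polynomial.aeval f (Lagrange.interpolate s id r) x = r μ • x := by
    intro r μ x hx
    by_cases h0 : x = 0
    · simp [h0]
    have hv : f.HasEigenvector μ x := ⟨Module.End.mem_eigenspace_iff.2 hx, h0⟩
    have hs : μ ∈ s := by
      rw [Set.Finite.mem_toFinset]
      exact Module.End.hasEigenvalue_of_hasEigenvector hv
    rw [Module.End.aeval_apply_of_hasEigenvector hv]
    congr 1
    exact Lagrange.eval_interpolate_at_node r (Function.injective_id.injOn) hs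
  have hext : ∀ A B : 𝔤 →ₗ[ℂ] 𝔤, (∀ (μ : ℂ) (x : 𝔤), ⁅Z, x⁆ = μ • x → A x = B x) → A = B := by
    intro A B h
    ext x
    have hx : x ∈ ⨆ μ, f.eigenspace μ := by rw [hZ]; trivial
    refine Submodule.iSup_induction _ (motive := fun x => A x = B x) hx ?_ (by simp) ?_
    · intro μ x hx
      exact h μ x (Module.End.mem_eigenspace_iff.1 hx)
    · intro x y hx hy
      rw [map_add, map_add, hx, hy]
  let a : 𝔤 ≃ₗ[ℂ] 𝔤 := LinearEquiv.ofLinearMap (Polynomial.aeval f p) (Polynomial.aeval f p')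
    (hext _ _ fun μ x hx => by
      rw [LinearMap.comp_apply, main _ μ x hx, map_smul, main _ μ x hx, smul_smul,
        ← Complex.exp_add]; simp)
    (hext _ _ fun μ x hx => by
      rw [LinearMap.comp_apply, main _ μ x hx, map_smul, main _ μ x hx, smul_smul,
        ← Complex.exp_add]; simp)
  have ha : ∀ (μ : ℂ) (x : 𝔤), ⁅Z, x⁆ = μ • x → a x = Complex.exp μ • x := main Complex.exp
  refine ⟨a, ?_, ha⟩
  have h1 : ∀ (μ : ℂ) (x : 𝔤), ⁅Z, x⁆ = μ • x → ∀ y, a ⁅x, y⁆ = ⁅a x, a y⁆ := by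
    intro μ x hx y
    have := hext ((a : 𝔤 →ₗ[ℂ] 𝔤) ∘ₗ LieAlgebra.ad ℂ 𝔤 x)
      (LieAlgebra.ad ℂ 𝔤 (a x) ∘ₗ (a : 𝔤 →ₗ[ℂ] 𝔤)) fun ν y hy => by
        have hxy : ⁅Z, ⁅x, y⁆⁆ = (μ + ν) • ⁅x, y⁆ := by
          rw [leibniz_lie, hx, hy, smul_lie, lie_smul, add_smul]
        simp only [LinearMap.comp_apply, LieAlgebra.ad_apply, LinearEquiv.coe_coe]
        rw [ha _ _ hxy, ha _ _ hx, ha _ _ hy, Complex.exp_add, smul_lie, lie_smul, smul_smul]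
    exact LinearMap.congr_fun this y
  intro x y
  have := hext ((a : 𝔤 →ₗ[ℂ] 𝔤) ∘ₗ LieAlgebra.ad ℂ 𝔤 y)
    (LieAlgebra.ad ℂ 𝔤 (a y) ∘ₗ (a : 𝔤 →ₗ[ℂ] 𝔤)) fun μ x hx => by
      have h2 := h1 μ x hx y
      simp only [LinearMap.comp_apply, LieAlgebra.ad_apply, LinearEquiv.coe_coe]
      rw [← lie_skew, map_neg, h2, lie_skew]
  have h3 := LinearMap.congr_fun this x
  simp only [LinearMap.comp_apply, LieAlgebra.ad_apply, LinearEquiv.coe_coe] at h3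
  rw [← lie_skew, map_neg, h3, lie_skew]

lemma diag_top {Z : 𝔤} {z : S → ℂ} (he : ∀ s, ⁅Z, b.e s⁆ = z s • b.e s)
    (hf : ∀ s, ⁅Z, b.f s⁆ = - (z s • b.f s)) :
    ⨆ μ, (LieAlgebra.ad ℂ 𝔤 Z).eigenspace μ = ⊤ := by
  rw [eq_top_iff]
  rintro x -
  have hmem : ∀ (μ : ℂ) (x : 𝔤), ⁅Z, x⁆ = μ • x →
      x ∈ ⨆ μ, (LieAlgebra.ad ℂ 𝔤 Z).eigenspace μ := fun μ x hx =>
    le_iSup (fun μ => (LieAlgebra.ad ℂ 𝔤 Z).eigenspace μ) μ (Module.End.mem_eigenspace_iff.2 hx)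
  have hx : x ∈ LieSubalgebra.lieSpan ℂ 𝔤 (Set.range b.e ∪ Set.range b.f) := by
    rw [b.span_ef]; trivial
  induction hx using LieSubalgebra.lieSpan_induction with
  | mem y hy =>
    rcases hy with ⟨s, rfl⟩ | ⟨s, rfl⟩
    · exact hmem _ _ (he s)
    · exact hmem (- z s) _ (by rw [hf, neg_smul])
  | zero => exact zero_mem _
  | add u v _ _ hu hv => exact add_mem hu hv
  | smul t v _ hv => exact Submodule.smul_mem _ t hv
  | lie u v _ _ hu hv =>
    refine Submodule.iSup_induction _ (motive := fun u => ⁅u, v⁆ ∈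
      ⨆ μ, (LieAlgebra.ad ℂ 𝔤 Z).eigenspace μ) hu ?_ (by simp) ?_
    · intro μ u hu
      rw [Module.End.mem_eigenspace_iff, LieAlgebra.ad_apply] at hu
      refine Submodule.iSup_induction _ (motive := fun v => ⁅u, v⁆ ∈
        ⨆ μ, (LieAlgebra.ad ℂ 𝔤 Z).eigenspace μ) hv ?_ (by simp) ?_
      · intro ν v hv
        rw [Module.End.mem_eigenspace_iff, LieAlgebra.ad_apply] at hv
        refine hmem (μ + ν) _ ?_
        rw [leibniz_lie, hu, hv, smul_lie, lie_smul, add_smul]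
      · intro v w hv hw
        rw [lie_add]; exact add_mem hv hw
    · intro u w hu hw
      rw [add_lie]; exact add_mem hu hw

lemma neg_lie_f {D : 𝔤} {s : S} (h : ⁅D, b.f s⁆ = - b.f s) : ⁅-D, b.symm.e s⁆ = b.symm.e s := by
  change ⁅-D, b.f s⁆ = b.f s
  rw [neg_lie, h, neg_neg]

lemma lie_up_up {D : 𝔤} {k l : ℤ} {x y : 𝔤} (hx : x ∈ up D k) (hy : y ∈ up D l) :
    ⁅x, y⁆ ∈ up D (k + l) := by
  refine Submodule.iSup_induction (fun j : {j : ℤ // k ≤ j} => gr D j)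
    (motive := fun x => ⁅x, y⁆ ∈ up D (k + l)) hx ?_ (by simp) ?_
  · intro i x hx
    refine Submodule.iSup_induction (fun j : {j : ℤ // l ≤ j} => gr D j)
      (motive := fun y => ⁅x, y⁆ ∈ up D (k + l)) hy ?_ (by simp) ?_
    · intro j y hy
      apply up_anti (show k + l ≤ i.1 + j.1 by have := i.2; have := j.2; omega)
      apply gr_le_up
      rw [mem_gr] at *
      rw [leibniz_lie, hx, hy, smul_lie, lie_smul, ← add_smul]
      push_cast
      rfl
    · intro y z hy hz
      rw [lie_add]; exact add_mem hy hz
  · intro x z hx hz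
    rw [add_lie]; exact add_mem hx hz

lemma upper_le {D : 𝔤} (hD : ∀ s, ⁅D, b.e s⁆ = b.e s) {x : 𝔤}
    (hx : x ∈ LieSubalgebra.lieSpan ℂ 𝔤 (Set.range b.e)) :
    x ∈ Submodule.span ℂ (Set.range b.e) ⊔ up D 2 := by
  have h1 : Submodule.span ℂ (Set.range b.e) ⊔ up D 2 ≤ up D 1 := by
    refine sup_le (Submodule.span_le.2 ?_) (up_anti (by norm_num))
    rintro _ ⟨s, rfl⟩
    exact gr_le_up (mem_gr.2 (by simp [hD]))
  induction hx using LieSubalgebra.lieSpan_induction with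
  | mem y hy => exact Submodule.mem_sup_left (Submodule.subset_span hy)
  | zero => exact zero_mem _
  | add u v _ _ hu hv => exact add_mem hu hv
  | smul t v _ hv => exact Submodule.smul_mem _ t hv
  | lie u v _ _ hu hv =>
    exact Submodule.mem_sup_right (up_anti (show (2 : ℤ) ≤ 1 + 1 by norm_num)
      (lie_up_up (h1 hu) (h1 hv)))

lemma up_le_iSup {D : 𝔤} {k l : ℤ} (h : l < k) : up D k ≤ ⨆ j, ⨆ (_ : j ≠ l), gr D j := by
  refine iSup_le fun j => ?_
  have hj : j.1 ≠ l := by have := j.2; omega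
  exact le_iSup₂ (f := fun (j : ℤ) (_ : j ≠ l) => gr D j) j.1 hj

lemma up_neg_le_iSup {D : 𝔤} {k l : ℤ} (h : l < k) :
    up (-D) k ≤ ⨆ j, ⨆ (_ : j ≠ -l), gr D j := by
  refine iSup_le fun j => ?_
  have hj : -j.1 ≠ -l := by have := j.2; omega
  rw [gr_neg]
  exact le_iSup₂ (f := fun (j : ℤ) (_ : j ≠ -l) => gr D j) (-j.1) hj

lemma gr_ext {D : 𝔤} {k : ℤ} {x y : 𝔤} (hx : x ∈ gr D k) (hy : y ∈ gr D k)
    (h : x - y ∈ ⨆ j, ⨆ (_ : j ≠ k), gr D j) : x = y := by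
  have ind : iSupIndep (gr D) :=
    (Module.End.eigenspaces_iSupIndep (LieAlgebra.ad ℂ 𝔤 D)).comp
      (f := fun k : ℤ => (k : ℂ)) Int.cast_injective
  have := ind k
  rw [Submodule.disjoint_def] at this
  exact sub_eq_zero.1 (this _ (sub_mem hx hy) h)

lemma lie_span_h {D : 𝔤} (hD : D ∈ Submodule.span ℂ (Set.range b.h)) {x : 𝔤}
    (hx : x ∈ Submodule.span ℂ (Set.range b.h)) : ⁅D, x⁆ = 0 := by
  induction hx using Submodule.span_induction with
  | mem x hx =>
    obtain ⟨s, rfl⟩ := hx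
    induction hD using Submodule.span_induction with
    | mem y hy => obtain ⟨t, rfl⟩ := hy; exact b.lie_h_h t s
    | zero => simp
    | add u v _ _ hu hv => rw [add_lie, hu, hv, add_zero]
    | smul t v _ hv => rw [smul_lie, hv, smul_zero]
  | zero => simp
  | add u v _ _ hu hv => rw [lie_add, hu, hv, add_zero]
  | smul t v _ hv => rw [lie_smul, hv, smul_zero]

variable (b) in
lemma exists_decomp (x : 𝔤) : ∃ h ∈ Submodule.span ℂ (Set.range b.h),
    ∃ l ∈ LieSubalgebra.lieSpan ℂ 𝔤 (Set.range b.f),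
    ∃ u ∈ LieSubalgebra.lieSpan ℂ 𝔤 (Set.range b.e), h + l + u = x := by
  have h1 := b.iSup_cartan_borelLower_borelUpper_eq_top
  have h2 : x ∈ 𝔥.toLieSubmodule ⊔ b.borelLower ⊔ b.borelUpper := by
    have : 𝔥.toLieSubmodule ⊔ b.borelLower ⊔ b.borelUpper = ⊤ := by simpa using h1
    rw [this]; trivial
  obtain ⟨h, hh, l, hl, u, hu, hx⟩ : ∃ᵉ (yc ∈ 𝔥) (yl ∈ LieSubalgebra.lieSpan ℂ 𝔤 (Set.range b.f))
      (yu ∈ LieSubalgebra.lieSpan ℂ 𝔤 (Set.range b.e)), yc + yl + yu = x := by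
    simpa [LieSubmodule.mem_sup] using! h2
  refine ⟨h, ?_, l, hl, u, hu, hx⟩
  have := b.coe_cartan_eq_span
  rw [← this]; exact hh

lemma gr_one_le {D : 𝔤} (he : ∀ s, ⁅D, b.e s⁆ = b.e s) (hf : ∀ s, ⁅D, b.f s⁆ = - b.f s)
    (hD : D ∈ Submodule.span ℂ (Set.range b.h)) : gr D 1 ≤ Submodule.span ℂ (Set.range b.e) := by
  intro x hx
  obtain ⟨h, hh, l, hl, u, hu, hsum⟩ := exists_decomp b x
  have hl' := upper_le (b := b.symm) (D := -D) (fun s => neg_lie_f (hf s)) hl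
  obtain ⟨e', he', u2, hu2, rfl⟩ := Submodule.mem_sup.1 (upper_le he hu)
  have he1 : e' ∈ gr D 1 := by
    have : Submodule.span ℂ (Set.range b.e) ≤ gr D 1 := by
      rw [Submodule.span_le]
      rintro _ ⟨s, rfl⟩
      exact mem_gr.2 (by simp [he])
    exact this he'
  have : x = e' := by
    refine gr_ext hx he1 ?_
    rw [← hsum, show h + l + (e' + u2) - e' = h + l + u2 by abel]
    refine add_mem (add_mem ?_ ?_) (up_le_iSup (by norm_num) hu2)
    · have h0 : h ∈ gr D 0 := mem_gr.2 (by simp [lie_span_h hD hh])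
      exact le_iSup₂_of_le (f := fun (j : ℤ) (_ : j ≠ 1) => gr D j) 0 (by norm_num) le_rfl h0
    · have h1 : Submodule.span ℂ (Set.range b.symm.e) ⊔ up (-D) 2 ≤ up (-D) 1 := by
        refine sup_le (Submodule.span_le.2 ?_) (up_anti (by norm_num))
        rintro _ ⟨s, rfl⟩
        exact gr_le_up (mem_gr.2 (by rw [neg_lie_f (hf s)]; simp))
      have := up_neg_le_iSup (D := D) (k := 1) (l := -1) (by norm_num) (h1 hl')
      simpa using this
  rw [this]; exact he'

lemma gr_zero_le {D : 𝔤} (he : ∀ s, ⁅D, b.e s⁆ = b.e s) (hf : ∀ s, ⁅D, b.f s⁆ = - b.f s)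
    (hD : D ∈ Submodule.span ℂ (Set.range b.h)) : gr D 0 ≤ Submodule.span ℂ (Set.range b.h) := by
  intro x hx
  obtain ⟨h, hh, l, hl, u, hu, hsum⟩ := exists_decomp b x
  have hl' := upper_le (b := b.symm) (D := -D) (fun s => neg_lie_f (hf s)) hl
  have hu' := upper_le he hu
  have : x = h := by
    refine gr_ext hx (mem_gr.2 (by simp [lie_span_h hD hh])) ?_
    rw [← hsum, show h + l + u - h = l + u by abel]
    refine add_mem ?_ ?_
    · have h1 : Submodule.span ℂ (Set.range b.symm.e) ⊔ up (-D) 2 ≤ up (-D) 1 := by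
        refine sup_le (Submodule.span_le.2 ?_) (up_anti (by norm_num))
        rintro _ ⟨s, rfl⟩
        exact gr_le_up (mem_gr.2 (by rw [neg_lie_f (hf s)]; simp))
      have := up_neg_le_iSup (D := D) (k := 1) (l := 0) (by norm_num) (h1 hl')
      simpa using this
    · have h1 : Submodule.span ℂ (Set.range b.e) ⊔ up D 2 ≤ up D 1 := by
        refine sup_le (Submodule.span_le.2 ?_) (up_anti (by norm_num))
        rintro _ ⟨s, rfl⟩
        exact gr_le_up (mem_gr.2 (by simp [he]))
      exact up_le_iSup (by norm_num) (h1 hu')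
  rw [this]; exact hh

variable (b) in
/-- An involution in `G` which maps the grading element to its negative. -/
lemma exists_flip [FiniteDimensional ℂ 𝔤] {D : 𝔤} (he : ∀ s, ⁅D, b.e s⁆ = b.e s)
    (hf : ∀ s, ⁅D, b.f s⁆ = - b.f s) (hD : D ∈ Submodule.span ℂ (Set.range b.h)) :
    ∃ n : G b, n * n = 1 ∧ n.1 D = - D := by
  have := Fintype.ofFinite S
  obtain ⟨c, hc⟩ : ∃ c : S → ℂ, ∑ s, c s • b.h s = D := by
    rw [Submodule.mem_span_range_iff_exists_fun] at hD
    exact hD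
  set E : 𝔤 := ∑ s, b.e s
  set F : 𝔤 := ∑ s, (2 * c s) • b.f s
  have hDE : ⁅D, E⁆ = E := by
    rw [lie_sum]; exact Finset.sum_congr rfl fun s _ => he s
  have hDF : ⁅D, F⁆ = - F := by
    rw [lie_sum, ← Finset.sum_neg_distrib]
    exact Finset.sum_congr rfl fun s _ => by rw [lie_smul, hf, smul_neg]
  have hEF : ⁅E, F⁆ = (2 : ℂ) • D := by
    rw [sum_lie, ← hc, Finset.smul_sum]
    refine Finset.sum_congr rfl fun s _ => ?_
    rw [lie_sum, Finset.sum_eq_single s]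
    · rw [lie_smul, (b.sl2 s).lie_e_f, smul_smul]
    · intro t _ hts
      rw [lie_smul, b.lie_e_f_ne s t hts.symm, smul_zero]
    · simp
  have hED : ⁅E, D⁆ = - E := by rw [← lie_skew, hDE]
  have hFD : ⁅F, D⁆ = F := by rw [← lie_skew, hDF, neg_neg]
  have htop : ⨆ μ, (LieAlgebra.ad ℂ 𝔤 D).eigenspace μ = ⊤ :=
    diag_top (b := b) (z := fun _ => 1) (fun s => by simp [he]) (fun s => by simp [hf])
  have hnE : IsNilpotent (LieAlgebra.ad ℂ 𝔤 (-E)) :=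
    ad_nilpotent htop (c := 1) (by norm_num) (by simp [hDE])
  have hnF : IsNilpotent (LieAlgebra.ad ℂ 𝔤 ((1 / 2 : ℂ) • F)) :=
    ad_nilpotent htop (c := -1) (by norm_num) (by rw [lie_smul, hDF]; simp)
  obtain ⟨x, hx, hxE⟩ := exists_adExp hnE
  obtain ⟨y, hy, hyF⟩ := exists_adExp hnF
  have hyD : y D = D + (1 / 2 : ℂ) • F := by
    have h1 : y D = adExp ((1 / 2 : ℂ) • F) D := by rw [← hyF]; rfl
    have h2 : ⁅(1 / 2 : ℂ) • F, D⁆ = (1 / 2 : ℂ) • F := by rw [smul_lie, hFD]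
    rw [h1, adExp_apply hnF (by rw [h2]; simp), h2]
    simp
  have hxD : x (D + (1 / 2 : ℂ) • F) = (1 / 2 : ℂ) • (E + F) := by
    have h0 : ∀ z, x z = adExp (-E) z := fun z => by rw [← hxE]; rfl
    have h2 : ⁅-E, D⁆ = E := by rw [neg_lie, hED, neg_neg]
    have h3 : ⁅-E, F⁆ = - ((2 : ℂ) • D) := by rw [neg_lie, hEF]
    rw [map_add, map_smul, h0, h0, adExp_apply hnE (by rw [h2]; simp),
      adExp_apply hnE (by rw [h3, lie_neg, lie_smul, h2]; simp), h3, lie_neg, lie_smul, h2]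
    simp only [neg_lie, lie_self, neg_zero]
    module
  obtain ⟨τ, hτ, hτd⟩ := exists_adDiag (Z := (Real.pi * Complex.I) • D) (diag_top (b := b)
    (z := fun _ => Real.pi * Complex.I) (fun s => by rw [smul_lie, he])
    (fun s => by rw [smul_lie, hf, smul_neg]))
  have hτe : ∀ s, τ (b.e s) = - b.e s := fun s => by
    rw [hτd (Real.pi * Complex.I) _ (by rw [smul_lie, he]), Complex.exp_pi_mul_I]; simp
  have hτf : ∀ s, τ (b.f s) = - b.f s := fun s => by
    rw [hτd (-(Real.pi * Complex.I)) _ (by rw [smul_lie, hf, smul_neg, neg_smul]),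
      Complex.exp_neg, Complex.exp_pi_mul_I]; norm_num
  have hτE : τ E = - E := by simp [E, hτe]
  have hτF : τ F = - F := by simp [F, hτf]
  let x' : G b := ⟨x, Subgroup.subset_closure (Or.inl ⟨hx, _, hnE, hxE⟩)⟩
  let y' : G b := ⟨y, Subgroup.subset_closure (Or.inl ⟨hy, _, hnF, hyF⟩)⟩
  let τ' : G b := ⟨τ, Subgroup.subset_closure (Or.inr ⟨hτ, fun _ => -1, fun s =>
    ⟨by rw [hτe]; simp, by rw [hτf]; simp [Units.smul_def]⟩⟩)⟩
  have hττ : τ' * τ' = 1 := by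
    apply G.ext_gens
    · intro s
      change τ (τ (b.e s)) = b.e s
      rw [hτe, map_neg, hτe, neg_neg]
    · intro s
      change τ (τ (b.f s)) = b.f s
      rw [hτf, map_neg, hτf, neg_neg]
  have hg : (x' * y').1 D = (1 / 2 : ℂ) • (E + F) := by
    change x (y D) = _
    rw [hyD, hxD]
  refine ⟨(x' * y')⁻¹ * τ' * (x' * y'), ?_, ?_⟩
  · have : (x' * y')⁻¹ * τ' * (x' * y') * ((x' * y')⁻¹ * τ' * (x' * y')) =
        (x' * y')⁻¹ * (τ' * τ') * (x' * y') := by group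
    rw [this, hττ]; group
  · change (x' * y')⁻¹.1 (τ ((x' * y').1 D)) = _
    rw [hg, map_smul, map_add, hτE, hτF, ← neg_add, smul_neg, ← hg, map_neg]
    change - ((x' * y')⁻¹ * (x' * y')).1 D = _
    rw [inv_mul_cancel]; rfl

variable (b) in
/-- The lift `\overline{w_0}` exists. -/
lemma nonempty_longestLift [FiniteDimensional ℂ 𝔤] : Nonempty (LongestLift b) := by
  classical
  have := Fintype.ofFinite S
  obtain ⟨D, he, hf, hD⟩ := exists_grading b
  obtain ⟨n, hnn, hnD⟩ := exists_flip b he hf hD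
  have hn2 : ∀ x, n.1 (n.1 x) = x := fun x => by
    have := congrArg (fun g : G b => g.1 x) hnn
    simpa using this
  have hgr : ∀ (k : ℤ) (x : 𝔤), x ∈ gr D k → n.1 x ∈ gr D (-k) := by
    intro k x hx
    rw [mem_gr] at *
    have h1 : ⁅n.1 D, n.1 x⁆ = (k : ℂ) • n.1 x := by rw [← G.map_lie, hx, map_smul]
    rw [hnD, neg_lie, neg_eq_iff_eq_neg] at h1
    rw [h1]; simp
  have hfe : gr D (-1) ≤ Submodule.span ℂ (Set.range b.f) := by
    have := gr_one_le (b := b.symm) (D := -D) (fun s => neg_lie_f (hf s))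
      (fun s => by
        change ⁅-D, b.e s⁆ = - b.e s
        rw [neg_lie, he])
      (by
        have : Submodule.span ℂ (Set.range b.symm.h) = Submodule.span ℂ (Set.range b.h) := by
          rw [LieAlgebra.Basis.symm_h, ← Set.neg_range', Submodule.span_neg]
        rw [this]; exact neg_mem hD)
    rwa [gr_neg] at this
  have hes := gr_one_le he hf hD
  obtain ⟨z, hz⟩ : ∃ z : S → ℂ, Function.Injective z :=
    ⟨fun s => ((Fintype.equivFin S s : ℕ) : ℂ), fun s t h => by
      have h1 : ((Fintype.equivFin S s : ℕ)) = (Fintype.equivFin S t : ℕ) := Nat.cast_injective (R := ℂ) h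
      exact (Fintype.equivFin S).injective (Fin.ext h1)⟩
  obtain ⟨Z, hZ, hZe, hZf⟩ := exists_weight b z
  have hnZ : n.1 Z ∈ Submodule.span ℂ (Set.range b.h) := by
    apply gr_zero_le he hf hD
    have := hgr 0 Z (mem_gr.2 (by simp [lie_span_h hD hZ]))
    simpa using this
  have hwt : ∀ X ∈ Submodule.span ℂ (Set.range b.h), ∀ s, ∃ ν : ℂ, ⁅X, b.e s⁆ = ν • b.e s ∧
      ⁅X, b.f s⁆ = - (ν • b.f s) := by
    intro X hX s
    induction hX using Submodule.span_induction with
    | mem x hx =>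
      obtain ⟨t, rfl⟩ := hx
      exact ⟨b.A s t, by rw [b.lie_h_e, Int.cast_smul_eq_zsmul],
        by rw [b.lie_h_f, Int.cast_smul_eq_zsmul, neg_smul]⟩
    | zero => exact ⟨0, by simp, by simp⟩
    | add u v _ _ hu hv =>
      obtain ⟨μ, h1, h2⟩ := hu
      obtain ⟨ν, h3, h4⟩ := hv
      exact ⟨μ + ν, by rw [add_lie, h1, h3, add_smul], by rw [add_lie, h2, h4, add_smul]; abel⟩
    | smul t v _ hv =>
      obtain ⟨ν, h3, h4⟩ := hv
      exact ⟨t * ν, by rw [smul_lie, h3, smul_smul], by rw [smul_lie, h4, smul_neg, smul_smul]⟩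
  choose ν hνe hνf using hwt _ hnZ
  have hle : LinearIndependent ℂ b.e :=
    Module.End.eigenvectors_linearIndependent' (LieAlgebra.ad ℂ 𝔤 Z) z hz _ fun s =>
      ⟨Module.End.mem_eigenspace_iff.2 (hZe s), (b.sl2 s).e_ne_zero⟩
  have hlf : LinearIndependent ℂ b.f :=
    Module.End.eigenvectors_linearIndependent' (LieAlgebra.ad ℂ 𝔤 Z) (fun s => - z s)
      (fun s t h => hz (neg_injective h)) _ fun s =>
      ⟨Module.End.mem_eigenspace_iff.2 (by simp [hZf]), (b.sl2 s).f_ne_zero⟩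
  have hZne : ∀ s, ⁅Z, n.1 (b.e s)⁆ = ν s • n.1 (b.e s) := fun s => by
    conv_lhs => rw [← hn2 Z]
    rw [← G.map_lie, hνe, map_smul]
  have hZnf : ∀ s, ⁅Z, n.1 (b.f s)⁆ = - (ν s • n.1 (b.f s)) := fun s => by
    conv_lhs => rw [← hn2 Z]
    rw [← G.map_lie, hνf, map_neg, map_smul]
  have hE : ∀ s, ∃ t, ∃ a : ℂ, z t = - ν s ∧ a ≠ 0 ∧ n.1 (b.e s) = a • b.f t := by
    intro s
    have h1 : n.1 (b.e s) ∈ Submodule.span ℂ (Set.range b.f) :=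
      hfe (hgr 1 _ (mem_gr.2 (by simp [he])))
    obtain ⟨m, hm⟩ := (Submodule.mem_span_range_iff_exists_fun ℂ).1 h1
    have h2 : ∀ t, m t * (- z t - ν s) = 0 := by
      refine Fintype.linearIndependent_iff.1 hlf _ ?_
      have h3 := hZne s
      rw [← hm, lie_sum, Finset.smul_sum, ← sub_eq_zero, ← Finset.sum_sub_distrib] at h3
      rw [← h3]
      refine Finset.sum_congr rfl fun t _ => ?_
      rw [lie_smul, hZf]
      module
    have h4 : n.1 (b.e s) ≠ 0 := fun h => (b.sl2 s).e_ne_zero (by simpa using h)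
    obtain ⟨t, ht⟩ : ∃ t, m t ≠ 0 := by
      by_contra! h
      exact h4 (by rw [← hm]; simp [h])
    have h5 : ∀ t, m t ≠ 0 → z t = - ν s := fun t ht => by
      have := (mul_eq_zero.1 (h2 t)).resolve_left ht
      linear_combination -this
    refine ⟨t, m t, h5 t ht, ht, ?_⟩
    rw [← hm]
    refine Finset.sum_eq_single t (fun t' _ h => ?_) (by simp)
    by_cases h' : m t' = 0
    · rw [h', zero_smul]
    · exact absurd (hz ((h5 t' h').trans (h5 t ht).symm)) h
  have hF : ∀ s, ∃ t, ∃ a : ℂ, z t = - ν s ∧ n.1 (b.f s) = a • b.e t := by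
    intro s
    have h1 : n.1 (b.f s) ∈ Submodule.span ℂ (Set.range b.e) := by
      apply hes
      have := hgr (-1) _ (mem_gr.2 (show ⁅D, b.f s⁆ = ((-1 : ℤ) : ℂ) • b.f s by simp [hf]))
      simpa using this
    obtain ⟨m, hm⟩ := (Submodule.mem_span_range_iff_exists_fun ℂ).1 h1
    have h2 : ∀ t, m t * (z t + ν s) = 0 := by
      refine Fintype.linearIndependent_iff.1 hle _ ?_
      have h3 := hZnf s
      rw [← hm, lie_sum, Finset.smul_sum, ← sub_eq_zero, sub_neg_eq_add,
        ← Finset.sum_add_distrib] at h3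
      rw [← h3]
      refine Finset.sum_congr rfl fun t _ => ?_
      rw [lie_smul, hZe]
      module
    have h4 : n.1 (b.f s) ≠ 0 := fun h => (b.sl2 s).f_ne_zero (by simpa using h)
    obtain ⟨t, ht⟩ : ∃ t, m t ≠ 0 := by
      by_contra! h
      exact h4 (by rw [← hm]; simp [h])
    have h5 : ∀ t, m t ≠ 0 → z t = - ν s := fun t ht => by
      have := (mul_eq_zero.1 (h2 t)).resolve_left ht
      linear_combination this
    refine ⟨t, m t, h5 t ht, ?_⟩
    rw [← hm]
    refine Finset.sum_eq_single t (fun t' _ h => ?_) (by simp)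
    by_cases h' : m t' = 0
    · rw [h', zero_smul]
    · exact absurd (hz ((h5 t' h').trans (h5 t ht).symm)) h
  choose p a hp ha hne using hE
  choose p' d hp' hnf' using hF
  have hnf : ∀ s, n.1 (b.f s) = d s • b.e (p s) := fun s => by
    rw [hnf', hz ((hp' s).trans (hp s).symm)]
  have had : ∀ s, a s * d s = 1 := by
    intro s
    have h1 : n.1 (b.h s) = - ((a s * d s) • b.h (p s)) := by
      rw [← (b.sl2 s).lie_e_f, G.map_lie, hne, hnf, smul_lie, lie_smul, ← lie_skew,
        (b.sl2 (p s)).lie_e_f, smul_neg, smul_neg, smul_smul]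
    have h2 : n.1 ⁅b.h s, b.e s⁆ = ⁅n.1 (b.h s), n.1 (b.e s)⁆ := G.map_lie n _ _
    rw [(b.sl2 s).lie_h_e_smul ℂ, map_smul, h1, hne, neg_lie, smul_lie, lie_smul,
      (b.sl2 (p s)).lie_lie_smul_f ℂ] at h2
    have h3 : (2 * a s * (a s * d s - 1)) • b.f (p s) = 0 := by
      have h4 := sub_eq_zero.2 h2
      rw [← neg_eq_zero, ← h4]
      module
    have h5 := (smul_eq_zero.1 h3).resolve_right (b.sl2 (p s)).f_ne_zero
    have h6 := (mul_eq_zero.1 h5).resolve_left (mul_ne_zero two_ne_zero (ha s))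
    linear_combination h6
  have hinv : ∀ s, a s • d (p s) • b.e (p (p s)) = b.e s := fun s => by
    rw [← hnf, ← map_smul, ← hne, hn2]
  have hpp : ∀ s, p (p s) = s := by
    intro s
    by_contra hs
    have h1 := hinv s
    have h2 : ⁅Z, a s • d (p s) • b.e (p (p s))⁆ = ⁅Z, b.e s⁆ := by rw [h1]
    rw [lie_smul, lie_smul, hZe, hZe, smul_comm (d (p s)), smul_comm (a s), h1] at h2
    have h3 : (z (p (p s)) - z s) • b.e s = 0 := by rw [sub_smul, h2, sub_self]
    have h4 := (smul_eq_zero.1 h3).resolve_right (b.sl2 s).e_ne_zero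
    exact hs (hz (sub_eq_zero.1 h4))
  have hap : ∀ s, a (p s) = a s := by
    intro s
    have h1 := hinv s
    rw [hpp, smul_smul] at h1
    have h2 : (a s * d (p s) - 1) • b.e s = 0 := by rw [sub_smul, h1, one_smul, sub_self]
    have h3 := (smul_eq_zero.1 h2).resolve_right (b.sl2 s).e_ne_zero
    have h4 := had (p s)
    linear_combination a (p s) * h3 * (-1) + a s * h4
  obtain ⟨y, hy⟩ : ∃ y : S → ℂ, ∀ s, Complex.exp (y s) = - a s :=
    ⟨fun s => Complex.log (- a s), fun s => Complex.exp_log (neg_ne_zero.2 (ha s))⟩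
  obtain ⟨Y, hY, hYe, hYf⟩ := exists_weight b y
  obtain ⟨θ, hθ, hθd⟩ := exists_adDiag (Z := Y) (diag_top hYe hYf)
  have hθe : ∀ s, θ (b.e s) = (- a s) • b.e s := fun s => by rw [hθd _ _ (hYe s), hy]
  have hθf : ∀ s, θ (b.f s) = (- a s)⁻¹ • b.f s := fun s => by
    rw [hθd (- y s) _ (by rw [hYf, neg_smul]), Complex.exp_neg, hy]
  let θ' : G b := ⟨θ, Subgroup.subset_closure (Or.inr ⟨hθ,
    fun s => Units.mk0 (- a s) (neg_ne_zero.2 (ha s)), fun s =>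
      ⟨by rw [hθe]; rfl, by rw [hθf, Units.smul_def]; simp⟩⟩)⟩
  refine ⟨⟨θ' * n, p, hpp, fun s => ?_, fun s => ?_⟩⟩
  · change θ (n.1 (b.e s)) = _
    rw [hne, map_smul, hθf, hap, smul_smul, inv_neg, mul_neg, mul_inv_cancel₀ (ha s)]
    simp
  · change θ (n.1 (b.f s)) = _
    rw [hnf, map_smul, hθe, hap, smul_smul, mul_neg, mul_comm, had]
    simp

variable (b) in
/-- The lift `\overline{w_0}`. -/
def longestLift [FiniteDimensional ℂ 𝔤] : LongestLift b := (nonempty_longestLift b).some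


/-! ### Flags, pinnings and configurations of triples of pinnings -/

variable (b) in
/-- The principal affine space `G / U⁺`, the set of decorated flags. -/
abbrev DecFlag : Type _ := G b ⧸ Uplus b

variable (b) in
/-- The flag variety `G / B⁺`. -/
abbrev Flag : Type _ := G b ⧸ Bplus b

/-- The projection `G / U⁺ → G / B⁺`. -/
def DecFlag.proj (A : DecFlag b) : Flag b :=
  Subgroup.quotientMapOfLE (le_sup_right : Uplus b ≤ Bplus b) A

lemma DecFlag.proj_smul (g : G b) (A : DecFlag b) : (g • A).proj = g • A.proj := by
  induction A using QuotientGroup.induction_on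
  rfl

variable (b) in
/-- The base point `B⁺` of the flag variety. -/
def flagPlus : Flag b := QuotientGroup.mk 1

/-- The flag `B⁻ = \overline{w_0}.B⁺`. -/
def flagMinus (w : LongestLift b) : Flag b := w.elt • flagPlus b

/-- A pair of flags is generic if it lies in the `G`-orbit of `(B⁺, B⁻)`. -/
def IsGeneric (w : LongestLift b) (B₁ B₂ : Flag b) : Prop :=
  ∃ g : G b, g • B₁ = flagPlus b ∧ g • B₂ = flagMinus w

/-- A pinning: a decorated flag and a flag such that the underlying pair of flags is generic. -/
def Pinning (w : LongestLift b) : Type _ :=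
  {p : DecFlag b × Flag b // IsGeneric w p.1.proj p.2}

namespace Pinning

variable {w : LongestLift b}

/-- `π₊(p)`, the first underlying flag. -/
def fst (p : Pinning w) : Flag b := p.1.1.proj

/-- `π₋(p)`, the second underlying flag. -/
def snd (p : Pinning w) : Flag b := p.1.2

instance : MulAction (G b) (Pinning w) where
  smul g p := ⟨(g • p.1.1, g • p.1.2), by
    obtain ⟨k, h1, h2⟩ := p.2
    refine ⟨k * g⁻¹, ?_, ?_⟩
    · rw [DecFlag.proj_smul, smul_smul, inv_mul_cancel_right, h1]
    · rw [smul_smul, inv_mul_cancel_right, h2]⟩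
  one_smul p := Subtype.ext (Prod.ext (one_smul _ _) (one_smul _ _))
  mul_smul g h p := Subtype.ext (Prod.ext (mul_smul _ _ _) (mul_smul _ _ _))

lemma fst_smul (g : G b) (p : Pinning w) : (g • p).fst = g • p.fst := DecFlag.proj_smul _ _

lemma snd_smul (g : G b) (p : Pinning w) : (g • p).snd = g • p.snd := rfl

variable (w) in
/-- The standard pinning `p_std = ([U⁺], B⁻)`. -/
def std : Pinning w := ⟨(QuotientGroup.mk 1, flagMinus w), 1, one_smul _ _, one_smul _ _⟩

end Pinning

lemma cartan_normalizes {h u : G b} (hh : h ∈ cartan b) (hu : u ∈ Uplus b) :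
    h * u * h⁻¹ ∈ Uplus b := by
  induction hu using Subgroup.closure_induction with
  | mem x hx =>
    apply Subgroup.subset_closure
    obtain ⟨-, s, t, hst⟩ := hx
    obtain ⟨c, hc⟩ := hh
    refine ⟨fun y z => G.map_lie (h * x * h⁻¹) y z, s, c s * t, ?_⟩
    have hx : ∀ y, x.1 y = adExp (t • b.e s) y := fun y => by rw [← hst]; rfl
    have hcomm : ∀ (n : ℕ) (y : 𝔤), ((LieAlgebra.ad ℂ 𝔤 ((c s * t) • b.e s)) ^ n) (h.1 y) =
        h.1 (((LieAlgebra.ad ℂ 𝔤 (t • b.e s)) ^ n) y) := by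
      intro n y
      induction n with
      | zero => simp
      | succ n ih =>
        rw [pow_succ', pow_succ', Module.End.mul_apply, Module.End.mul_apply, ih,
          LieAlgebra.ad_apply, LieAlgebra.ad_apply, G.map_lie, LinearEquiv.map_smul, (hc s).1,
          smul_smul, mul_comm]
    ext y
    obtain ⟨y, rfl⟩ := h.1.surjective y
    have h1 : (h * x * h⁻¹).1 (h.1 y) = h.1 (x.1 y) := by simp
    change (h * x * h⁻¹).1 (h.1 y) = _
    rw [h1, hx, adExp, adExp]
    rw [LinearMap.sum_apply, LinearMap.sum_apply, map_sum]
    refine Finset.sum_congr rfl fun n _ => ?_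
    rw [LinearMap.smul_apply, LinearMap.smul_apply, LinearEquiv.map_smul, hcomm]
  | one => simp [one_mem]
  | mul g k _ _ hg hk =>
    have := mul_mem hg hk
    simpa [mul_assoc] using this
  | inv g _ hg =>
    have := inv_mem hg
    simpa [mul_assoc] using this

lemma Bplus_eq_mul {g : G b} (hg : g ∈ Bplus b) : ∃ h ∈ cartan b, ∃ u ∈ Uplus b, g = h * u := by
  rw [Bplus, Subgroup.sup_eq_closure] at hg
  induction hg using Subgroup.closure_induction with
  | mem x hx =>
    rcases hx with hx | hx
    · exact ⟨x, hx, 1, one_mem _, by simp⟩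
    · exact ⟨1, one_mem _, x, hx, by simp⟩
  | one => exact ⟨1, one_mem _, 1, one_mem _, by simp⟩
  | mul g k _ _ hg hk =>
    obtain ⟨h, hh, u, hu, rfl⟩ := hg
    obtain ⟨h', hh', u', hu', rfl⟩ := hk
    refine ⟨h * h', mul_mem hh hh', (h'⁻¹ * u * h') * u', mul_mem ?_ hu', by group⟩
    simpa using cartan_normalizes (inv_mem hh') hu
  | inv g _ hg =>
    obtain ⟨h, hh, u, hu, rfl⟩ := hg
    exact ⟨h⁻¹, inv_mem hh, h * u⁻¹ * h⁻¹, cartan_normalizes hh (inv_mem hu), by group⟩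

lemma cartan_smul_flagMinus (w : LongestLift b) {h : G b} (hh : h ∈ cartan b) :
    h • flagMinus w = flagMinus w := by
  rw [flagMinus, smul_smul]
  have h1 : h * w.elt = w.elt * (w.elt⁻¹ * h * w.elt) := by group
  have h2 : w.elt⁻¹ * h * w.elt ∈ cartan b := by
    rw [inv_eq_of_mul_eq_one_left w.mul_self]
    obtain ⟨c, hc⟩ := hh
    refine ⟨fun s => (c (w.star s))⁻¹, fun s => ⟨?_, ?_⟩⟩
    · simp [w.elt_e, w.elt_f, (hc _).2, w.star_star, Units.smul_def]
    · simp [w.elt_e, w.elt_f, (hc _).1, w.star_star, Units.smul_def]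
  rw [h1, mul_smul]
  congr 1
  rw [flagPlus, MulAction.Quotient.smul_mk, QuotientGroup.eq]
  have h3 : w.elt⁻¹ * h * w.elt ∈ Bplus b := (le_sup_left : cartan b ≤ Bplus b) h2
  simpa using inv_mem h3

namespace Pinning

variable {w : LongestLift b}

/-- Every pinning is of the form `g.p_std`. -/
lemma exists_frame (p : Pinning w) : ∃ g : G b, g • std w = p := by
  obtain ⟨⟨A, B⟩, k, h1, h2⟩ := p
  induction A using QuotientGroup.induction_on with
  | H a =>
  have h3 : k * a ∈ Bplus b := by
    have : QuotientGroup.mk (k * a) = flagPlus b := h1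
    rw [flagPlus, eq_comm, QuotientGroup.eq] at this
    simpa using this
  obtain ⟨h, hh, u, hu, hku⟩ := Bplus_eq_mul h3
  refine ⟨k⁻¹ * h, Subtype.ext (Prod.ext ?_ ?_)⟩
  · change (k⁻¹ * h) • (QuotientGroup.mk 1 : DecFlag b) = QuotientGroup.mk a
    rw [MulAction.Quotient.smul_mk, QuotientGroup.eq]
    have : (k⁻¹ * h) • (1 : G b) = a * u⁻¹ := by
      rw [smul_eq_mul, mul_one, eq_mul_inv_iff_mul_eq, mul_assoc, ← hku]; group
    rw [this]
    simpa using hu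
  · change (k⁻¹ * h) • flagMinus w = B
    rw [mul_smul, cartan_smul_flagMinus w hh, ← h2]
    simp

/-- The action of `G` on pinnings is free. -/
lemma smul_std_injective [FiniteDimensional ℂ 𝔤] {g g' : G b} (h : g • std w = g' • std w) :
    g = g' := by
  have h0 : (g'⁻¹ * g) • std w = std w := by rw [mul_smul, h]; simp
  have h1 : (g'⁻¹ * g) • (QuotientGroup.mk 1 : DecFlag b) = QuotientGroup.mk 1 :=
    congrArg (fun p : Pinning w => p.1.1) h0
  have h2 : (g'⁻¹ * g) • flagMinus w = flagMinus w :=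
    congrArg (fun p : Pinning w => p.1.2) h0
  have h3 : g'⁻¹ * g ∈ Uplus b := by
    rw [MulAction.Quotient.smul_mk, eq_comm, QuotientGroup.eq] at h1
    simpa using h1
  have h4 : w.elt⁻¹ * (g'⁻¹ * g) * w.elt ∈ Bplus b := by
    rw [flagMinus, flagPlus, smul_smul, MulAction.Quotient.smul_mk, MulAction.Quotient.smul_mk,
      eq_comm, QuotientGroup.eq] at h2
    simpa [mul_assoc] using h2
  have := Uplus_inter w h3 h4
  rwa [inv_mul_eq_one, eq_comm] at this

/-- The unique element `g` with `p = g.p_std`. -/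
def frame (p : Pinning w) : G b := p.exists_frame.choose

lemma frame_smul_std (p : Pinning w) : p.frame • std w = p := p.exists_frame.choose_spec

lemma frame_smul [FiniteDimensional ℂ 𝔤] (g : G b) (p : Pinning w) :
    (g • p).frame = g * p.frame := by
  apply smul_std_injective (w := w)
  rw [frame_smul_std, mul_smul, frame_smul_std]

/-- The opposite pinning: `(g.p_std)^* = g \overline{w_0}.p_std`. -/
def opp (p : Pinning w) : Pinning w := (p.frame * w.elt) • std w

end Pinning

/-- Triples of flags and pinnings `(p_{12}, p_{23}, p_{31})`, where `p_{i,i+1}` is a pinning over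
`(B_i, B_{i+1})`: the flags are determined by the pinnings, which have to satisfy
`π₋(p_{i-1,i}) = π₊(p_{i,i+1})`. The pinning `p_{i,i+1}` has the index `i - 1`. -/
def PreConf (w : LongestLift b) : Type _ :=
  {p : ZMod 3 → Pinning w // ∀ i, (p i).snd = (p (i + 1)).fst}

instance (w : LongestLift b) : MulAction (G b) (PreConf w) where
  smul g p := ⟨fun i => g • p.1 i, fun i => by
    rw [Pinning.snd_smul, Pinning.fst_smul, p.2]⟩
  one_smul p := Subtype.ext (funext fun _ => one_smul _ _)
  mul_smul g h p := Subtype.ext (funext fun _ => mul_smul _ _ _)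

/-- The configuration space `Conf_3 P_G` of `G`-orbits. -/
def Conf (w : LongestLift b) : Type _ := MulAction.orbitRel.Quotient (G b) (PreConf w)

/-- The orbit `[p_{12}, p_{23}, p_{31}]`. -/
def Conf.mk {w : LongestLift b} (p : PreConf w) : Conf w :=
  Quotient.mk (MulAction.orbitRel (G b) (PreConf w)) p

lemma Conf.sound {w : LongestLift b} {p q : PreConf w} (g : G b)
    (h : ∀ i, p.1 i = g • q.1 i) : Conf.mk p = Conf.mk q :=
  Quotient.sound (s := MulAction.orbitRel (G b) (PreConf w)) ⟨g, Subtype.ext (funext fun i => (h i).symm)⟩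

/-- The cyclic shift `[p_{12}, p_{23}, p_{31}] ↦ [p_{23}, p_{31}, p_{12}]` by `k` steps. -/
def Conf.shiftBy {w : LongestLift b} (k : ZMod 3) : Conf w → Conf w :=
  Quotient.lift (fun p : PreConf w => Conf.mk ⟨fun i => p.1 (i + k), fun i => by
      rw [p.2, add_right_comm]⟩) (by
    rintro p q ⟨g, rfl⟩
    exact Conf.sound g fun i => rfl)

/-- The cyclic shift `S_3 : [p_{12}, p_{23}, p_{31}] ↦ [p_{23}, p_{31}, p_{12}]`, a permutation of
`Conf_3 P_G`. -/
def Conf.cyc {w : LongestLift b} : Equiv.Perm (Conf w) where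
  toFun := Conf.shiftBy 1
  invFun := Conf.shiftBy (-1)
  left_inv c := by
    induction c using Quotient.inductionOn
    exact Conf.sound 1 fun i => by simp
  right_inv c := by
    induction c using Quotient.inductionOn
    exact Conf.sound 1 fun i => by simp

/-- The two turning directions, left and right. -/
inductive Turn where
  | L
  | R

/-- The basic Wilson lines
`b_L [g₁.p_std, g₂.p_std, g₃.p_std] = g₁⁻¹ g₃ \overline{w_0}` and
`b_R [g₁.p_std, g₂.p_std, g₃.p_std] = g₃⁻¹ g₁ \overline{w_0}`. Equivalently
`p_{31} = (b_L.p_std)^*` if `p_{12} = p_std`, and `p_{12} = (b_R.p_std)^*` if `p_{31} = p_std`. -/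
def basicWilson [FiniteDimensional ℂ 𝔤] {w : LongestLift b} (τ : Turn) : Conf w → G b :=
  Quotient.lift (fun p : PreConf w => match τ with
      | Turn.L => (p.1 0).frame⁻¹ * (p.1 2).frame * w.elt
      | Turn.R => (p.1 2).frame⁻¹ * (p.1 0).frame * w.elt) (by
    rintro p q ⟨g, rfl⟩
    have : ∀ i, ((g • q : PreConf w).1 i).frame = g * (q.1 i).frame := fun i =>
      Pinning.frame_smul g (q.1 i)
    cases τ <;> simp [this, mul_assoc])

end Group

/-! ### Marked surfaces and the moduli spaces of framed local systems with pinnings -/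

/-- The underlying data of a marked surface: a space, the set of marked points, and the boundary
intervals, parametrised from their initial to their terminal marked point according to the boundary
orientation. The surfaces of interest are those with an `IdealTriangulation`, defined below. -/
structure MarkedSurface where
  /-- the underlying space -/
  carrier : Type*
  [top : TopologicalSpace carrier]
  /-- the set of marked points (punctures and special points) -/
  marked : Set carrier
  /-- the set of boundary intervals -/
  Edge : Type
  /-- the parametrisation of the boundary intervals (closed up by their end points) -/
  edge : Edge → C(unitInterval, carrier)
  edge_mem_marked : ∀ E t, edge E t ∈ marked ↔ t = 0 ∨ t = 1

attribute [instance] MarkedSurface.top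

/-- The open interval. -/
abbrev OpenI : Type := Set.Ioo (0 : ℝ) 1

namespace OpenI

/-- A point of the open interval as a point of the closed one. -/
def toI (t : OpenI) : I := ⟨t.1, t.2.1.le, t.2.2.le⟩

lemma continuous_toI : Continuous toI := by unfold toI; fun_prop

/-- The reflected point `1 - t`. -/
def refl (t : OpenI) : OpenI := ⟨1 - t.1, by linarith [t.2.2], by linarith [t.2.1]⟩

/-- The midpoint. -/
def half : OpenI := ⟨1 / 2, by norm_num, by norm_num⟩

/-- The straight path between two points of the open interval. -/
def seg (s t : OpenI) : Path s t where
  toFun u := ⟨(1 - u.1) * s.1 + u.1 * t.1, by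
    have := convex_Ioo (0 : ℝ) 1 s.2 t.2 (sub_nonneg.2 u.2.2) u.2.1 (by ring)
    simpa using this⟩
  continuous_toFun := by fun_prop
  source' := by ext; simp
  target' := by ext; simp

end OpenI

namespace MarkedSurface

variable (Sf : MarkedSurface)

/-- The complement of the marked points. It is homotopy equivalent to the compact surface obtained
by removing an open disk around every puncture. -/
abbrev Reg : Type _ := {x : Sf.carrier // x ∉ Sf.marked}

variable {Sf}

/-- The (open) boundary intervals, as maps into the complement of the marked points. -/
def edgeMap (E : Sf.Edge) : C(OpenI, Sf.Reg) where
  toFun t := ⟨Sf.edge E t.toI, by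
    rw [Sf.edge_mem_marked, not_or]
    exact ⟨fun h => t.2.1.ne' (congrArg Subtype.val h), fun h => t.2.2.ne (congrArg Subtype.val h)⟩⟩
  continuous_toFun := by
    have := OpenI.continuous_toI
    fun_prop

/-- The homotopy class of the path along a boundary interval between two of its points. -/
def edgePath (E : Sf.Edge) (s t : OpenI) : Path.Homotopic.Quotient (edgeMap E s) (edgeMap E t) :=
  Path.Homotopic.Quotient.mk ((OpenI.seg s t).map (edgeMap E).continuous)

end MarkedSurface

section Moduli

variable {S 𝔤 : Type*} [Finite S] [LieRing 𝔤] [LieAlgebra ℂ 𝔤] {𝔥 : LieSubalgebra ℂ 𝔤}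
  {b : LieAlgebra.Basis S 𝔥}

/-- A framed `G`-local system with pinnings `(L, β; p)` on a marked surface.

The local system `L` is given by its parallel transport, a representation of the fundamental
groupoid of the complement of the marked points, after trivialising every fibre: if `x` and `y` are
the end points of `γ`, then `hol γ ∈ G` is the parallel transport along `γ` from the fibre over `y`
back to the fibre over `x`. Thus a section `v` of an associated bundle is flat if
`v x = hol γ • v y` for all `γ`.

The framing is a flat section `β` of the flag bundle near the marked points (only the germ of
`β` at the marked points matters), and `p` is a flat section over the boundary intervals of the
bundle of pinnings, such that `p_E` is over the pair of the flags attached to the initial and to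
the terminal point of `E`. -/
structure FramedSystem (w : LongestLift b) (Sf : MarkedSurface) where
  /-- the parallel transport -/
  hol : ∀ {x y : Sf.Reg}, Path.Homotopic.Quotient x y → G b
  hol_refl : ∀ x : Sf.Reg, hol (Path.Homotopic.Quotient.refl x) = 1
  hol_trans : ∀ {x y z : Sf.Reg} (γ : Path.Homotopic.Quotient x y)
    (δ : Path.Homotopic.Quotient y z), hol (γ.trans δ) = hol γ * hol δ
  /-- the framing -/
  β : Sf.Reg → Flag b
  β_flat : ∀ m ∈ Sf.marked, ∃ U ∈ 𝓝 m, ∀ (x y : Sf.Reg) (γ : Path x y), (∀ t, (γ t).1 ∈ U) →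
    β x = hol (Path.Homotopic.Quotient.mk γ) • β y
  /-- the pinnings -/
  p : Sf.Edge → OpenI → Pinning w
  p_flat : ∀ (E : Sf.Edge) (s t : OpenI), p E s = hol (MarkedSurface.edgePath E s t) • p E t
  p_fst : ∀ E : Sf.Edge, ∃ ε > 0, ∀ t : OpenI, t.1 < ε →
    (p E t).fst = β (MarkedSurface.edgeMap E t)
  p_snd : ∀ E : Sf.Edge, ∃ ε > 0, ∀ t : OpenI, 1 - t.1 < ε →
    (p E t).snd = β (MarkedSurface.edgeMap E t)

namespace FramedSystem

variable {w : LongestLift b} {Sf : MarkedSurface}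

/-- `g` is an isomorphism (gauge transformation) from `A` to `A'`. -/
structure IsIso (A A' : FramedSystem w Sf) (g : Sf.Reg → G b) : Prop where
  hol : ∀ {x y : Sf.Reg} (γ : Path.Homotopic.Quotient x y), A'.hol γ = g x * A.hol γ * (g y)⁻¹
  β : ∀ m ∈ Sf.marked, ∃ U ∈ 𝓝 m, ∀ x : Sf.Reg, x.1 ∈ U → A'.β x = g x • A.β x
  p : ∀ (E : Sf.Edge) (t : OpenI), A'.p E t = g (MarkedSurface.edgeMap E t) • A.p E t

variable (w Sf) in
/-- Gauge equivalence. -/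
def setoid : Setoid (FramedSystem w Sf) where
  r A A' := ∃ g, IsIso A A' g
  iseqv :=
    { refl := fun A => ⟨1, fun γ => by simp, fun m _ => ⟨Set.univ, Filter.univ_mem, by simp⟩,
        fun E t => by simp⟩
      symm := by
        rintro A A' ⟨g, h⟩
        refine ⟨g⁻¹, fun γ => by simp [h.hol, mul_assoc], fun m hm => ?_, fun E t => by simp [h.p]⟩
        obtain ⟨U, hU, h⟩ := h.β m hm
        exact ⟨U, hU, fun x hx => by simp [h x hx]⟩
      trans := by
        rintro A A' A'' ⟨g, h⟩ ⟨g', h'⟩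
        refine ⟨g' * g, fun γ => by simp [h.hol, h'.hol, mul_assoc], fun m hm => ?_,
          fun E t => by simp [h.p, h'.p, mul_smul]⟩
        obtain ⟨U, hU, h⟩ := h.β m hm
        obtain ⟨U', hU', h'⟩ := h'.β m hm
        exact ⟨U ∩ U', Filter.inter_mem hU hU', fun x hx => by
          rw [h' x hx.2, h x hx.1, Pi.mul_apply, mul_smul]⟩ }

end FramedSystem

/-- The moduli space `P_{G,Σ}`: the set of gauge equivalence classes `[L, β; p]` of framed
`G`-local systems with pinnings. -/
def Moduli (w : LongestLift b) (Sf : MarkedSurface) : Type _ :=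
  Quotient (FramedSystem.setoid w Sf)

/-- The class `[L, β; p]`. -/
def Moduli.mk {w : LongestLift b} {Sf : MarkedSurface} (A : FramedSystem w Sf) : Moduli w Sf :=
  Quotient.mk _ A

/-! ### Wilson lines -/

/-- A homotopy class (with fixed end points) of paths from the boundary interval `E` to `E'`. -/
structure Arc (Sf : MarkedSurface) (E E' : Sf.Edge) where
  /-- the position of the starting point on `E` -/
  s : OpenI
  /-- the position of the end point on `E'` -/
  t : OpenI
  /-- the homotopy class -/
  path : Path.Homotopic.Quotient (MarkedSurface.edgeMap E s) (MarkedSurface.edgeMap E' t)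

/-- Two classes of paths are related if they differ by sliding the end points along the boundary
intervals. -/
def Arc.Slide {Sf : MarkedSurface} {E E' : Sf.Edge} (c c' : Arc Sf E E') : Prop :=
  c'.path = (MarkedSurface.edgePath E c'.s c.s).trans
    (c.path.trans (MarkedSurface.edgePath E' c.t c'.t))

/-- An arc class `[c] : E → E'`: a homotopy class of paths relative to `E` and `E'`. -/
def ArcClass (Sf : MarkedSurface) (E E' : Sf.Edge) : Type _ :=
  Quot (Arc.Slide (Sf := Sf) (E := E) (E' := E'))

variable [FiniteDimensional ℂ 𝔤] {w : LongestLift b} {Sf : MarkedSurface}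

/-- The Wilson line of `(L, β; p)` along a path `c` from `E` to `E'`: in the trivialisation of `L`
along `c` for which `p_E` is the standard pinning, `p_{E'}` is `g.(p_std)^*` with this `g`. -/
def FramedSystem.wilson (A : FramedSystem w Sf) {E E' : Sf.Edge} (c : Arc Sf E E') : G b :=
  (A.p E c.s).frame⁻¹ * A.hol c.path * (A.p E' c.t).frame * w.elt

lemma FramedSystem.wilson_iso {A A' : FramedSystem w Sf} {g : Sf.Reg → G b}
    (h : A.IsIso A' g) {E E' : Sf.Edge} (c : Arc Sf E E') : A'.wilson c = A.wilson c := by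
  simp only [FramedSystem.wilson, h.hol, h.p, Pinning.frame_smul]
  group

lemma FramedSystem.wilson_slide (A : FramedSystem w Sf) {E E' : Sf.Edge} {c c' : Arc Sf E E'}
    (h : c.Slide c') : A.wilson c = A.wilson c' := by
  simp only [FramedSystem.wilson]
  rw [h, A.hol_trans, A.hol_trans, A.p_flat E c'.s c.s, Pinning.frame_smul,
    A.p_flat E' c.t c'.t, Pinning.frame_smul]
  group

/-- The Wilson line `g_{[c]} : P_{G,Σ} → G` along an arc class `[c]`. -/
def wilson {E E' : Sf.Edge} (c : ArcClass Sf E E') : Moduli w Sf → G b :=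
  Quot.lift (fun c => Quotient.lift (fun A => FramedSystem.wilson A c)
    (fun _ _ ⟨_, h⟩ => (FramedSystem.wilson_iso h c).symm))
    (fun c c' h => by
      funext x
      induction x using Quotient.inductionOn with
      | h A => exact A.wilson_slide h) c

end Moduli

/-! ### The triangle -/

/-- The standard triangle, with vertices indexed counterclockwise by `ℤ/3`. -/
abbrev Tri : Type := stdSimplex ℝ (ZMod 3)

namespace Tri

/-- The `i`-th vertex. -/
def vertex (i : ZMod 3) : Tri := ⟨Pi.single i 1, single_mem_stdSimplex ℝ i⟩

/-- The convex combination `(1 - t) x + t y`. -/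
def cmb (x y : Tri) (t : I) : Tri :=
  ⟨fun i => (1 - t.1) * x.1 i + t.1 * y.1 i, by
    have := convex_stdSimplex ℝ (ZMod 3) x.2 y.2 (sub_nonneg.2 t.2.2) t.2.1 (by ring)
    exact this⟩

lemma continuous_cmb : Continuous fun q : Tri × Tri × I => cmb q.1 q.2.1 q.2.2 := by
  unfold cmb
  refine Continuous.subtype_mk (continuous_pi fun i => ?_) _
  have h1 : Continuous fun q : Tri × Tri × I => q.1.1 i :=
    (continuous_apply i).comp (continuous_subtype_val.comp continuous_fst)
  have h2 : Continuous fun q : Tri × Tri × I => q.2.1.1 i :=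
    (continuous_apply i).comp (continuous_subtype_val.comp (continuous_fst.comp continuous_snd))
  fun_prop

@[simp] lemma cmb_zero (x y : Tri) : cmb x y 0 = x := by
  ext i; simp [cmb]

@[simp] lemma cmb_one (x y : Tri) : cmb x y 1 = y := by
  ext i; simp [cmb]

@[simp] lemma cmb_self (x : Tri) (t : I) : cmb x x t = x :=
  Subtype.ext (funext fun i => by simp only [cmb]; ring)

lemma le_one (x : Tri) (i : ZMod 3) : x.1 i ≤ 1 := by
  rw [← x.2.2]
  exact Finset.single_le_sum (fun j _ => x.2.1 j) (Finset.mem_univ i)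

lemma eq_vertex {x : Tri} {i : ZMod 3} (h : x.1 i = 1) : x = vertex i := by
  refine Subtype.ext (funext fun j => ?_)
  by_cases hj : j = i
  · subst hj; simpa [vertex] using h
  · have h1 := x.2.2
    rw [← Finset.add_sum_erase _ _ (Finset.mem_univ i), h] at h1
    have h2 : ∑ k ∈ Finset.univ.erase i, x.1 k = 0 := by linarith
    rw [Finset.sum_eq_zero_iff_of_nonneg fun k _ => x.2.1 k] at h2
    simpa [vertex, hj] using h2 j (by simp [hj])

/-- The `i`-th side, from the `i`-th vertex to the next one. -/
def side (i : ZMod 3) : C(unitInterval, Tri) where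
  toFun t := cmb (vertex i) (vertex (i + 1)) t
  continuous_toFun := by
    have h : Continuous fun t : I => ((vertex i, vertex (i + 1), t) : Tri × Tri × I) := by fun_prop
    exact continuous_cmb.comp h

lemma cmb_vertex {x y : Tri} {t : I} {i : ZMod 3} (h : cmb x y t = vertex i) :
    x = vertex i ∨ y = vertex i := by
  have h1 : (1 - t.1) * x.1 i + t.1 * y.1 i = 1 := by
    have := congrArg (fun z : Tri => z.1 i) h
    simpa [cmb, vertex] using this
  by_contra hc
  rw [not_or] at hc
  have hx : x.1 i < 1 := lt_of_le_of_ne (le_one x i) fun h => hc.1 (eq_vertex h)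
  have hy : y.1 i < 1 := lt_of_le_of_ne (le_one y i) fun h => hc.2 (eq_vertex h)
  have h0 := t.2.1
  have h2 := t.2.2
  rcases h0.lt_or_eq with h0 | h0
  · nlinarith
  · rw [← h0] at h1; linarith

lemma vertex_injective : Function.Injective vertex := by
  intro i j h
  by_contra hij
  have := congrArg (fun z : Tri => z.1 i) h
  simp [vertex, hij] at this

lemma side_mem (i : ZMod 3) (t : I) : side i t ∈ Set.range vertex ↔ t = 0 ∨ t = 1 := by
  constructor
  · rintro ⟨j, hj⟩
    have h1 : (side i t).1 i = 1 - t.1 := by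
      simp [side, cmb, vertex]
    have h2 : (side i t).1 i = 0 ∨ (side i t).1 i = 1 := by
      rw [← hj]
      by_cases h : i = j
      · subst h; simp [vertex]
      · simp [vertex, h]
    rw [h1] at h2
    rcases h2 with h2 | h2
    · right; ext; simp only [Set.Icc.coe_one]; linarith
    · left; ext; simp only [Set.Icc.coe_zero]; linarith
  · rintro (rfl | rfl)
    · exact ⟨i, by simp [side]⟩
    · exact ⟨i + 1, by simp [side]⟩

end Tri

/-- The triangle as a marked surface: a disk with three special points. The boundary interval `i`
goes from the special point `i` to the special point `i + 1`. -/
def triangle : MarkedSurface where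
  carrier := Tri
  marked := Set.range Tri.vertex
  Edge := ZMod 3
  edge := Tri.side
  edge_mem_marked := Tri.side_mem

namespace triangle

/-- The convex combination of two points which are not vertices. -/
def cmb (x y : triangle.Reg) (t : I) : triangle.Reg :=
  ⟨Tri.cmb x.1 y.1 t, by
    rintro ⟨i, hi⟩
    rcases Tri.cmb_vertex hi.symm with h | h
    · exact x.2 ⟨i, h.symm⟩
    · exact y.2 ⟨i, h.symm⟩⟩

lemma continuous_cmb :
    Continuous fun q : triangle.Reg × triangle.Reg × I => cmb q.1 q.2.1 q.2.2 := by
  refine Continuous.subtype_mk ?_ _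
  refine Tri.continuous_cmb.comp (f := fun q : triangle.Reg × triangle.Reg × I =>
    ((q.1.1, q.2.1.1, q.2.2) : Tri × Tri × I)) ?_
  exact (continuous_subtype_val.comp continuous_fst).prodMk
    ((continuous_subtype_val.comp (continuous_fst.comp continuous_snd)).prodMk
      (continuous_snd.comp continuous_snd))

@[simp] lemma cmb_zero (x y : triangle.Reg) : cmb x y 0 = x := Subtype.ext (Tri.cmb_zero _ _)

@[simp] lemma cmb_one (x y : triangle.Reg) : cmb x y 1 = y := Subtype.ext (Tri.cmb_one _ _)

@[simp] lemma cmb_self (x : triangle.Reg) (t : I) : cmb x x t = x :=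
  Subtype.ext (Tri.cmb_self _ _)

/-- The straight path between two points of the triangle. -/
def seg (x y : triangle.Reg) : Path x y where
  toFun t := cmb x y t
  continuous_toFun := by
    have h : Continuous fun t : I => ((x, y, t) : triangle.Reg × triangle.Reg × I) := by fun_prop
    exact continuous_cmb.comp h
  source' := cmb_zero x y
  target' := cmb_one x y

lemma path_unique {x y : triangle.Reg} (γ δ : Path.Homotopic.Quotient x y) : γ = δ := by
  induction γ using Path.Homotopic.Quotient.ind with
  | mk γ =>
  induction δ using Path.Homotopic.Quotient.ind with
  | mk δ =>
  refine Path.Homotopic.Quotient.eq.2 ⟨?_⟩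
  refine
    { toFun := fun q => cmb (γ q.2) (δ q.2) q.1
      continuous_toFun := by
        have h : Continuous fun q : I × I =>
            ((γ q.2, δ q.2, q.1) : triangle.Reg × triangle.Reg × I) := by fun_prop
        exact continuous_cmb.comp h
      map_zero_left := fun t => by simp
      map_one_left := fun t => by simp
      prop' := ?_ }
  rintro s t (rfl | rfl) <;> simp

/-- The barycenter. -/
def center : triangle.Reg :=
  ⟨⟨fun _ => 1 / 3, fun _ => by norm_num, by simp [ZMod.card]⟩, by
    rintro ⟨i, hi⟩
    have := congrArg (fun z : Tri => z.1 i) hi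
    norm_num [Tri.vertex] at this⟩

section

variable {S 𝔤 : Type*} [Finite S] [LieRing 𝔤] [LieAlgebra ℂ 𝔤] {𝔥 : LieSubalgebra ℂ 𝔤}
  {b : LieAlgebra.Basis S 𝔥} {w : LongestLift b}

/-- The value at the barycenter of the `i`-th pinning of a framed local system on the triangle,
extended by parallel transport. -/
def pinningAtCenter (A : FramedSystem w triangle) (i : ZMod 3) : Pinning w :=
  A.hol (Path.Homotopic.Quotient.mk
    (seg center (MarkedSurface.edgeMap (Sf := triangle) i OpenI.half))) • A.p i OpenI.half

lemma pinningAtCenter_eq (A : FramedSystem w triangle) (i : ZMod 3) (t : OpenI) :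
    pinningAtCenter A i = A.hol (Path.Homotopic.Quotient.mk
      (seg center (MarkedSurface.edgeMap (Sf := triangle) i t))) • A.p i t := by
  rw [pinningAtCenter, A.p_flat i OpenI.half t, smul_smul, ← A.hol_trans]
  congr 2
  exact path_unique _ _

lemma exists_small (i : ZMod 3) {U : Set Tri} (hU : U ∈ 𝓝 (Tri.vertex (i + 1))) {ε : ℝ}
    (hε : 0 < ε) : ∃ t : OpenI, t.1 < ε ∧
      ∀ u, Tri.cmb (Tri.side i t.refl.toI) (Tri.side (i + 1) t.toI) u ∈ U := by
  have hc : Continuous fun q : I × I =>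
      Tri.cmb (Tri.side i (unitInterval.symm q.1)) (Tri.side (i + 1) q.1) q.2 := by
    have h : Continuous fun q : I × I =>
        ((Tri.side i (unitInterval.symm q.1), Tri.side (i + 1) q.1, q.2) : Tri × Tri × I) := by
      fun_prop
    exact Tri.continuous_cmb.comp h
  have h0 : ∀ u : I, ∀ᶠ q : I × I in 𝓝 (0 : I) ×ˢ 𝓝 u,
      Tri.cmb (Tri.side i (unitInterval.symm q.1)) (Tri.side (i + 1) q.1) q.2 ∈ U := by
    intro u
    rw [← nhds_prod_eq]
    refine hc.continuousAt ?_
    have : Tri.cmb (Tri.side i (unitInterval.symm 0)) (Tri.side (i + 1) 0) u =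
        Tri.vertex (i + 1) := by
      simp [Tri.side]
    simpa only [this] using hU
  have h1 : ∀ᶠ t : I in 𝓝 0, ∀ u ∈ (Set.univ : Set I),
      Tri.cmb (Tri.side i (unitInterval.symm t)) (Tri.side (i + 1) t) u ∈ U :=
    isCompact_univ.eventually_forall_of_forall_eventually fun u _ => by
      rw [nhds_prod_eq]; exact h0 u
  rw [Metric.eventually_nhds_iff] at h1
  obtain ⟨δ, hδ, h1⟩ := h1
  have hm : 0 < min (min ε δ) 1 := by positivity
  refine ⟨⟨min (min ε δ) 1 / 2, by positivity, ?_⟩, ?_, fun u => ?_⟩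
  · have := min_le_right (min ε δ) 1
    linarith
  · have := (min_le_left (min ε δ) 1).trans (min_le_left ε δ)
    dsimp only
    linarith
  · have h2 := (min_le_left (min ε δ) 1).trans (min_le_right ε δ)
    refine h1 (y := OpenI.toI ⟨min (min ε δ) 1 / 2, by positivity, ?_⟩) ?_ u trivial
    · have := min_le_right (min ε δ) 1
      linarith
    · rw [Subtype.dist_eq, Real.dist_eq]
      simp only [OpenI.toI, Set.Icc.coe_zero, sub_zero]
      rw [abs_of_pos (by positivity)]
      linarith

lemma pinningAtCenter_compat (A : FramedSystem w triangle) (i : ZMod 3) :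
    (pinningAtCenter A i).snd = (pinningAtCenter A (i + 1)).fst := by
  obtain ⟨U, hU, hflat⟩ := A.β_flat (Tri.vertex (i + 1)) ⟨i + 1, rfl⟩
  obtain ⟨ε₁, hε₁, h1⟩ := A.p_snd i
  obtain ⟨ε₂, hε₂, h2⟩ := A.p_fst (i + 1 : ZMod 3)
  obtain ⟨t, ht, hseg⟩ := exists_small i hU (lt_min hε₁ hε₂)
  rw [pinningAtCenter_eq A i t.refl, pinningAtCenter_eq A (i + 1) t, Pinning.snd_smul,
    Pinning.fst_smul, h1 _ (by
      have := ht.trans_le (min_le_left _ _)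
      simpa [OpenI.refl] using this), h2 t (ht.trans_le (min_le_right _ _)),
    hflat _ _ (seg (MarkedSurface.edgeMap (Sf := triangle) i t.refl)
      (MarkedSurface.edgeMap (Sf := triangle) (i + 1 : ZMod 3) t)) hseg, smul_smul, ← A.hol_trans]
  congr 2
  exact path_unique _ _

/-- The isomorphism `f_m : P_{G,T} → Conf_3 P_G` determined by the choice of a distinguished marked
point `m` (the dot) of the triangle: the three flat sections `p_E`, `p_{E'}`, `p_{E''}` are extended
to a common point, where `E`, `E'`, `E''` are the sides in their cyclic order, starting with the
side `E` which emanates from `m`. -/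
def toConf (m : ZMod 3) : Moduli w triangle → Conf w :=
  Quotient.lift (fun A => Conf.mk ⟨fun i => pinningAtCenter A (m + i), fun i => by
      rw [pinningAtCenter_compat, add_assoc]⟩) (by
    rintro A A' ⟨g, h⟩
    refine (Conf.sound (g center) fun i => ?_).symm
    have hp := h.p (m + i : ZMod 3) OpenI.half
    simp only [pinningAtCenter, h.hol]
    erw [hp]
    simp only [smul_smul]
    congr 1
    simp only [mul_assoc]
    erw [inv_mul_cancel]
    simp)

end

end triangle

/-! ### Ideal triangulations -/

/-- The relation that glues the sides of a family of triangles according to a pairing `glue`: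
the points of a side are identified, reversing the orientation, with those of the paired side.
A side which is paired with itself is not glued to anything. -/
inductive SideRel {ι : Type} (glue : ι × ZMod 3 → ι × ZMod 3) :
    (Σ _ : ι, Tri) → (Σ _ : ι, Tri) → Prop where
  | mk (s : ι × ZMod 3) (hs : glue s ≠ s) (t : I) :
      SideRel glue ⟨s.1, Tri.side s.2 t⟩
        ⟨(glue s).1, Tri.side (glue s).2 (unitInterval.symm t)⟩

/-- An ideal triangulation `Δ` of a marked surface: the surface is obtained from finitely many
positively oriented triangles by gluing pairs of sides by orientation-reversing maps, the marked
points are the images of the vertices, and the boundary intervals are the sides which are not glued.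
A space which admits such a structure is a compact surface, with the orientation given by the
triangles. There are no self-folded triangles: the two triangles along an
interior edge are different. -/
structure IdealTriangulation (Sf : MarkedSurface) where
  /-- the set `t(Δ)` of triangles -/
  T : Type
  [fintype : Fintype T]
  /-- the pairing of sides; the fixed points are the boundary sides -/
  glue : T × ZMod 3 → T × ZMod 3
  glue_glue : ∀ s, glue (glue s) = s
  not_selfFolded : ∀ s, glue s ≠ s → (glue s).1 ≠ s.1
  /-- the characteristic map of a triangle -/
  chart : T → C(Tri, Sf.carrier)
  isQuotientMap : Topology.IsQuotientMap fun q : (Σ _ : T, Tri) => chart q.1 q.2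
  chart_eq_iff : ∀ q q' : (Σ _ : T, Tri),
    chart q.1 q.2 = chart q'.1 q'.2 ↔ Relation.EqvGen (SideRel glue) q q'
  marked_eq : Sf.marked = {x | ∃ (τ : T) (i : ZMod 3), chart τ (Tri.vertex i) = x}
  /-- the bijection between the boundary intervals and the boundary sides -/
  bdry : Sf.Edge ≃ {s : T × ZMod 3 // glue s = s}
  edge_eq : ∀ (E : Sf.Edge) (t : I), Sf.edge E t = chart (bdry E).1.1 (Tri.side (bdry E).1.2 t)

namespace IdealTriangulation

variable {Sf : MarkedSurface} (Δ : IdealTriangulation Sf)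

lemma chart_mem_marked (τ : Δ.T) {x : Tri} (hx : Δ.chart τ x ∈ Sf.marked) :
    x ∈ Set.range Tri.vertex := by
  rw [Δ.marked_eq] at hx
  obtain ⟨τ', i, h⟩ := hx
  have h1 := (Δ.chart_eq_iff ⟨τ', Tri.vertex i⟩ ⟨τ, x⟩).1 h
  have key : ∀ q q' : (Σ _ : Δ.T, Tri), Relation.EqvGen (SideRel Δ.glue) q q' →
      (q.2 ∈ Set.range Tri.vertex ↔ q'.2 ∈ Set.range Tri.vertex) := by
    intro q q' h
    induction h with
    | rel _ _ h =>
      obtain ⟨s, -, t⟩ := h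
      rw [Tri.side_mem, Tri.side_mem, or_comm]
      simp
    | refl _ => rfl
    | symm _ _ _ ih => exact ih.symm
    | trans _ _ _ _ _ ih ih' => exact ih.trans ih'
  exact (key _ _ h1).1 ⟨i, rfl⟩

/-- The characteristic map of a triangle on the complement of the vertices. -/
def chartReg (τ : Δ.T) : C(triangle.Reg, Sf.Reg) where
  toFun x := ⟨Δ.chart τ x.1, fun h => x.2 (Δ.chart_mem_marked τ h)⟩
  continuous_toFun := Continuous.subtype_mk ((Δ.chart τ).continuous.comp continuous_subtype_val) _

section Gluing

variable {S 𝔤 : Type*} [Finite S] [LieRing 𝔤] [LieAlgebra ℂ 𝔤] {𝔥 : LieSubalgebra ℂ 𝔤}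
  {b : LieAlgebra.Basis S 𝔥} {w : LongestLift b}

/-- `(L, β; p)` on `Σ` is obtained by gluing the framed local systems with pinnings `D τ` on the
triangles, by means of the isomorphisms `g τ` from the restriction of `L` to the triangle `τ`
to the local system of `D τ`: these isomorphisms respect the framings and the pinnings on the
boundary intervals, and along every interior edge they identify the pinning given
on one side with the opposite of the pinning given on the other side. -/
structure GluedBy (D : Δ.T → FramedSystem w triangle) (A : FramedSystem w Sf)
    (g : Δ.T → triangle.Reg → G b) : Prop where
  hol : ∀ (τ : Δ.T) {x y : triangle.Reg} (γ : Path.Homotopic.Quotient x y),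
    (D τ).hol γ = g τ x * A.hol (γ.map (Δ.chartReg τ)) * (g τ y)⁻¹
  β : ∀ (τ : Δ.T) (i : ZMod 3), ∃ U ∈ 𝓝 (Tri.vertex i), ∀ x : triangle.Reg, x.1 ∈ U →
    (D τ).β x = g τ x • A.β (Δ.chartReg τ x)
  p_bdry : ∀ (E : Sf.Edge) (t : OpenI),
    (D (Δ.bdry E).1.1).p (Δ.bdry E).1.2 t =
      g (Δ.bdry E).1.1 (MarkedSurface.edgeMap (Sf := triangle) (Δ.bdry E).1.2 t) • A.p E t
  p_int : ∀ (s : Δ.T × ZMod 3), Δ.glue s ≠ s → ∀ t : OpenI,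
    (g s.1 (MarkedSurface.edgeMap (Sf := triangle) s.2 t))⁻¹ • (D s.1).p s.2 t =
      ((g (Δ.glue s).1 (MarkedSurface.edgeMap (Sf := triangle) (Δ.glue s).2 t.refl))⁻¹ •
        (D (Δ.glue s).1).p (Δ.glue s).2 t.refl).opp

/-- The point `x` of `P_{G,Σ}` is obtained by gluing from the point `d` of `∏_T P_{G,T}`. -/
def IsGluing (d : Δ.T → Moduli w triangle) (x : Moduli w Sf) : Prop :=
  ∃ (D : Δ.T → FramedSystem w triangle) (A : FramedSystem w Sf) (g : Δ.T → triangle.Reg → G b),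
    (∀ τ, Moduli.mk (D τ) = d τ) ∧ Moduli.mk A = x ∧ Δ.GluedBy D A g

/-- `q` is the gluing morphism `q_Δ : ∏_{T ∈ t(Δ)} P_{G,T} → P_{G,Σ}`. -/
def IsGluingMap (q : (Δ.T → Moduli w triangle) → Moduli w Sf) : Prop :=
  ∀ d, Δ.IsGluing d (q d)

end Gluing

/-! ### Turning patterns -/

/-- The passage of a path through a triangle: the triangle, the side through which the path enters
and the side through which it leaves. -/
structure Passage where
  /-- the triangle -/
  tri : Δ.T
  /-- the side at which the path enters -/
  enter : ZMod 3
  /-- the side at which the path leaves -/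
  leave : ZMod 3

variable {Δ}

/-- The turning direction: to the left if the common corner of the two sides is the initial
point of the entering side, to the right otherwise. -/
def Passage.turn (P : Δ.Passage) : Turn :=
  if P.leave + 1 = P.enter then Turn.L else Turn.R

/-- The corner which the path separates from the two other corners of the triangle: the common
vertex of the two sides. -/
def Passage.corner (P : Δ.Passage) : ZMod 3 :=
  if P.leave + 1 = P.enter then P.enter else P.leave

/-- The path `γ` runs inside the triangle of `P`, from the entering side to
the leaving side, and these two sides are different. -/
def Passage.IsPassedBy (P : Δ.Passage) {x y : Sf.Reg} (γ : Path x y) : Prop :=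
  P.enter ≠ P.leave ∧ ∃ δ : C(unitInterval, triangle.Reg),
    (∀ u, γ u = Δ.chartReg P.tri (δ u)) ∧
    (∃ s : OpenI, δ 0 = MarkedSurface.edgeMap (Sf := triangle) P.enter s) ∧
    (∃ t : OpenI, δ 1 = MarkedSurface.edgeMap (Sf := triangle) P.leave t)

/-- `P'` continues `P`: the side at which `P` leaves is glued to the side at which `P'` enters. -/
def Passage.Next (P P' : Δ.Passage) : Prop :=
  Δ.glue (P.tri, P.leave) = (P'.tri, P'.enter) ∧ (P'.tri, P'.enter) ≠ (P.tri, P.leave)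

/-- The homotopy class of paths has a representative in minimal position with respect to `Δ`
which traverses successively the triangles of the given list of passages: it is a concatenation of
pieces, one for each passage, every one of which crosses its triangle from one side to a
different one. -/
inductive Traverses : ∀ {x y : Sf.Reg}, Path.Homotopic.Quotient x y → List Δ.Passage → Prop where
  | single {x y : Sf.Reg} (γ : Path x y) (P : Δ.Passage) (hγ : P.IsPassedBy γ) :
      Traverses (Path.Homotopic.Quotient.mk γ) [P]
  | cons {x y z : Sf.Reg} (γ : Path x y) (c : Path.Homotopic.Quotient y z) (P P' : Δ.Passage)
      (l : List Δ.Passage) (hγ : P.IsPassedBy γ) (hP : P.Next P') (hc : Traverses c (P' :: l)) :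
      Traverses ((Path.Homotopic.Quotient.mk γ).trans c) (P :: P' :: l)

variable (Δ)

/-- The arc class `[c]`, put in minimal position with respect to `Δ`, traverses successively
the triangles of the given list of passages. -/
def ArcTraverses {E E' : Sf.Edge} (c : ArcClass Sf E E') (l : List Δ.Passage) : Prop :=
  ∃ c' : Arc Sf E E', Quot.mk _ c' = c ∧ Traverses c'.path l

end IdealTriangulation

end

end WilsonLine

/-! ### Local systems of torsors given by an atlas, and their holonomy. -/

namespace WilsonLine

noncomputable section

/-! Decomposition. A Wilson line compares the pinnings at the two ends of an arc, as `frame⁻¹ * hol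
* frame * w.elt`. Inside one triangle all paths with the same ends are homotopic, so this expression
for the entering and the leaving side can be computed at the barycenter. There it is `b_L` or `b_R`
of the configuration, rotated until the corner cut off by the arc comes first
(`basicWilson_passage`, `GluedBy.hol_passage`). Between two triangles the leaving pinning is the
opposite of the entering one, so the frames differ by `w.elt`. Together with the `w.elt` that ends
the preceding factor this gives `w.elt * w.elt = 1`, and the product telescopes
(`GluedBy.hol_traverses`). The two outermost sides are boundary sides, whose pinnings are kept by
the gluing. The argument applies to any glued system, so no uniqueness of the gluing is involved.

Existence of the gluing map. A triangle without its vertices is simply connected, so every system on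
it is isomorphic to a constant one (`triangle.exists_constSystem`), and it suffices to glue constant
systems. Elements `ε s` of the group, one for every side, are chosen so that the pinnings on two
glued sides become opposite after applying `(ε s)⁻¹` (`exists_gluing_gauge`). The glued local system
is trivial on each triangle, with transition element `ε s * (ε (glue s))⁻¹` across a side. A
`FramedSystem` trivialises each fibre separately, without continuity, so the isomorphism with the
constant system may be the discontinuous function `gauge`: `ε` on the open sides and `1` inside.

The holonomy is the monodromy of the torsor, viewed as a covering with discrete fibre
(`FlatAtlas.exists_hol`); this is what makes it homotopy invariant. The framing takes at each corner
the first flag of the side that starts there (`cornerSection`). The values match across glued sides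
because opposition interchanges the two flags of a pinning. -/

/-- An atlas of a local system of `Γ`-torsors on `X` all of whose fibres are trivialised:
on the open set `U i`, multiplication by `k i` passes to a flat trivialisation. -/
structure FlatAtlas (X Γ : Type*) [TopologicalSpace X] [Group Γ] where
  /-- the index set -/
  ι : Type*
  /-- the open cover -/
  U : ι → Set X
  isOpen_U : ∀ i, IsOpen (U i)
  /-- a member of the cover around a point -/
  idx : X → ι
  mem_idx : ∀ x, x ∈ U (idx x)
  /-- the passage from the given trivialisations of the fibres to the flat ones -/
  k : ι → X → Γ
  k_trans : ∀ i j x, x ∈ U i → x ∈ U j →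
    ∀ᶠ y in 𝓝 x, k j y * (k i y)⁻¹ = k j x * (k i x)⁻¹

namespace FlatAtlas

section

variable {X Γ : Type*} [TopologicalSpace X] [Group Γ] (Z : FlatAtlas X Γ)

/-- The section `v` of a bundle associated with the torsor is flat along `γ`. -/
def IsFlat {Y : Type*} [MulAction Γ Y] (γ : I → X) (v : I → Y) : Prop :=
  ∀ t, ∃ i, γ t ∈ Z.U i ∧ ∀ᶠ u in 𝓝 t, Z.k i (γ u) • v u = Z.k i (γ t) • v t

variable {Z}

/-- Transition functions are locally constant, so flatness in one member of the cover implies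
flatness in every other member around the point. Hence `IsFlat` need only ask for a single index. -/
lemma IsFlat.eventually {Y : Type*} [MulAction Γ Y] {γ : C(I, X)} {v : I → Y}
    (h : Z.IsFlat γ v) {t : I} {i : Z.ι} (hi : γ t ∈ Z.U i) :
    ∀ᶠ u in 𝓝 t, Z.k i (γ u) • v u = Z.k i (γ t) • v t := by
  obtain ⟨j, hj, h⟩ := h t
  filter_upwards [h, γ.continuous.continuousAt.eventually (Z.k_trans j i _ hj hi)] with u h1 h2
  have h3 : ∀ u, Z.k i (γ u) • v u = (Z.k i (γ u) * (Z.k j (γ u))⁻¹) • Z.k j (γ u) • v u :=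
    fun u => by rw [smul_smul, inv_mul_cancel_right]
  rw [h3 u, h3 t, h1, h2]

/-- Right multiplication commutes with the left factors `k i`. It is the source of the commutation
of monodromy with the right action. -/
lemma IsFlat.mul_right {γ : I → X} {a : I → Γ} (h : Z.IsFlat γ a) (g : Γ) :
    Z.IsFlat γ fun t => a t * g := by
  intro t
  obtain ⟨i, hi, h⟩ := h t
  refine ⟨i, hi, h.mono fun u hu => ?_⟩
  simp only [smul_eq_mul, ← mul_assoc] at *
  rw [hu]

/-- A flat section is constant with respect to a flat section of the torsor. -/
lemma IsFlat.inv_smul_eq {Y : Type*} [MulAction Γ Y] {γ : C(I, X)} {a : I → Γ} {v : I → Y}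
    (ha : Z.IsFlat γ a) (hv : Z.IsFlat γ v) (s t : I) : (a s)⁻¹ • v s = (a t)⁻¹ • v t := by
  have : IsLocallyConstant fun t => (a t)⁻¹ • v t := by
    rw [IsLocallyConstant.iff_eventually_eq]
    intro t
    filter_upwards [ha.eventually (Z.mem_idx (γ t)), hv.eventually (Z.mem_idx (γ t))] with u h1 h2
    -- The factor `k` cancels in the quotient, and once it is inserted both terms are locally
    -- constant.
    have h3 : ∀ u, (a u)⁻¹ • v u =
        (Z.k (Z.idx (γ t)) (γ u) • a u)⁻¹ • Z.k (Z.idx (γ t)) (γ u) • v u := fun u => by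
      rw [smul_smul, smul_eq_mul, mul_inv_rev, inv_mul_cancel_right]
    rw [h3 u, h1, h2, ← h3]
  exact this.apply_eq_of_isPreconnected isPreconnected_univ trivial trivial

end

section

variable {X Γ : Type*} [TopologicalSpace X] [Group Γ] [TopologicalSpace Γ] [DiscreteTopology Γ]
  (Z : FlatAtlas X Γ)

/-- The torsor as a fibre bundle with discrete fibre. -/
def core : FiberBundleCore Z.ι X Γ where
  baseSet := Z.U
  isOpen_baseSet := Z.isOpen_U
  indexAt := Z.idx
  mem_baseSet_at := Z.mem_idx
  coordChange i j x v := Z.k j x * (Z.k i x)⁻¹ * v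
  coordChange_self i x _ v := by simp
  continuousOn_coordChange i j := by
    rintro ⟨x, v⟩ ⟨⟨hi, hj⟩, -⟩
    refine ContinuousAt.continuousWithinAt ?_
    -- The fibre is discrete, so near `(x, v)` the second coordinate is constant.
    have h1 : ∀ᶠ q : X × Γ in 𝓝 (x, v), q.2 = v :=
      continuous_snd.continuousAt.eventually (p := fun u => u = v)
        (by rw [nhds_discrete]; exact Filter.eventually_pure.2 rfl)
    have h2 : ∀ᶠ q : X × Γ in 𝓝 (x, v), Z.k j q.1 * (Z.k i q.1)⁻¹ = Z.k j x * (Z.k i x)⁻¹ :=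
      (continuous_fst.continuousAt (x := (x, v))).eventually (Z.k_trans i j x hi hj)
    refine ContinuousAt.congr (f := fun _ => Z.k j x * (Z.k i x)⁻¹ * v) continuousAt_const ?_
    filter_upwards [h1, h2] with q h1 h2
    rw [h1, h2]
  coordChange_comp i j l x _ v := by group

lemma isCoveringMap : IsCoveringMap Z.core.proj :=
  FiberBundle.isCoveringMap (F := Γ) (E := Z.core.Fiber)

/-- The element of the torsor over `x` with coordinate `g`. -/
def pt (x : X) (g : Γ) : Z.core.TotalSpace := ⟨x, (Z.k (Z.idx x) x * g : Γ)⟩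

/-- The preferred index `Z.idx x` in the definition of `pt` cancels, so the coordinate `g` has the
same meaning in all trivialisations. -/
lemma localTriv_pt (i : Z.ι) (x : X) (g : Γ) :
    Z.core.localTriv i (Z.pt x g) = (x, Z.k i x * g) := by
  rw [FiberBundleCore.localTriv_apply]
  refine Prod.ext rfl ?_
  change Z.k i x * (Z.k (Z.idx x) x)⁻¹ * (Z.k (Z.idx x) x * g) = _
  group

lemma pt_injective (x : X) : Function.Injective (Z.pt x) := by
  intro g h hgh
  have := congrArg (Z.core.localTriv (Z.idx x)) hgh
  rw [localTriv_pt, localTriv_pt] at this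
  simpa using this

lemma exists_pt (q : Z.core.TotalSpace) : ∃ g, Z.pt q.1 g = q := by
  obtain ⟨x, v⟩ := q
  refine ⟨(Z.k (Z.idx x) x)⁻¹ * (show Γ from v), ?_⟩
  unfold pt
  congr 1
  exact mul_inv_cancel_left (Z.k (Z.idx x) x) (show Γ from v)

/-- In a trivialisation the second coordinate lies in a discrete space, where continuity at a point
means being eventually constant. Continuous lifts to the covering are therefore the flat sections of
the torsor. -/
lemma continuous_pt_iff {γ : C(I, X)} {a : I → Γ} :
    (Continuous fun t => Z.pt (γ t) (a t)) ↔ Z.IsFlat γ a := by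
  have key : ∀ t, (ContinuousAt (fun t => Z.pt (γ t) (a t)) t ↔
      ∀ᶠ u in 𝓝 t, Z.k (Z.idx (γ t)) (γ u) * a u = Z.k (Z.idx (γ t)) (γ t) * a t) := by
    intro t
    have h0 : (fun t => Z.pt (γ t) (a t)) t ∈ (Z.core.localTriv (Z.idx (γ t))).source := by
      rw [FiberBundleCore.mem_localTriv_source]
      exact Z.mem_idx _
    have h1 := (Z.core.localTriv (Z.idx (γ t))).toOpenPartialHomeomorph.continuousAt_iff_continuousAt_comp_left
      (f := fun t => Z.pt (γ t) (a t)) (x := t) ?_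
    · rw [h1]
      have h2 : (Z.core.localTriv (Z.idx (γ t))).toOpenPartialHomeomorph ∘
          (fun t => Z.pt (γ t) (a t)) = fun u => (γ u, Z.k (Z.idx (γ t)) (γ u) * a u) := by
        funext u
        exact Z.localTriv_pt _ _ _
      have h3 : ContinuousAt (fun u => Z.k (Z.idx (γ t)) (γ u) * a u) t ↔
          ∀ᶠ u in 𝓝 t, Z.k (Z.idx (γ t)) (γ u) * a u = Z.k (Z.idx (γ t)) (γ t) * a t := by
        rw [ContinuousAt, nhds_discrete Γ, Filter.tendsto_pure]
      rw [h2, ← h3]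
      exact ⟨fun h => continuous_snd.continuousAt.comp h,
        fun h => γ.continuous.continuousAt.prodMk h⟩
    · have : Z.U (Z.idx (γ t)) ∈ 𝓝 (γ t) := (Z.isOpen_U _).mem_nhds (Z.mem_idx _)
      filter_upwards [γ.continuous.continuousAt this] with u hu
      exact (Z.core.mem_localTriv_source _ _).2 hu
  rw [continuous_iff_continuousAt]
  constructor
  · intro h t
    exact ⟨_, Z.mem_idx _, (key t).1 (h t)⟩
  · intro h t
    exact (key t).2 (h.eventually (Z.mem_idx _))

/-- Path lifting in the covering, with the lift normalised at its start. -/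
lemma exists_isFlat_aux (γ : C(I, X)) : ∃ a : I → Γ, Z.IsFlat γ a ∧ a 0 = 1 := by
  obtain ⟨Δ, h1, h2⟩ := Z.isCoveringMap.exists_path_lifts γ (Z.pt (γ 0) 1) rfl
  choose a ha using fun t => Z.exists_pt (Δ t)
  have h3 : ∀ t, Z.pt (γ t) (a t) = Δ t := fun t => by
    rw [← ha t]
    congr 1
    exact (congrFun h1 t).symm
  refine ⟨a, Z.continuous_pt_iff.1 (by simp only [h3]; exact Δ.continuous), ?_⟩
  exact Z.pt_injective _ ((h3 0).trans h2)

/-- A flat section is a lift of the path, and monodromy sends the start of a lift to its end. -/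
lemma monodromy_pt {x y : X} (γ : Path x y) {a : I → Γ} (ha : Z.IsFlat γ a) :
    Z.isCoveringMap.monodromy (Path.Homotopic.Quotient.mk γ) ⟨Z.pt x (a 0), rfl⟩ =
      ⟨Z.pt y (a 1), rfl⟩ := by
  have hc : Continuous fun t => Z.pt (γ t) (a t) := Z.continuous_pt_iff (γ := γ.toContinuousMap).2 ha
  let Δ : Path (Z.pt x (a 0)) (Z.pt y (a 1)) := ⟨⟨_, hc⟩, by simp, by simp⟩
  refine Z.isCoveringMap.monodromy_eq_of_map_eq (Path.Homotopic.Quotient.mk Δ) ?_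
  rfl

/-- Monodromy commutes with right multiplication, so in coordinates it is left multiplication by a
fixed element. `hol` is the inverse of this element, since it transports from the end of the path
back to its start. Homotopy invariance and compatibility with composition are inherited from the
monodromy. -/
lemma exists_hol_aux : ∃ hol : ∀ {x y : X}, Path.Homotopic.Quotient x y → Γ,
    (∀ {x y z : X} (γ : Path.Homotopic.Quotient x y) (δ : Path.Homotopic.Quotient y z),
      hol (γ.trans δ) = hol γ * hol δ) ∧
    ∀ {x y : X} (γ : Path x y) (a : I → Γ), Z.IsFlat γ a →
      hol (Path.Homotopic.Quotient.mk γ) = a 0 * (a 1)⁻¹ := by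
  have h0 : ∀ {x y : X} (γ : Path.Homotopic.Quotient x y), ∃ g : Γ, ∀ h,
      Z.isCoveringMap.monodromy γ ⟨Z.pt x h, rfl⟩ = ⟨Z.pt y (g⁻¹ * h), rfl⟩ := by
    intro x y γ
    induction γ using Path.Homotopic.Quotient.ind with
    | mk γ =>
    obtain ⟨a, ha, ha0⟩ := Z.exists_isFlat_aux γ.toContinuousMap
    -- As `a 0 = 1`, the flat section `a * h` starts at `h` and ends at `a 1 * h`, whence `g⁻¹ = a
    -- 1`.
    refine ⟨(a 1)⁻¹, fun h => ?_⟩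
    have := Z.monodromy_pt γ (ha.mul_right h)
    simpa [ha0] using this
  choose hol hhol using @h0
  -- The image of a single point of the fibre already determines `hol γ`.
  have huniq : ∀ {x y : X} (γ : Path.Homotopic.Quotient x y) (g h : Γ),
      Z.isCoveringMap.monodromy γ ⟨Z.pt x h, rfl⟩ = ⟨Z.pt y (g⁻¹ * h), rfl⟩ → hol γ = g := by
    intro x y γ g h hg
    rw [hhol γ h] at hg
    have := Z.pt_injective _ (congrArg Subtype.val hg)
    simpa using this
  refine ⟨fun {x y} γ => hol γ, fun γ δ => ?_, fun {x y} γ a ha => ?_⟩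
  · refine huniq _ _ 1 ?_
    rw [IsCoveringMap.monodromy_trans_apply, hhol, hhol, mul_inv_rev, mul_assoc]
  · refine huniq _ _ (a 0) ?_
    rw [Z.monodromy_pt γ ha]
    simp

end

variable {X Γ : Type*} [TopologicalSpace X] [Group Γ] (Z : FlatAtlas X Γ)

/-- Flat sections exist along every path. -/
lemma exists_isFlat (γ : C(I, X)) : ∃ a : I → Γ, Z.IsFlat γ a :=
  -- The covering argument needs a discrete topology on the group, introduced here only for the
  -- proof.
  letI : TopologicalSpace Γ := ⊥
  haveI : DiscreteTopology Γ := ⟨rfl⟩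
  (Z.exists_isFlat_aux γ).imp fun _ h => h.1

/-- The holonomy of a local system given by an atlas. -/
lemma exists_hol : ∃ hol : ∀ {x y : X}, Path.Homotopic.Quotient x y → Γ,
    (∀ {x y z : X} (γ : Path.Homotopic.Quotient x y) (δ : Path.Homotopic.Quotient y z),
      hol (γ.trans δ) = hol γ * hol δ) ∧
    ∀ {x y : X} (γ : Path x y) (a : I → Γ), Z.IsFlat γ a →
      hol (Path.Homotopic.Quotient.mk γ) = a 0 * (a 1)⁻¹ :=
  letI : TopologicalSpace Γ := ⊥
  haveI : DiscreteTopology Γ := ⟨rfl⟩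
  Z.exists_hol_aux

end FlatAtlas

/-! ### Barycentric coordinates on the triangle. -/

lemma OpenI.toI_refl (t : OpenI) : t.refl.toI = unitInterval.symm t.toI := rfl

namespace Tri

lemma continuous_coord (i : ZMod 3) : Continuous fun x : Tri => x.1 i :=
  (continuous_apply i).comp continuous_subtype_val

lemma zmod_add_one_ne (i : ZMod 3) : i + 1 ≠ i := by revert i; decide

lemma zmod_add_two_ne (i : ZMod 3) : i + 2 ≠ i := by revert i; decide

lemma zmod_add_two_ne_add_one (i : ZMod 3) : i + 2 ≠ i + 1 := by revert i; decide

lemma zmod_cases (i j : ZMod 3) : j = i ∨ j = i + 1 ∨ j = i + 2 := by revert i j; decide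

lemma side_coord_zero (i : ZMod 3) (t : I) : (side i t).1 i = 1 - t.1 := by
  simp [side, cmb, vertex]

lemma side_coord_one (i : ZMod 3) (t : I) : (side i t).1 (i + 1) = t.1 := by
  simp [side, cmb, vertex]

lemma side_coord_two (i : ZMod 3) (t : I) : (side i t).1 (i + 2) = 0 := by
  have h1 : (vertex i).1 (i + 2) = 0 := Pi.single_eq_of_ne (zmod_add_two_ne i) _
  have h2 : (vertex (i + 1)).1 (i + 2) = 0 := Pi.single_eq_of_ne (zmod_add_two_ne_add_one i) _
  simp [side, cmb, h1, h2]

lemma sum_coord (x : Tri) (i : ZMod 3) : x.1 i + x.1 (i + 1) + x.1 (i + 2) = 1 := by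
  have h := x.2.2
  rw [← h]
  have : (Finset.univ : Finset (ZMod 3)) = {i, i + 1, i + 2} := by revert i; decide
  rw [this, Finset.sum_insert, Finset.sum_pair (zmod_add_two_ne_add_one i).symm, add_assoc]
  simp [(zmod_add_one_ne i).symm, (zmod_add_two_ne i).symm]

/-- The points which are not on the two sides different from the `i`-th one. -/
def mid (i : ZMod 3) : Set Tri := {x | 0 < x.1 i ∧ 0 < x.1 (i + 1)}

/-- The interior of the triangle. -/
def inner : Set Tri := {x | ∀ i, 0 < x.1 i}

lemma isOpen_mid (i : ZMod 3) : IsOpen (mid i) :=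
  (isOpen_lt continuous_const (continuous_coord i)).inter
    (isOpen_lt continuous_const (continuous_coord (i + 1)))

lemma isOpen_inner : IsOpen inner := by
  have : inner = ⋂ i, {x : Tri | 0 < x.1 i} := by ext; simp [inner]
  rw [this]
  exact isOpen_iInter_of_finite fun i => isOpen_lt continuous_const (continuous_coord i)

lemma inner_subset_mid (i : ZMod 3) : inner ⊆ mid i := fun _ h => ⟨h _, h _⟩

lemma side_mem_mid (i : ZMod 3) (t : OpenI) : side i t.toI ∈ mid i := by
  refine ⟨?_, ?_⟩
  · rw [side_coord_zero]; exact sub_pos.2 t.2.2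
  · rw [side_coord_one]; exact t.2.1

/-- The only coordinate that can vanish on `mid i` is the one with index `i + 2`, and its vanishing
is the equation of the side `i`. -/
lemma mem_inner_or_side {x : Tri} {i : ZMod 3} (hx : x ∈ mid i) :
    x ∈ inner ∨ ∃ t : OpenI, x = side i t.toI := by
  have h1 := sum_coord x i
  have h2 : 0 ≤ x.1 (i + 2) := x.2.1 _
  rcases h2.lt_or_eq with h | h
  · left
    intro j
    rcases zmod_cases i j with rfl | rfl | rfl
    exacts [hx.1, hx.2, h]
  · right
    have h3 : x.1 (i + 1) < 1 := by have := hx.1; linarith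
    refine ⟨⟨x.1 (i + 1), hx.2, h3⟩, Subtype.ext (funext fun j => ?_)⟩
    rcases zmod_cases i j with rfl | rfl | rfl
    · rw [side_coord_zero]; simp only [OpenI.toI]; linarith
    · rw [side_coord_one]; rfl
    · rw [side_coord_two, h]

/-- On the side `i` the coordinate `i + 2` is zero, and for `j ≠ i` the set `mid j` requires it to
be positive. -/
lemma mid_of_side {i j : ZMod 3} {t : I} (h : side i t ∈ mid j) : i = j := by
  rcases zmod_cases i j with h1 | h1 | h1
  · exact h1.symm
  · have := h.2
    rw [h1, add_assoc, one_add_one_eq_two, side_coord_two] at this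
    exact absurd this (lt_irrefl _)
  · have := h.1
    rw [h1, side_coord_two] at this
    exact absurd this (lt_irrefl _)

lemma side_eq_side {i j : ZMod 3} {s t : OpenI} (h : side i s.toI = side j t.toI) :
    i = j ∧ s = t := by
  have h1 : i = j := mid_of_side (h ▸ side_mem_mid j t)
  subst h1
  have := congrArg (fun x : Tri => x.1 (i + 1)) h
  simp only [side_coord_one] at this
  exact ⟨rfl, Subtype.ext this⟩

lemma side_not_inner (i : ZMod 3) (t : I) : side i t ∉ inner := fun h => by
  have := h (i + 2)
  rw [side_coord_two] at this
  exact lt_irrefl _ this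

lemma exists_openI_of_not_vertex {i : ZMod 3} {t : I} (h : side i t ∉ Set.range vertex) :
    ∃ s : OpenI, t = s.toI := by
  rw [side_mem, not_or] at h
  exact ⟨⟨t.1, lt_of_le_of_ne t.2.1 fun h' => h.1 (Subtype.ext h'.symm),
    lt_of_le_of_ne t.2.2 fun h' => h.2 (Subtype.ext h')⟩, rfl⟩

lemma mid_not_vertex {x : Tri} {i : ZMod 3} (hx : x ∈ mid i) : x ∉ Set.range vertex := by
  rintro ⟨j, rfl⟩
  obtain ⟨h1, h2⟩ := hx
  by_cases h : i = j
  · subst h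
    simp [vertex] at h2
  · simp [vertex, h] at h1

lemma pos_of_not_vertex {x : Tri} (hx : x ∉ Set.range vertex) (i : ZMod 3) :
    0 < x.1 (i + 1) ∨ 0 < x.1 (i + 2) := by
  by_contra h
  rw [not_or, not_lt, not_lt] at h
  have h1 := sum_coord x i
  have h2 : 0 ≤ x.1 (i + 1) := x.2.1 _
  have h3 : 0 ≤ x.1 (i + 2) := x.2.1 _
  exact hx ⟨i, (eq_vertex (by linarith)).symm⟩

lemma zmod_two_one (i : ZMod 3) : i + 2 + 1 = i := by revert i; decide

/-- A point close to a vertex which is not a vertex is off two sides, at least one of which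
contains the vertex. -/
lemma exists_mid_near {x : Tri} (hx : x ∉ Set.range vertex) {i : ZMod 3} (hi : 0 < x.1 i) :
    ∃ j, x ∈ mid j ∧ (i = j ∨ i = j + 1) := by
  rcases pos_of_not_vertex hx i with h | h
  · exact ⟨i, ⟨hi, h⟩, Or.inl rfl⟩
  · exact ⟨i + 2, ⟨h, by rwa [zmod_two_one]⟩, Or.inr (zmod_two_one i).symm⟩

lemma exists_mid {x : Tri} (hx : x ∉ Set.range vertex) : ∃ i, x ∈ mid i := by
  have : ∃ i, 0 < x.1 i := by
    by_contra h
    push Not at h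
    have h1 := sum_coord x 0
    linarith [h 0, h (0 + 1), h (0 + 2)]
  obtain ⟨i, hi⟩ := this
  obtain ⟨j, hj, -⟩ := exists_mid_near hx hi
  exact ⟨j, hj⟩

/-- Coordinates are nonnegative with sum `1`. The sets where some coordinate exceeds `1 / 2` thus
serve as disjoint neighbourhoods of the three vertices. -/
lemma half_unique {x : Tri} {i j : ZMod 3} (hi : 1 / 2 < x.1 i) (hj : 1 / 2 < x.1 j) : i = j := by
  have h1 := sum_coord x i
  have h2 : ∀ k, 0 ≤ x.1 k := x.2.1
  rcases zmod_cases i j with rfl | rfl | rfl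
  · rfl
  · linarith [h2 (i + 2)]
  · linarith [h2 (i + 1)]

end Tri

/-! ### The identifications of the gluing, and open sets of the surface. -/

namespace IdealTriangulation

variable {Sf : MarkedSurface} (Δ : IdealTriangulation Sf)

variable {Δ} in
lemma glue_ne {s : Δ.T × ZMod 3} (hs : Δ.glue s ≠ s) : Δ.glue (Δ.glue s) ≠ Δ.glue s := by
  rw [Δ.glue_glue]; exact hs.symm

/-- Away from the vertices, only paired points of two sides are identified. -/
lemma chart_eq {τ τ' : Δ.T} {x x' : Tri} (hx : x ∉ Set.range Tri.vertex)
    (h : Δ.chart τ x = Δ.chart τ' x') :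
    (τ = τ' ∧ x = x') ∨ ∃ s, Δ.glue s ≠ s ∧ ∃ t : OpenI, τ = s.1 ∧ x = Tri.side s.2 t.toI ∧
      τ' = (Δ.glue s).1 ∧ x' = Tri.side (Δ.glue s).2 t.refl.toI := by
  -- A point which is not a vertex lies on at most one side, so chains of identifications through
  -- such points collapse to length at most one.
  have key : ∀ q q' : (Σ _ : Δ.T, Tri), Relation.EqvGen (SideRel Δ.glue) q q' →
      (q = q' ∨ SideRel Δ.glue q q' ∨ (q.2 ∈ Set.range Tri.vertex ∧
        q'.2 ∈ Set.range Tri.vertex)) := by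
    have hv : ∀ q q', SideRel Δ.glue q q' →
        (q.2 ∈ Set.range Tri.vertex ↔ q'.2 ∈ Set.range Tri.vertex) := by
      rintro _ _ ⟨s, -, t⟩
      rw [Tri.side_mem, Tri.side_mem, or_comm]
      simp
    have hsymm : ∀ q q', SideRel Δ.glue q q' → SideRel Δ.glue q' q := by
      rintro _ _ ⟨s, hs, t⟩
      have := SideRel.mk (Δ.glue s) (glue_ne hs) (unitInterval.symm t)
      rwa [Δ.glue_glue, unitInterval.symm_symm] at this
    intro q q' h
    induction h with
    | rel _ _ h => exact Or.inr (Or.inl h)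
    | refl _ => exact Or.inl rfl
    | symm _ _ _ ih =>
      rcases ih with rfl | ih | ih
      · exact Or.inl rfl
      · exact Or.inr (Or.inl (hsymm _ _ ih))
      · exact Or.inr (Or.inr ih.symm)
    | trans a b c _ _ ih ih' =>
      rcases ih with rfl | ih | ih
      · exact ih'
      · rcases ih' with rfl | ih' | ih'
        · exact Or.inr (Or.inl ih)
        · by_cases hb : b.2 ∈ Set.range Tri.vertex
          · exact Or.inr (Or.inr ⟨(hv _ _ ih).2 hb, (hv _ _ ih').1 hb⟩)
          · left
            -- Both relations now start at `b`, which is not a vertex and hence determines the side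
            -- and the parameter. They are the same relation, so the chain has returned to its
            -- start.
            have ih := hsymm _ _ ih
            rcases ih with ⟨s, hs, t⟩
            generalize hq : (⟨s.1, Tri.side s.2 t⟩ : Σ _ : Δ.T, Tri) = q at *
            rcases ih' with ⟨s', hs', t'⟩
            have h1 : s.1 = s'.1 := congrArg Sigma.fst hq
            have h2 : Tri.side s.2 t = Tri.side s'.2 t' :=
              congrArg (fun q : (Σ _ : Δ.T, Tri) => q.2) hq
            obtain ⟨r', rfl⟩ := Tri.exists_openI_of_not_vertex hb
            rw [← h2] at hb
            obtain ⟨r, rfl⟩ := Tri.exists_openI_of_not_vertex hb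
            obtain ⟨h3, rfl⟩ := Tri.side_eq_side h2
            obtain rfl : s = s' := Prod.ext h1 h3
            rfl
        · exact Or.inr (Or.inr ⟨(hv _ _ ih).2 ih'.1, ih'.2⟩)
      · rcases ih' with rfl | ih' | ih'
        · exact Or.inr (Or.inr ih)
        · exact Or.inr (Or.inr ⟨ih.1, (hv _ _ ih').1 ih.2⟩)
        · exact Or.inr (Or.inr ⟨ih.1, ih'.2⟩)
  rcases key _ _ ((Δ.chart_eq_iff ⟨τ, x⟩ ⟨τ', x'⟩).1 h) with h | h | h
  · left
    exact ⟨congrArg Sigma.fst h, congrArg (fun q : (Σ _ : Δ.T, Tri) => q.2) h⟩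
  · right
    generalize hq : (⟨τ, x⟩ : Σ _ : Δ.T, Tri) = q at h
    generalize hq' : (⟨τ', x'⟩ : Σ _ : Δ.T, Tri) = q' at h
    rcases h with ⟨s, hs, t⟩
    have h1 : x = Tri.side s.2 t := congrArg (fun q : (Σ _ : Δ.T, Tri) => q.2) hq
    have h2 : x' = Tri.side (Δ.glue s).2 (unitInterval.symm t) :=
      congrArg (fun q : (Σ _ : Δ.T, Tri) => q.2) hq'
    obtain ⟨r, rfl⟩ := Tri.exists_openI_of_not_vertex (h1 ▸ hx)
    exact ⟨s, hs, r, congrArg Sigma.fst hq, h1, congrArg Sigma.fst hq', h2⟩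
  · exact absurd h.1 hx

/-- The union of the images of subsets of the triangles. -/
def image (V : Δ.T → Set Tri) : Set Sf.carrier := {y | ∃ τ, ∃ x ∈ V τ, Δ.chart τ x = y}

/-- A family of subsets of the triangles is saturated if it is a union of fibres
of the gluing. -/
def IsSaturated (V : Δ.T → Set Tri) : Prop :=
  ∀ s, Δ.glue s ≠ s → ∀ t : I, Tri.side s.2 t ∈ V s.1 →
    Tri.side (Δ.glue s).2 (unitInterval.symm t) ∈ V (Δ.glue s).1

variable {Δ}

/-- Saturation carries membership along the generated equivalence relation, so the preimage of the
image is the family itself. Together with the quotient topology this produces open sets of the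
surface. -/
lemma IsSaturated.chart_mem_image {V : Δ.T → Set Tri} (hV : Δ.IsSaturated V) {τ : Δ.T} {x : Tri} :
    Δ.chart τ x ∈ Δ.image V ↔ x ∈ V τ := by
  refine ⟨?_, fun h => ⟨τ, x, h, rfl⟩⟩
  rintro ⟨τ', x', hx', h⟩
  have key : ∀ q q' : (Σ _ : Δ.T, Tri), Relation.EqvGen (SideRel Δ.glue) q q' →
      (q.2 ∈ V q.1 ↔ q'.2 ∈ V q'.1) := by
    intro q q' h
    induction h with
    | rel _ _ h =>
      obtain ⟨s, hs, t⟩ := h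
      refine ⟨hV s hs t, fun h => ?_⟩
      have := hV (Δ.glue s) (glue_ne hs) _ h
      rwa [Δ.glue_glue, unitInterval.symm_symm] at this
    | refl _ => rfl
    | symm _ _ _ ih => exact ih.symm
    | trans _ _ _ _ _ ih ih' => exact ih.trans ih'
  exact (key _ _ ((Δ.chart_eq_iff ⟨τ', x'⟩ ⟨τ, x⟩).1 h)).1 hx'

lemma IsSaturated.isOpen_image {V : Δ.T → Set Tri} (hV : Δ.IsSaturated V)
    (ho : ∀ τ, IsOpen (V τ)) : IsOpen (Δ.image V) := by
  rw [← Δ.isQuotientMap.isOpen_preimage, isOpen_sigma_iff]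
  intro τ
  convert ho τ using 1
  ext x
  exact hV.chart_mem_image

variable (Δ)

lemma exists_chart (y : Sf.carrier) : ∃ τ x, Δ.chart τ x = y := by
  obtain ⟨q, hq⟩ := Δ.isQuotientMap.surjective y
  exact ⟨q.1, q.2, hq⟩

lemma chart_vertex_mem (τ : Δ.T) (i : ZMod 3) : Δ.chart τ (Tri.vertex i) ∈ Sf.marked := by
  rw [Δ.marked_eq]; exact ⟨τ, i, rfl⟩

lemma exists_chartReg (y : Sf.Reg) : ∃ τ x, Δ.chartReg τ x = y := by
  obtain ⟨τ, x, h⟩ := Δ.exists_chart y.1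
  refine ⟨τ, ⟨x, ?_⟩, Subtype.ext h⟩
  rintro ⟨i, rfl⟩
  exact y.2 (h ▸ Δ.chart_vertex_mem τ i)

/-- Subsets of the two triangles along a side. -/
def piece (s : Δ.T × ZMod 3) (C C' : Set Tri) (τ : Δ.T) : Set Tri :=
  {x | (τ = s.1 ∧ x ∈ C) ∨ (Δ.glue s ≠ s ∧ τ = (Δ.glue s).1 ∧ x ∈ C')}

variable {Δ}

lemma isOpen_piece {s : Δ.T × ZMod 3} {C C' : Set Tri} (hC : IsOpen C) (hC' : IsOpen C')
    (τ : Δ.T) : IsOpen (Δ.piece s C C' τ) :=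
  (isOpen_const.inter hC).union (isOpen_const.inter (isOpen_const.inter hC'))

/-- A subset of `mid i` meets no side other than the side `i`, so saturation is a condition on `s`
and its partner alone. -/
lemma isSaturated_piece {s : Δ.T × ZMod 3} {C C' : Set Tri} (hC : C ⊆ Tri.mid s.2)
    (hC' : C' ⊆ Tri.mid (Δ.glue s).2)
    (h : ∀ t : I, Tri.side s.2 t ∈ C ↔ Tri.side (Δ.glue s).2 (unitInterval.symm t) ∈ C') :
    Δ.IsSaturated (Δ.piece s C C') := by
  rintro r hr t (⟨h1, h2⟩ | ⟨h0, h1, h2⟩)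
  · obtain rfl : r = s := Prod.ext h1 (Tri.mid_of_side (hC h2))
    exact Or.inr ⟨hr, rfl, (h t).1 h2⟩
  · obtain rfl : r = Δ.glue s := Prod.ext h1 (Tri.mid_of_side (hC' h2))
    rw [Δ.glue_glue]
    refine Or.inl ⟨rfl, (h _).2 ?_⟩
    rwa [unitInterval.symm_symm]

lemma side_mem_mid_glue (s : Δ.T × ZMod 3) (t : I) : Tri.side s.2 t ∈ Tri.mid s.2 ↔
    Tri.side (Δ.glue s).2 (unitInterval.symm t) ∈ Tri.mid (Δ.glue s).2 := by
  simp only [Tri.mid, Set.mem_ofPred_eq, Tri.side_coord_zero, Tri.side_coord_one,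
    unitInterval.coe_symm_eq]
  rw [and_comm, sub_sub_cancel]

end IdealTriangulation

/-! ### The local system glued from trivial ones. -/

namespace IdealTriangulation

variable {Sf : MarkedSurface} (Δ : IdealTriangulation Sf) {Γ : Type*} [Group Γ]
  (ε : Δ.T × ZMod 3 → Γ)

open Classical in
/-- The gauge on a triangle with prescribed values on the sides and the value `1` inside. -/
def gauge (τ : Δ.T) (x : Tri) : Γ :=
  if h : ∃ (i : ZMod 3) (t : OpenI), x = Tri.side i t.toI then ε (τ, h.choose) else 1

variable {Δ}

lemma gauge_side (s : Δ.T × ZMod 3) (t : OpenI) :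
    Δ.gauge ε s.1 (Tri.side s.2 t.toI) = ε s := by
  have h : ∃ (i : ZMod 3) (r : OpenI), Tri.side s.2 t.toI = Tri.side i r.toI := ⟨_, _, rfl⟩
  rw [gauge, dif_pos h]
  obtain ⟨r, hr⟩ := h.choose_spec
  rw [← (Tri.side_eq_side hr).1]

lemma gauge_inner (τ : Δ.T) {x : Tri} (hx : x ∈ Tri.inner) : Δ.gauge ε τ x = 1 := by
  rw [gauge, dif_neg]
  rintro ⟨i, t, rfl⟩
  exact Tri.side_not_inner _ _ hx

variable (Δ)

/-- The open set formed by a side and the interiors of the adjacent triangles. -/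
def sideNhd (s : Δ.T × ZMod 3) : Set Sf.Reg :=
  {y | y.1 ∈ Δ.image (Δ.piece s (Tri.mid s.2) (Tri.mid (Δ.glue s).2))}

open Classical in
/-- The gauge on the neighbourhood of a side which extends the gauge of a triangle. -/
def sideGauge (s : Δ.T × ZMod 3) (y : Sf.Reg) : Γ :=
  if h : ∃ x ∈ Tri.mid s.2, Δ.chart s.1 x = y.1 then Δ.gauge ε s.1 h.choose
  else if h : ∃ x ∈ Tri.mid (Δ.glue s).2, Δ.chart (Δ.glue s).1 x = y.1 then
    ε s * (ε (Δ.glue s))⁻¹ * Δ.gauge ε (Δ.glue s).1 h.choose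
  else 1

variable {Δ}

lemma isSaturated_sideNhd (s : Δ.T × ZMod 3) :
    Δ.IsSaturated (Δ.piece s (Tri.mid s.2) (Tri.mid (Δ.glue s).2)) :=
  isSaturated_piece subset_rfl subset_rfl (side_mem_mid_glue s)

lemma isOpen_sideNhd (s : Δ.T × ZMod 3) : IsOpen (Δ.sideNhd s) :=
  ((isSaturated_sideNhd s).isOpen_image
    (isOpen_piece (Tri.isOpen_mid _) (Tri.isOpen_mid _))).preimage continuous_subtype_val

/-- Two paired points lie in different triangles, because no triangle is self-folded. -/
lemma chart_injOn {τ : Δ.T} {x x' : Tri} (hx : x ∉ Set.range Tri.vertex)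
    (h : Δ.chart τ x = Δ.chart τ x') : x = x' := by
  rcases Δ.chart_eq hx h with h | ⟨s, hs, t, h1, -, h3, -⟩
  · exact h.2
  · exact absurd (h3.symm.trans h1) (Δ.not_selfFolded s hs)

lemma sideGauge_left (s : Δ.T × ZMod 3) {y : Sf.Reg} {x : Tri} (hx : x ∈ Tri.mid s.2)
    (hy : Δ.chart s.1 x = y.1) : Δ.sideGauge ε s y = Δ.gauge ε s.1 x := by
  have h : ∃ x ∈ Tri.mid s.2, Δ.chart s.1 x = y.1 := ⟨x, hx, hy⟩
  rw [sideGauge, dif_pos h]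
  congr 1
  exact chart_injOn (Tri.mid_not_vertex h.choose_spec.1) (h.choose_spec.2.trans hy.symm)

/-- The two branches in the definition of `sideGauge` overlap only along the glued side, and there
both give `ε s`. -/
lemma sideGauge_right {s : Δ.T × ZMod 3} (hs : Δ.glue s ≠ s) {y : Sf.Reg} {x : Tri}
    (hx : x ∈ Tri.mid (Δ.glue s).2) (hy : Δ.chart (Δ.glue s).1 x = y.1) :
    Δ.sideGauge ε s y = ε s * (ε (Δ.glue s))⁻¹ * Δ.gauge ε (Δ.glue s).1 x := by
  by_cases h : ∃ x ∈ Tri.mid s.2, Δ.chart s.1 x = y.1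
  · obtain ⟨z, hz, hzy⟩ := h
    rw [sideGauge_left ε s hz hzy]
    rcases Δ.chart_eq (Tri.mid_not_vertex hz) (hzy.trans hy.symm) with h | ⟨r, hr, t, h1, h2, h3, h4⟩
    · exact absurd h.1.symm (Δ.not_selfFolded s hs)
    · obtain rfl : r = s := Prod.ext h1.symm (Tri.mid_of_side (h2 ▸ hz))
      rw [h2, h4, gauge_side, gauge_side, inv_mul_cancel_right]
  · have h' : ∃ x ∈ Tri.mid (Δ.glue s).2, Δ.chart (Δ.glue s).1 x = y.1 := ⟨x, hx, hy⟩
    rw [sideGauge, dif_neg h, dif_pos h']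
    congr 2
    exact chart_injOn (Tri.mid_not_vertex h'.choose_spec.1) (h'.choose_spec.2.trans hy.symm)

/-- The gauges of the two neighbourhoods of a side differ by a constant. -/
lemma sideGauge_glue {s : Δ.T × ZMod 3} (hs : Δ.glue s ≠ s) {y : Sf.Reg} (hy : y ∈ Δ.sideNhd s) :
    Δ.sideGauge ε (Δ.glue s) y = ε (Δ.glue s) * (ε s)⁻¹ * Δ.sideGauge ε s y := by
  obtain ⟨τ, x, ⟨rfl, hx⟩ | ⟨-, rfl, hx⟩, h⟩ := hy
  · have h1 := sideGauge_right ε (glue_ne hs) (y := y) (x := x)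
    rw [Δ.glue_glue] at h1
    rw [sideGauge_left ε s hx h, h1 hx h]
  · rw [sideGauge_right ε hs hx h, sideGauge_left ε (Δ.glue s) hx h]
    group

/-- Inside a triangle `gauge` is `1`, which leaves only a constant depending on the side and the
triangle. -/
lemma sideGauge_inner {s : Δ.T × ZMod 3} {τ : Δ.T} {x z : Tri} (hx : x ∈ Tri.inner)
    (hz : z ∈ Tri.inner) (hs : x ∈ Δ.piece s (Tri.mid s.2) (Tri.mid (Δ.glue s).2) τ)
    {y y' : Sf.Reg} (hy : Δ.chart τ x = y.1) (hy' : Δ.chart τ z = y'.1) :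
    Δ.sideGauge ε s y = Δ.sideGauge ε s y' := by
  rcases hs with ⟨rfl, hs⟩ | ⟨h0, rfl, hs⟩
  · rw [sideGauge_left ε s hs hy, sideGauge_left ε s (Tri.inner_subset_mid _ hz) hy',
      gauge_inner ε _ hx, gauge_inner ε _ hz]
  · rw [sideGauge_right ε h0 hs hy, sideGauge_right ε h0 (Tri.inner_subset_mid _ hz) hy',
      gauge_inner ε _ hx, gauge_inner ε _ hz]

/-- No side meets the interior, so the family is saturated for lack of anything to check. -/
lemma isOpen_image_inner (τ : Δ.T) :
    IsOpen {y : Sf.Reg | ∃ x ∈ Tri.inner, Δ.chart τ x = y.1} := by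
  let V : Δ.T → Set Tri := fun τ' => {x | τ' = τ ∧ x ∈ Tri.inner}
  have hV : Δ.IsSaturated V := fun s hs t h => absurd h.2 (Tri.side_not_inner _ _)
  have := (hV.isOpen_image fun τ' => isOpen_const.inter Tri.isOpen_inner).preimage
    (continuous_subtype_val (p := fun y => y ∉ Sf.marked))
  convert this using 1
  ext y
  constructor
  · rintro ⟨x, hx, h⟩
    exact ⟨τ, x, ⟨rfl, hx⟩, h⟩
  · rintro ⟨_, x, ⟨rfl, hx⟩, h⟩
    exact ⟨x, hx, h⟩

/-- By saturation membership can be tested in the triangle of `r`, where `Tri.mid_of_side`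
identifies the side. -/
lemma eq_or_eq_glue_of_mem_sideNhd {s r : Δ.T × ZMod 3} {t : OpenI} {y : Sf.Reg}
    (h : Δ.chart r.1 (Tri.side r.2 t.toI) = y.1) (hy : y ∈ Δ.sideNhd s) :
    s = r ∨ (Δ.glue r ≠ r ∧ s = Δ.glue r) := by
  have h1 : Δ.chart r.1 (Tri.side r.2 t.toI) ∈
      Δ.image (Δ.piece s (Tri.mid s.2) (Tri.mid (Δ.glue s).2)) := h.symm ▸ hy
  rw [(isSaturated_sideNhd s).chart_mem_image] at h1
  rcases h1 with ⟨h1, h2⟩ | ⟨h0, h1, h2⟩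
  · exact Or.inl (Prod.ext h1.symm (Tri.mid_of_side h2).symm)
  · obtain rfl : r = Δ.glue s := Prod.ext h1 (Tri.mid_of_side h2)
    exact Or.inr ⟨glue_ne h0, (Δ.glue_glue s).symm⟩

/-- The gauges themselves may jump at a side; their ratio does not. Near an interior point of a
triangle both are constant. A point of an open side lies only in the neighbourhoods of that side and
of its partner, which coincide as sets near it and whose gauges differ by the constant of
`sideGauge_glue`. -/
lemma sideGauge_trans (s s' : Δ.T × ZMod 3) (y : Sf.Reg) (hs : y ∈ Δ.sideNhd s)
    (hs' : y ∈ Δ.sideNhd s') : ∀ᶠ y' in 𝓝 y,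
      Δ.sideGauge ε s' y' * (Δ.sideGauge ε s y')⁻¹ =
        Δ.sideGauge ε s' y * (Δ.sideGauge ε s y)⁻¹ := by
  have hn := (isOpen_sideNhd s).mem_nhds hs
  obtain ⟨τ, x, hx, h⟩ := hs
  have hx0 : x ∈ Tri.inner ∨ ∃ r : Δ.T × ZMod 3, ∃ t : OpenI, τ = r.1 ∧ x = Tri.side r.2 t.toI := by
    rcases hx with ⟨-, hx⟩ | ⟨-, -, hx⟩ <;> rcases Tri.mem_inner_or_side hx with h | ⟨t, ht⟩
    exacts [Or.inl h, Or.inr ⟨(τ, _), t, rfl, ht⟩, Or.inl h, Or.inr ⟨(τ, _), t, rfl, ht⟩]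
  rcases hx0 with hi | ⟨r, t, rfl, rfl⟩
  · have hx' : x ∈ Δ.piece s' (Tri.mid s'.2) (Tri.mid (Δ.glue s').2) τ := by
      rw [← (isSaturated_sideNhd s').chart_mem_image, h]
      exact hs'
    filter_upwards [(isOpen_image_inner τ).mem_nhds ⟨x, hi, h⟩] with y' hy'
    obtain ⟨z, hz, h'⟩ := hy'
    rw [sideGauge_inner ε hi hz hx h h', sideGauge_inner ε hi hz hx' h h']
  · have h1 := eq_or_eq_glue_of_mem_sideNhd h ⟨r.1, _, hx, h⟩
    have h2 := eq_or_eq_glue_of_mem_sideNhd h hs'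
    have h3 : s' = s ∨ (Δ.glue s ≠ s ∧ s' = Δ.glue s) := by
      rcases h1 with rfl | ⟨h0, rfl⟩
      · exact h2
      · rcases h2 with rfl | ⟨-, rfl⟩
        · exact Or.inr ⟨glue_ne h0, (Δ.glue_glue _).symm⟩
        · exact Or.inl rfl
    rcases h3 with rfl | ⟨h0, rfl⟩
    · exact Filter.Eventually.of_forall fun y' => by rw [mul_inv_cancel, mul_inv_cancel]
    · filter_upwards [hn] with y' hy'
      rw [sideGauge_glue ε h0 hy', sideGauge_glue ε h0 ⟨r.1, _, hx, h⟩, mul_inv_cancel_right,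
        mul_inv_cancel_right]

lemma chartReg_mem_sideNhd {s : Δ.T × ZMod 3} {x : triangle.Reg} (hx : x.1 ∈ Tri.mid s.2) :
    Δ.chartReg s.1 x ∈ Δ.sideNhd s := ⟨s.1, x.1, Or.inl ⟨rfl, hx⟩, rfl⟩

lemma exists_mem_sideNhd (y : Sf.Reg) : ∃ s, y ∈ Δ.sideNhd s := by
  obtain ⟨τ, x, rfl⟩ := Δ.exists_chartReg y
  obtain ⟨i, hi⟩ := Tri.exists_mid x.2
  exact ⟨(τ, i), chartReg_mem_sideNhd (s := (τ, i)) hi⟩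

variable (Δ)

/-- The local system which is trivial on the triangles, with the transition functions
`ε s * (ε (glue s))⁻¹`. -/
def atlas : FlatAtlas Sf.Reg Γ where
  ι := Δ.T × ZMod 3
  U := Δ.sideNhd
  isOpen_U := isOpen_sideNhd
  idx y := (exists_mem_sideNhd y).choose
  mem_idx y := (exists_mem_sideNhd y).choose_spec
  k := Δ.sideGauge ε
  k_trans := sideGauge_trans ε

/-- Around the side `i` of `τ` the flat coordinate of the section is `gauge * gauge⁻¹ = 1`. So the
local system is trivial on each triangle, and `gauge` is the passage to its flat trivialisation. -/
lemma isFlat_chartReg (τ : Δ.T) (δ : C(I, triangle.Reg)) :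
    (Δ.atlas ε).IsFlat (fun u => Δ.chartReg τ (δ u)) fun u => (Δ.gauge ε τ (δ u).1)⁻¹ := by
  intro t
  obtain ⟨i, hi⟩ := Tri.exists_mid (δ t).2
  have key : ∀ u, (δ u).1 ∈ Tri.mid i →
      Δ.sideGauge ε (τ, i) (Δ.chartReg τ (δ u)) • (Δ.gauge ε τ (δ u).1)⁻¹ = 1 := fun u hu => by
    rw [sideGauge_left ε (τ, i) hu rfl, smul_eq_mul, mul_inv_cancel]
  refine ⟨(τ, i), chartReg_mem_sideNhd (s := (τ, i)) hi, ?_⟩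
  filter_upwards [(continuous_subtype_val.comp δ.continuous).continuousAt.eventually
    ((Tri.isOpen_mid i).mem_nhds hi)] with u hu
  exact (key u hu).trans (key t hi).symm

/-! ### Framings near the marked points, from values at the corners. -/

section Corner

variable {Y : Type*} [MulAction Γ Y] [Inhabited Y] (F : Δ.T → ZMod 3 → Y)

open Classical in
/-- A section near the marked points, given by its values at the corners of the triangles. -/
def cornerSection (y : Sf.Reg) : Y :=
  if h : ∃ (τ : Δ.T) (x : Tri) (i : ZMod 3), Δ.chart τ x = y.1 ∧ 1 / 2 < x.1 i then
    (Δ.gauge ε h.choose h.choose_spec.choose)⁻¹ • F h.choose h.choose_spec.choose_spec.choose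
  else default

/-- The values at the corners match along the glued sides. -/
def CornerCompat : Prop := ∀ s, Δ.glue s ≠ s →
  (ε s)⁻¹ • F s.1 s.2 = (ε (Δ.glue s))⁻¹ • F (Δ.glue s).1 ((Δ.glue s).2 + 1)

variable {Δ F}

/-- The choices in `cornerSection` do not matter. A point with two preimages lies on a glued side,
and `CornerCompat` matches the values there: applied to `s` near its initial point, and to the
partner of `s` near its terminal point. -/
lemma cornerSection_eq (hF : Δ.CornerCompat ε F) {τ : Δ.T} {x : Tri} {i : ZMod 3} {y : Sf.Reg} (hy : Δ.chart τ x = y.1)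
    (hx : 1 / 2 < x.1 i) : Δ.cornerSection ε F y = (Δ.gauge ε τ x)⁻¹ • F τ i := by
  have h : ∃ (τ : Δ.T) (x : Tri) (i : ZMod 3), Δ.chart τ x = y.1 ∧ 1 / 2 < x.1 i :=
    ⟨τ, x, i, hy, hx⟩
  rw [cornerSection, dif_pos h]
  obtain ⟨h1, h2⟩ := h.choose_spec.choose_spec.choose_spec
  generalize h.choose_spec.choose_spec.choose = j at *
  generalize h.choose_spec.choose = z at *
  generalize h.choose = τ' at *
  have hx0 : x ∉ Set.range Tri.vertex := by
    rintro ⟨i, rfl⟩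
    exact y.2 (hy ▸ Δ.chart_vertex_mem τ i)
  rcases Δ.chart_eq hx0 (hy.trans h1.symm) with ⟨rfl, rfl⟩ | ⟨s, hs, t, rfl, rfl, rfl, rfl⟩
  · rw [Tri.half_unique hx h2]
  · rw [gauge_side, gauge_side]
    rcases Tri.zmod_cases s.2 i with rfl | rfl | rfl
    · have : (Δ.glue s).2 + 1 = j := Tri.half_unique (by
        rw [Tri.side_coord_zero] at hx
        rw [Tri.side_coord_one]
        exact hx) h2
      rw [← this, hF s hs]
    · have : (Δ.glue s).2 = j := Tri.half_unique (by
        rw [Tri.side_coord_one] at hx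
        rw [Tri.side_coord_zero, OpenI.toI_refl, unitInterval.coe_symm_eq, sub_sub_cancel]
        exact hx) h2
      have h3 := hF _ (glue_ne hs)
      rw [Δ.glue_glue] at h3
      rw [← this, h3]
    · rw [Tri.side_coord_two] at hx
      norm_num at hx

/-- On the part of a side neighbourhood that is close to the corner, the gauged section is
constantly `F s.1 i`. Indeed `sideGauge` undoes the factor `gauge⁻¹`, and in the partner triangle
the remaining factor is absorbed by `CornerCompat`. -/
lemma cornerSection_eventually (hF : Δ.CornerCompat ε F) {τ : Δ.T} {x : Tri} {i : ZMod 3} {y : Sf.Reg}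
    (hy : Δ.chart τ x = y.1) (hx : 1 / 2 < x.1 i) : ∃ s, y ∈ Δ.sideNhd s ∧ ∀ᶠ y' in 𝓝 y,
      Δ.sideGauge ε s y' • Δ.cornerSection ε F y' =
        Δ.sideGauge ε s y • Δ.cornerSection ε F y := by
  have hx0 : x ∉ Set.range Tri.vertex := by
    rintro ⟨i, rfl⟩
    exact y.2 (hy ▸ Δ.chart_vertex_mem τ i)
  obtain ⟨j, hj, hij⟩ := Tri.exists_mid_near hx0 (i := i) (by linarith)
  obtain ⟨s, rfl, rfl⟩ : ∃ s : Δ.T × ZMod 3, s.1 = τ ∧ s.2 = j := ⟨(τ, j), rfl, rfl⟩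
  -- `i'` is the corner of the partner triangle that is glued to `i`. The initial and the terminal
  -- point are interchanged because the gluing reverses the side.
  obtain ⟨i', hi', hF'⟩ : ∃ i', (∀ t : I, (Tri.side s.2 t).1 i =
      (Tri.side (Δ.glue s).2 (unitInterval.symm t)).1 i') ∧ (Δ.glue s ≠ s →
      (ε s)⁻¹ • F s.1 i = (ε (Δ.glue s))⁻¹ • F (Δ.glue s).1 i') := by
    rcases hij with rfl | rfl
    · exact ⟨(Δ.glue s).2 + 1, fun t => by
        rw [Tri.side_coord_zero, Tri.side_coord_one, unitInterval.coe_symm_eq], hF s⟩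
    · refine ⟨(Δ.glue s).2, fun t => by
        rw [Tri.side_coord_zero, Tri.side_coord_one, unitInterval.coe_symm_eq, sub_sub_cancel],
        fun hs => ?_⟩
      have h3 := hF _ (glue_ne hs)
      rw [Δ.glue_glue] at h3
      exact h3.symm
  let V := Δ.piece s (Tri.mid s.2 ∩ {x | 1 / 2 < x.1 i})
    (Tri.mid (Δ.glue s).2 ∩ {x | 1 / 2 < x.1 i'})
  have hV : Δ.IsSaturated V := isSaturated_piece Set.inter_subset_left Set.inter_subset_left
    fun t => and_congr (side_mem_mid_glue s t) (by
      simp only [Set.mem_ofPred_eq]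
      rw [hi'])
  have hVo : IsOpen (Δ.image V) := hV.isOpen_image (isOpen_piece
    ((Tri.isOpen_mid _).inter (isOpen_lt continuous_const (Tri.continuous_coord _)))
    ((Tri.isOpen_mid _).inter (isOpen_lt continuous_const (Tri.continuous_coord _))))
  have key : ∀ y' : Sf.Reg, y'.1 ∈ Δ.image V →
      Δ.sideGauge ε s y' • Δ.cornerSection ε F y' = F s.1 i := by
    rintro y' ⟨_, z, ⟨rfl, hz, hz'⟩ | ⟨h0, rfl, hz, hz'⟩, h⟩
    · rw [sideGauge_left ε s hz h, cornerSection_eq ε hF h hz', smul_inv_smul]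
    · rw [sideGauge_right ε h0 hz h, cornerSection_eq ε hF h hz', mul_smul, smul_inv_smul,
        mul_smul, ← hF' h0, smul_inv_smul]
  have hyV : y.1 ∈ Δ.image V := ⟨s.1, x, Or.inl ⟨rfl, hj, hx⟩, hy⟩
  refine ⟨s, ⟨s.1, x, Or.inl ⟨rfl, hj⟩, hy⟩, ?_⟩
  filter_upwards [(hVo.preimage continuous_subtype_val).mem_nhds hyV] with y' hy'
  rw [key y' hy', key y hyV]

/-- A corner section is flat near the marked points. -/
lemma cornerSection_isFlat (hF : Δ.CornerCompat ε F) {m : Sf.carrier} (hm : m ∈ Sf.marked) :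
    ∃ U ∈ 𝓝 m, ∀ γ : C(I, Sf.Reg), (∀ t, (γ t).1 ∈ U) →
      (Δ.atlas ε).IsFlat γ fun t => Δ.cornerSection ε F (γ t) := by
  -- All corner neighbourhoods at once: flatness is a local condition, so the set need not depend on
  -- the marked point.
  let V : Δ.T → Set Tri := fun _ => {x | ∃ i, 1 / 2 < x.1 i}
  have hV : Δ.IsSaturated V := by
    rintro s hs t ⟨i, hi⟩
    rcases Tri.zmod_cases s.2 i with rfl | rfl | rfl
    · refine ⟨(Δ.glue s).2 + 1, ?_⟩
      rw [Tri.side_coord_zero] at hi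
      rwa [Tri.side_coord_one, unitInterval.coe_symm_eq]
    · refine ⟨(Δ.glue s).2, ?_⟩
      rw [Tri.side_coord_one] at hi
      rwa [Tri.side_coord_zero, unitInterval.coe_symm_eq, sub_sub_cancel]
    · rw [Tri.side_coord_two] at hi
      norm_num at hi
  have hVo : ∀ τ, IsOpen (V τ) := fun τ => by
    have : V τ = ⋃ i, {x : Tri | 1 / 2 < x.1 i} := by ext; simp [V]
    rw [this]
    exact isOpen_iUnion fun i => isOpen_lt continuous_const (Tri.continuous_coord i)
  rw [Δ.marked_eq] at hm
  obtain ⟨τ, i, rfl⟩ := hm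
  refine ⟨Δ.image V, (hV.isOpen_image hVo).mem_nhds ⟨τ, _, ⟨i, ?_⟩, rfl⟩, fun γ hγ t => ?_⟩
  · norm_num [Tri.vertex]
  · obtain ⟨τ', x, ⟨j, hj⟩, h⟩ := hγ t
    obtain ⟨s, hs, he⟩ := cornerSection_eventually ε hF h hj
    exact ⟨s, hs, γ.continuous.continuousAt.eventually he⟩

end Corner

end IdealTriangulation

/-! ### Opposite pinnings and constant systems on the triangle. -/

section

variable {S 𝔤 : Type*} [Finite S] [LieRing 𝔤] [LieAlgebra ℂ 𝔤] {𝔥 : LieSubalgebra ℂ 𝔤}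
  {b : LieAlgebra.Basis S 𝔥} {w : LongestLift b}

namespace Pinning

lemma fst_std : (std w).fst = flagPlus b := rfl

lemma snd_std : (std w).snd = w.elt • flagPlus b := rfl

/-- The lift `w.elt` carries the base flag `B⁺` to `B⁻`, the second flag of the standard pinning.
This is what makes framings match along glued sides. -/
lemma fst_opp (p : Pinning w) : p.opp.fst = p.snd := by
  conv_rhs => rw [← p.frame_smul_std]
  rw [opp, fst_smul, snd_smul, fst_std, snd_std, mul_smul]

lemma frame_opp [FiniteDimensional ℂ 𝔤] (p : Pinning w) : p.opp.frame = p.frame * w.elt := by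
  apply smul_std_injective (w := w)
  rw [frame_smul_std, opp]

lemma frame_injective : Function.Injective (frame : Pinning w → G b) := fun p q h => by
  rw [← p.frame_smul_std, h, q.frame_smul_std]

end Pinning

namespace Tri

/-- The metric of the triangle is induced from a normed space, where balls are convex. -/
lemma cmb_mem_ball {v x y : Tri} {r : ℝ} (hx : x ∈ Metric.ball v r) (hy : y ∈ Metric.ball v r)
    (t : I) : cmb x y t ∈ Metric.ball v r := by
  have h := convex_ball v.1 r (x := x.1) (y := y.1) hx hy (sub_nonneg.2 t.2.2) t.2.1 (by ring)
  exact h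

end Tri

namespace triangle

lemma half_lt_coord_zero (i : ZMod 3) {t : OpenI} (ht : t.1 < 1 / 2) :
    1 / 2 < (MarkedSurface.edgeMap (Sf := triangle) i t).1.1 i := by
  change 1 / 2 < (Tri.side i t.toI).1 i
  rw [Tri.side_coord_zero]
  simp only [OpenI.toI]
  linarith

lemma half_lt_coord_one (i : ZMod 3) {t : OpenI} (ht : 1 - t.1 < 1 / 2) :
    1 / 2 < (MarkedSurface.edgeMap (Sf := triangle) i t).1.1 (i + 1) := by
  change 1 / 2 < (Tri.side i t.toI).1 (i + 1)
  rw [Tri.side_coord_one]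
  simp only [OpenI.toI]
  linarith

open Classical in
/-- The trivial local system on the triangle with the given constant pinnings on the sides. -/
def constSystem (P : PreConf w) : FramedSystem w triangle where
  hol _ := 1
  hol_refl _ := rfl
  hol_trans _ _ := (one_mul 1).symm
  β x := if h : ∃ i, 1 / 2 < x.1.1 i then (P.1 h.choose).fst else flagPlus b
  β_flat := by
    rintro _ ⟨i, rfl⟩
    refine ⟨{x : Tri | 1 / 2 < x.1 i},
      (isOpen_lt continuous_const (Tri.continuous_coord i)).mem_nhds ?_, fun x y γ hγ => ?_⟩
    · norm_num [Tri.vertex]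
    · have hx : 1 / 2 < x.1.1 i := by have := hγ 0; rwa [γ.source] at this
      have hy : 1 / 2 < y.1.1 i := by have := hγ 1; rwa [γ.target] at this
      have hx' : ∃ i, 1 / 2 < x.1.1 i := ⟨i, hx⟩
      have hy' : ∃ i, 1 / 2 < y.1.1 i := ⟨i, hy⟩
      rw [dif_pos hx', dif_pos hy', one_smul, Tri.half_unique hx'.choose_spec hx,
        Tri.half_unique hy'.choose_spec hy]
  p i _ := P.1 i
  p_flat _ _ _ := (one_smul _ _).symm
  p_fst := fun (i : ZMod 3) => by
    refine ⟨1 / 2, by norm_num, fun t ht => ?_⟩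
    have hx := half_lt_coord_zero i ht
    have hx' : ∃ j, 1 / 2 < (MarkedSurface.edgeMap (Sf := triangle) i t).1.1 j := ⟨i, hx⟩
    rw [dif_pos hx', Tri.half_unique hx'.choose_spec hx]
  p_snd := fun (i : ZMod 3) => by
    refine ⟨1 / 2, by norm_num, fun t ht => ?_⟩
    have hx := half_lt_coord_one i ht
    have hx' : ∃ j, 1 / 2 < (MarkedSurface.edgeMap (Sf := triangle) i t).1.1 j := ⟨_, hx⟩
    rw [dif_pos hx', Tri.half_unique hx'.choose_spec hx]
    -- At its terminal point the side meets the corner `i + 1`, whose flag is the first flag of the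
    -- next pinning.
    exact P.2 i

lemma constSystem_β (P : PreConf w) {x : triangle.Reg} {i : ZMod 3} (hx : 1 / 2 < x.1.1 i) :
    (constSystem P).β x = (P.1 i).fst := by
  have hx' : ∃ i, 1 / 2 < x.1.1 i := ⟨i, hx⟩
  change (if h : ∃ i, 1 / 2 < x.1.1 i then (P.1 h.choose).fst else flagPlus b) = _
  rw [dif_pos hx', Tri.half_unique hx'.choose_spec hx]

/-- The vertex `i` is the common end of the sides `i + 2` and `i`, and the end `u = 1` of the
segment in `exists_small` lies on the side `i`. -/
lemma exists_ball_side (i : ZMod 3) {r ε : ℝ} (hr : 0 < r) (hε : 0 < ε) :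
    ∃ t : OpenI, t.1 < ε ∧ Tri.side i t.toI ∈ Metric.ball (Tri.vertex i) r := by
  obtain ⟨t, ht, h⟩ := exists_small (i + 2) (U := Metric.ball (Tri.vertex i) r)
    (by rw [Tri.zmod_two_one]; exact Metric.ball_mem_nhds _ hr) hε
  refine ⟨t, ht, ?_⟩
  have := h 1
  rwa [Tri.cmb_one, Tri.zmod_two_one] at this

/-- Near a vertex, the framing extended to the barycenter is given by the pinnings. -/
lemma pinningAtCenter_fst (A : FramedSystem w triangle) (i : ZMod 3) :
    ∃ U ∈ 𝓝 (Tri.vertex i), ∀ x : triangle.Reg, x.1 ∈ U →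
      (pinningAtCenter A i).fst = A.hol (Path.Homotopic.Quotient.mk (seg center x)) • A.β x := by
  obtain ⟨U, hU, hflat⟩ := A.β_flat (Tri.vertex i) ⟨i, rfl⟩
  obtain ⟨r, hr, hrU⟩ := Metric.mem_nhds_iff.1 (show U ∈ 𝓝 (Tri.vertex i : Tri) from hU)
  obtain ⟨ε, hε, h1⟩ := A.p_fst i
  obtain ⟨t, ht, hseg⟩ := exists_ball_side i hr hε
  refine ⟨Metric.ball (Tri.vertex i) r, Metric.ball_mem_nhds _ hr, fun x hx => ?_⟩
  -- The point `x` is compared with a point of the side so close to the vertex that its framing is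
  -- read off from the pinning; the segment between them stays in the ball.
  rw [pinningAtCenter_eq A i t, Pinning.fst_smul, h1 t ht,
    hflat _ _ (seg x (MarkedSurface.edgeMap (Sf := triangle) i t))
      fun u => hrU (Tri.cmb_mem_ball hx hseg u), smul_smul, ← A.hol_trans]
  congr 2
  exact path_unique _ _

/-- Every framed local system on the triangle is isomorphic to a constant one. -/
lemma exists_constSystem (d : Moduli w triangle) : ∃ P, Moduli.mk (constSystem P) = d := by
  induction d using Quotient.inductionOn with
  | h A =>
  let P : PreConf w := ⟨pinningAtCenter A, pinningAtCenter_compat A⟩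
  refine ⟨P, Eq.symm (Quotient.sound ?_)⟩
  -- Parallel transport to the barycenter is the gauge transformation. It trivialises the holonomy
  -- because two paths in the triangle with the same ends are homotopic.
  refine ⟨fun x => A.hol (Path.Homotopic.Quotient.mk (seg center x)), ?_, ?_, ?_⟩
  · intro x y γ
    rw [← A.hol_trans]
    change 1 = _
    rw [eq_mul_inv_iff_mul_eq, one_mul]
    congr 1
    exact path_unique _ _
  · rintro _ ⟨i, rfl⟩
    obtain ⟨U, hU, h⟩ := pinningAtCenter_fst A i
    refine ⟨U ∩ {x : Tri | 1 / 2 < x.1 i}, Filter.inter_mem hU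
      ((isOpen_lt continuous_const (Tri.continuous_coord i)).mem_nhds ?_), fun x hx => ?_⟩
    · norm_num [Tri.vertex]
    · exact (constSystem_β P hx.2).trans (h x hx.1)
  · intro i t
    exact pinningAtCenter_eq A i t

end triangle

/-! ### Existence of the gluing map. -/

namespace IdealTriangulation

variable [FiniteDimensional ℂ 𝔤] {Sf : MarkedSurface} (Δ : IdealTriangulation Sf)

/-- There are elements of `G` which make all pinnings on the sides standard, up to passing to the
opposite pinning on one of two glued sides. -/
lemma exists_gluing_gauge (P : Δ.T → PreConf w) : ∃ ε : Δ.T × ZMod 3 → G b,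
    ∀ s, Δ.glue s ≠ s →
      (ε s)⁻¹ • (P s.1).1 s.2 = ((ε (Δ.glue s))⁻¹ • (P (Δ.glue s).1).1 (Δ.glue s).2).opp := by
  classical
  have := Δ.fintype
  -- An arbitrary order on the sides breaks the symmetry between two partners: the smaller one gets
  -- the standard pinning, the larger one its opposite. As `w.elt` is an involution, the required
  -- relation then holds read from either side.
  obtain ⟨f, hf⟩ := exists_injective_nat (Δ.T × ZMod 3)
  refine ⟨fun s => if f s ≤ f (Δ.glue s) then ((P s.1).1 s.2).frame else
    ((P s.1).1 s.2).frame * w.elt, fun s hs => ?_⟩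
  have hne : f s ≠ f (Δ.glue s) := fun h => hs (hf h).symm
  have hw : w.elt⁻¹ = w.elt := inv_eq_of_mul_eq_one_left w.mul_self
  have h1 : ∀ p q : Pinning w, p.frame⁻¹ • p = ((q.frame * w.elt)⁻¹ • q).opp := fun p q => by
    apply Pinning.frame_injective
    rw [Pinning.frame_opp, Pinning.frame_smul, Pinning.frame_smul, mul_inv_rev, hw,
      inv_mul_cancel, mul_assoc w.elt, inv_mul_cancel, mul_one, w.mul_self]
  have h2 : ∀ p q : Pinning w, (p.frame * w.elt)⁻¹ • p = (q.frame⁻¹ • q).opp := fun p q => by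
    apply Pinning.frame_injective
    rw [Pinning.frame_opp, Pinning.frame_smul, Pinning.frame_smul, mul_inv_rev, hw,
      inv_mul_cancel, mul_assoc w.elt, inv_mul_cancel, mul_one, one_mul]
  beta_reduce
  rcases lt_or_gt_of_ne hne with h | h
  · rw [if_pos h.le, if_neg (by rw [Δ.glue_glue]; exact not_le.2 h)]
    exact h1 _ _
  · rw [if_neg (not_le.2 h), if_pos (by rw [Δ.glue_glue]; exact h.le)]
    exact h2 _ _

lemma chartReg_edgeMap (E : Sf.Edge) (t : OpenI) :
    Δ.chartReg (Δ.bdry E).1.1 (MarkedSurface.edgeMap (Sf := triangle) (Δ.bdry E).1.2 t) =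
      MarkedSurface.edgeMap E t := Subtype.ext (Δ.edge_eq E t.toI).symm

/-- Constant systems on the triangles can be glued. -/
lemma exists_gluedBy (P : Δ.T → PreConf w) : ∃ (A : FramedSystem w Sf)
    (g : Δ.T → triangle.Reg → G b), Δ.GluedBy (fun τ => triangle.constSystem (P τ)) A g := by
  obtain ⟨ε, hε⟩ := Δ.exists_gluing_gauge P
  obtain ⟨hol, htrans, hhol⟩ := (Δ.atlas ε).exists_hol
  let : Inhabited (Flag b) := ⟨flagPlus b⟩
  let F : Δ.T → ZMod 3 → Flag b := fun τ i => ((P τ).1 i).fst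
  -- The first flags of the two members of `hε`: opposition turns the first flag of the partner
  -- pinning into its second, which is the first flag of the following side.
  have hF : Δ.CornerCompat ε F := fun s hs => by
    have := congrArg Pinning.fst (hε s hs)
    rwa [Pinning.fst_opp, Pinning.fst_smul, Pinning.snd_smul, (P (Δ.glue s).1).2] at this
  have hchart : ∀ (τ : Δ.T) {x y : triangle.Reg} (δ : Path x y),
      hol (Path.Homotopic.Quotient.mk (δ.map (Δ.chartReg τ).continuous)) =
        (Δ.gauge ε τ x.1)⁻¹ * Δ.gauge ε τ y.1 := fun τ x y δ => by
    have := hhol (δ.map (Δ.chartReg τ).continuous) _ (Δ.isFlat_chartReg ε τ δ.toContinuousMap)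
    simpa using this
  let A : FramedSystem w Sf :=
    { hol := hol
      hol_refl := fun x => by
        -- A group element equal to its own square is `1`.
        have := htrans (Path.Homotopic.Quotient.refl x) (Path.Homotopic.Quotient.refl x)
        rw [Path.Homotopic.Quotient.refl_trans] at this
        simpa using this
      hol_trans := htrans
      β := Δ.cornerSection ε F
      β_flat := fun m hm => by
        obtain ⟨U, hU, h⟩ := cornerSection_isFlat ε hF hm
        refine ⟨U, hU, fun x y γ hγ => ?_⟩
        -- The holonomy is `a 0 * (a 1)⁻¹` for a flat section `a`, and relative to `a` the flat
        -- framing is constant.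
        obtain ⟨a, ha⟩ := (Δ.atlas ε).exists_isFlat γ.toContinuousMap
        rw [hhol γ a ha]
        have := ha.inv_smul_eq (h γ.toContinuousMap hγ) 0 1
        simp only [Path.coe_toContinuousMap, Path.source, Path.target] at this
        rw [mul_smul, ← this, smul_inv_smul]
      p := fun E _ => (ε (Δ.bdry E).1)⁻¹ • (P (Δ.bdry E).1.1).1 (Δ.bdry E).1.2
      p_flat := fun E s t => by
        -- A boundary interval is a side of one triangle, and on an open side `gauge` is constant;
        -- the transport along it is trivial.
        have h : hol (MarkedSurface.edgePath E s t) = 1 := by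
          have h1 := Δ.isFlat_chartReg ε (Δ.bdry E).1.1
            ((MarkedSurface.edgeMap (Sf := triangle) (Δ.bdry E).1.2).comp
              (OpenI.seg s t).toContinuousMap)
          have h2 : (fun u => Δ.chartReg (Δ.bdry E).1.1
              (((MarkedSurface.edgeMap (Sf := triangle) (Δ.bdry E).1.2).comp
                (OpenI.seg s t).toContinuousMap) u)) =
              (OpenI.seg s t).map (MarkedSurface.edgeMap E).continuous :=
            funext fun u => Δ.chartReg_edgeMap E _
          rw [h2] at h1
          refine (hhol _ _ h1).trans ?_
          have h3 : ∀ u, Δ.gauge ε (Δ.bdry E).1.1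
              (((MarkedSurface.edgeMap (Sf := triangle) (Δ.bdry E).1.2).comp
                (OpenI.seg s t).toContinuousMap) u).1 = ε (Δ.bdry E).1 :=
            fun u => gauge_side ε _ _
          rw [h3, h3, mul_inv_cancel]
        rw [h, one_smul]
      p_fst := fun E => by
        refine ⟨1 / 2, by norm_num, fun t ht => ?_⟩
        rw [Pinning.fst_smul, cornerSection_eq ε hF (i := (Δ.bdry E).1.2)
          (Δ.edge_eq E t.toI).symm, gauge_side]
        rw [Tri.side_coord_zero]
        simp only [OpenI.toI]
        linarith
      p_snd := fun E => by
        refine ⟨1 / 2, by norm_num, fun t ht => ?_⟩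
        rw [Pinning.snd_smul, cornerSection_eq ε hF (i := (Δ.bdry E).1.2 + 1)
          (Δ.edge_eq E t.toI).symm, gauge_side, (P _).2]
        rw [Tri.side_coord_one]
        simp only [OpenI.toI]
        linarith }
  -- The function `gauge` is itself the gluing isomorphism. The conditions on holonomy and framing
  -- are `hchart` and `cornerSection_eq`; on the sides it takes the value `ε`, so that interior
  -- edges reduce to `hε`.
  refine ⟨A, fun τ x => Δ.gauge ε τ x.1, ?_, ?_, ?_, ?_⟩
  · intro τ x y γ
    induction γ using Path.Homotopic.Quotient.ind with
    | mk γ =>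
    change 1 = _ * hol (Path.Homotopic.Quotient.mk (γ.map (Δ.chartReg τ).continuous)) * _
    rw [hchart]
    group
  · intro τ i
    refine ⟨{x : Tri | 1 / 2 < x.1 i},
      (isOpen_lt continuous_const (Tri.continuous_coord i)).mem_nhds ?_, fun x hx => ?_⟩
    · norm_num [Tri.vertex]
    · rw [triangle.constSystem_β _ hx]
      change _ = _ • Δ.cornerSection ε F _
      rw [cornerSection_eq ε hF (τ := τ) (x := x.1) (i := i) rfl hx, smul_inv_smul]
  · intro E t
    have h := gauge_side ε (Δ.bdry E).1 t
    change _ = Δ.gauge ε _ (Tri.side (Δ.bdry E).1.2 t.toI) • (ε (Δ.bdry E).1)⁻¹ • _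
    rw [h, smul_inv_smul]
    rfl
  · intro s hs t
    have h1 := gauge_side ε s t
    have h2 := gauge_side ε (Δ.glue s) t.refl
    change (Δ.gauge ε _ (Tri.side s.2 t.toI))⁻¹ • (P s.1).1 s.2 =
      ((Δ.gauge ε _ (Tri.side (Δ.glue s).2 t.refl.toI))⁻¹ •
        (P (Δ.glue s).1).1 (Δ.glue s).2).opp
    rw [h1, h2, hε s hs]

/-- The gluing map exists. -/
lemma exists_isGluingMap :
    ∃ q : (Δ.T → Moduli w triangle) → Moduli w Sf, Δ.IsGluingMap q := by
  -- Each class is represented by a constant system, for which the gluing has been constructed.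
  choose P hP using triangle.exists_constSystem (w := w)
  choose A g h using Δ.exists_gluedBy (w := w)
  exact ⟨fun d => Moduli.mk (A fun τ => P (d τ)),
    fun d => ⟨_, _, _, fun τ => hP (d τ), rfl, h _⟩⟩

end IdealTriangulation

end

/-! ### The decomposition formula. -/

section

variable {S 𝔤 : Type*} [Finite S] [LieRing 𝔤] [LieAlgebra ℂ 𝔤] {𝔥 : LieSubalgebra ℂ 𝔤}
  {b : LieAlgebra.Basis S 𝔥} {w : LongestLift b}

namespace Conf

lemma shiftBy_shiftBy (k l : ZMod 3) (c : Conf w) : shiftBy k (shiftBy l c) = shiftBy (k + l) c := by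
  induction c using Quotient.inductionOn with
  | h p =>
  refine Conf.sound 1 fun i => ?_
  rw [one_smul]
  change p.1 (i + k + l) = p.1 (i + (k + l))
  rw [add_assoc]

/-- Integral powers of the cyclic shift depend only on the exponent modulo `3`, so the
representative picked by `valMinAbs` is immaterial. -/
lemma cyc_zpow (n : ℤ) (c : Conf w) : (cyc ^ n) c = shiftBy (n : ZMod 3) c := by
  induction n using Int.induction_on with
  | zero =>
    induction c using Quotient.inductionOn with
    | h p =>
    refine (Conf.sound (p := p) 1 fun i => ?_)
    rw [one_smul]
    change p.1 i = p.1 (i + ((0 : ℤ) : ZMod 3))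
    rw [Int.cast_zero, add_zero]
  | succ n ih =>
    rw [add_comm, zpow_add, zpow_one, Equiv.Perm.mul_apply, ih, Int.cast_add, Int.cast_one,
      ← shiftBy_shiftBy]
    rfl
  | pred n ih =>
    rw [sub_eq_neg_add, zpow_add, zpow_neg_one, Equiv.Perm.mul_apply, ih, Int.cast_add,
      show ((-1 : ℤ) : ZMod 3) = -1 from by decide, ← shiftBy_shiftBy]
    rfl

end Conf

namespace IdealTriangulation

variable {Sf : MarkedSurface} {Δ : IdealTriangulation Sf}

open triangle

/-- Both basic Wilson lines compare the pinnings on the entering and the leaving side. -/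
lemma basicWilson_passage [FiniteDimensional ℂ 𝔤] (P : Δ.Passage) (hP : P.enter ≠ P.leave) (m : ZMod 3)
    (A : FramedSystem w triangle) :
    basicWilson P.turn ((Conf.cyc ^ (P.corner - m).valMinAbs) (toConf m (Moduli.mk A))) =
      (pinningAtCenter A P.enter).frame⁻¹ * (pinningAtCenter A P.leave).frame * w.elt := by
  rw [Conf.cyc_zpow, ZMod.coe_valMinAbs]
  -- The dot `m` cancels against the shift: after it, index `0` is the side starting at the corner
  -- `k` and index `2` is the side ending there.
  have h0 : ∀ k : ZMod 3, m + (0 + (k - m)) = k := fun k => by ring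
  have h2 : ∀ k : ZMod 3, m + (2 + (k - m)) = k + 2 := fun k => by ring
  by_cases h : P.leave + 1 = P.enter
  -- Left turn: the entering side starts at the corner, so the indices `0` and `2` stand for
  -- entering and leaving.
  · have h3 : P.enter + 2 = P.leave := by
      rw [← h]
      exact (by decide : ∀ i : ZMod 3, i + 1 + 2 = i) _
    rw [Passage.turn, Passage.corner, if_pos h, if_pos h]
    change (pinningAtCenter A (m + (0 + (P.enter - m)))).frame⁻¹ *
      (pinningAtCenter A (m + (2 + (P.enter - m)))).frame * w.elt = _
    rw [h0, h2, h3]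
  -- Right turn: the leaving side starts at the corner, so the two indices exchange their roles, as
  -- do the two frames in the definition of `b_R`.
  · have h3 : P.leave + 2 = P.enter := by
      rcases Tri.zmod_cases P.leave P.enter with h' | h' | h'
      exacts [absurd h' hP, absurd h'.symm h, h'.symm]
    rw [Passage.turn, Passage.corner, if_neg h, if_neg h]
    change (pinningAtCenter A (m + (2 + (P.leave - m)))).frame⁻¹ *
      (pinningAtCenter A (m + (0 + (P.leave - m)))).frame * w.elt = _
    rw [h0, h2, h3]

/-- The pinning on a side of a triangle, transported to the glued local system. -/
def sidePinning (D : Δ.T → FramedSystem w triangle) (g : Δ.T → triangle.Reg → G b)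
    (r : Δ.T × ZMod 3) (t : OpenI) : Pinning w :=
  (g r.1 (MarkedSurface.edgeMap (Sf := triangle) r.2 t))⁻¹ • (D r.1).p r.2 t

variable (Δ) in
/-- A point of an open side, as a point of the surface. -/
def sidePt (r : Δ.T × ZMod 3) (t : OpenI) : Sf.Reg :=
  Δ.chartReg r.1 (MarkedSurface.edgeMap (Sf := triangle) r.2 t)

lemma sidePt_eq {r r' : Δ.T × ZMod 3} {t t' : OpenI} (h : Δ.sidePt r t = Δ.sidePt r' t') :
    (r = r' ∧ t = t') ∨ (Δ.glue r ≠ r ∧ r' = Δ.glue r ∧ t' = t.refl) := by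
  have h1 : Δ.chart r.1 (Tri.side r.2 t.toI) = Δ.chart r'.1 (Tri.side r'.2 t'.toI) :=
    congrArg Subtype.val h
  rcases Δ.chart_eq (Tri.mid_not_vertex (Tri.side_mem_mid _ _)) h1 with
    ⟨h2, h3⟩ | ⟨s, hs, u, h2, h3, h4, h5⟩
  · obtain ⟨h4, h5⟩ := Tri.side_eq_side h3
    exact Or.inl ⟨Prod.ext h2 h4, h5⟩
  · obtain ⟨h6, rfl⟩ := Tri.side_eq_side h3
    obtain rfl : r = s := Prod.ext h2 h6
    obtain ⟨h7, h8⟩ := Tri.side_eq_side h5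
    exact Or.inr ⟨hs, Prod.ext h4 h7, h8⟩

lemma sidePt_bdry (E : Sf.Edge) (t : OpenI) :
    Δ.sidePt (Δ.bdry E).1 t = MarkedSurface.edgeMap E t := Δ.chartReg_edgeMap E t

/-- A boundary side is fixed by `glue`, so its points are not identified with points of other sides.
This shows that a traversal starts and ends at the boundary sides of the arc. -/
lemma eq_bdry_of_sidePt {E : Sf.Edge} {r : Δ.T × ZMod 3} {t t' : OpenI}
    (h : MarkedSurface.edgeMap E t = Δ.sidePt r t') : r = (Δ.bdry E).1 ∧ t' = t := by
  rw [← Δ.sidePt_bdry] at h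
  rcases sidePt_eq h with ⟨h1, h2⟩ | ⟨h1, -⟩
  · exact ⟨h1.symm, h2.symm⟩
  · exact absurd (Δ.bdry E).2 h1

section

variable {D : Δ.T → FramedSystem w triangle} {A : FramedSystem w Sf}
  {g : Δ.T → triangle.Reg → G b}

lemma GluedBy.sidePinning_bdry (h : Δ.GluedBy D A g) (E : Sf.Edge) (t : OpenI) :
    sidePinning D g (Δ.bdry E).1 t = A.p E t := by
  rw [sidePinning, h.p_bdry, inv_smul_smul]

lemma GluedBy.sidePinning_opp (h : Δ.GluedBy D A g) {r r' : Δ.T × ZMod 3} (hr : Δ.glue r = r')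
    (hne : r' ≠ r) (t : OpenI) :
    sidePinning D g r t = (sidePinning D g r' t.refl).opp := by
  subst hr
  exact h.p_int r hne t

variable [FiniteDimensional ℂ 𝔤]

/-- The decomposition formula for a single triangle. -/
lemma GluedBy.hol_passage (h : Δ.GluedBy D A g) {P : Δ.Passage} {x y : Sf.Reg} {γ : Path x y}
    (hγ : P.IsPassedBy γ) (m : ZMod 3) : ∃ s t : OpenI, x = Δ.sidePt (P.tri, P.enter) s ∧
      y = Δ.sidePt (P.tri, P.leave) t ∧
      (sidePinning D g (P.tri, P.enter) s).frame⁻¹ * A.hol (Path.Homotopic.Quotient.mk γ) *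
          (sidePinning D g (P.tri, P.leave) t).frame * w.elt =
        basicWilson P.turn ((Conf.cyc ^ (P.corner - m).valMinAbs)
          (toConf m (Moduli.mk (D P.tri)))) := by
  obtain ⟨hne, δ, hδ, ⟨s, hs⟩, ⟨t, ht⟩⟩ := hγ
  have hx : x = Δ.sidePt (P.tri, P.enter) s := by
    rw [← γ.source, hδ, hs]; rfl
  have hy : y = Δ.sidePt (P.tri, P.leave) t := by
    rw [← γ.target, hδ, ht]; rfl
  refine ⟨s, t, hx, hy, ?_⟩
  subst hx hy
  let δ' : Path (MarkedSurface.edgeMap (Sf := triangle) P.enter s)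
    (MarkedSurface.edgeMap (Sf := triangle) P.leave t) := ⟨δ, hs, ht⟩
  have h1 : γ = δ'.map (Δ.chartReg P.tri).continuous := Path.ext (funext hδ)
  have h2 := h.hol P.tri (Path.Homotopic.Quotient.mk δ')
  have h3 : A.hol ((Path.Homotopic.Quotient.mk δ').map (Δ.chartReg P.tri)) =
      A.hol (Path.Homotopic.Quotient.mk γ) := by
    rw [h1]; rfl
  rw [h3] at h2
  -- By uniqueness of paths in the triangle, transport from the barycenter to the leaving side
  -- factors through the entering side; the barycenter then drops out of the comparison.
  have h4 : (D P.tri).hol (Path.Homotopic.Quotient.mk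
        (seg center (MarkedSurface.edgeMap (Sf := triangle) P.leave t))) =
      (D P.tri).hol (Path.Homotopic.Quotient.mk
        (seg center (MarkedSurface.edgeMap (Sf := triangle) P.enter s))) *
      (D P.tri).hol (Path.Homotopic.Quotient.mk δ') := by
    rw [← (D P.tri).hol_trans]
    congr 1
    exact path_unique _ _
  rw [basicWilson_passage P hne, pinningAtCenter_eq _ P.enter s, pinningAtCenter_eq _ P.leave t,
    Pinning.frame_smul, Pinning.frame_smul, h4, h2, sidePinning, sidePinning, Pinning.frame_smul,
    Pinning.frame_smul]
  group

/-- The decomposition formula for a path between two sides. -/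
lemma GluedBy.hol_traverses (h : Δ.GluedBy D A g) (dot : Δ.T → ZMod 3) {x y : Sf.Reg}
    {c : Path.Homotopic.Quotient x y} {l : List Δ.Passage} (hc : Traverses c l) :
    ∃ P Q : Δ.Passage, l.head? = some P ∧ ∃ s t : OpenI, x = Δ.sidePt (P.tri, P.enter) s ∧
      y = Δ.sidePt (Q.tri, Q.leave) t ∧
      (sidePinning D g (P.tri, P.enter) s).frame⁻¹ * A.hol c *
          (sidePinning D g (Q.tri, Q.leave) t).frame * w.elt =
        (l.map fun P => basicWilson P.turn ((Conf.cyc ^ (P.corner - dot P.tri).valMinAbs)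
          (toConf (dot P.tri) (Moduli.mk (D P.tri))))).prod := by
  induction hc with
  | single γ P hγ =>
    obtain ⟨s, t, hx, hy, he⟩ := h.hol_passage hγ (dot P.tri)
    exact ⟨P, P, rfl, s, t, hx, hy, by rw [he, List.map_singleton, List.prod_singleton]⟩
  | cons γ c P P' l hγ hP hc ih =>
    obtain ⟨s, t, hx, hy, he⟩ := h.hol_passage hγ (dot P.tri)
    obtain ⟨P₀, Q, hP₀, s', t', hx', hy', he'⟩ := ih
    -- The head of the list is part of the induction statement in order to identify the first
    -- passage of the tail here.
    obtain rfl : P' = P₀ := by simpa using hP₀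
    refine ⟨P, Q, rfl, s, t', hx, hy', ?_⟩
    rw [List.map_cons, List.prod_cons, ← he, ← he', A.hol_trans]
    -- The two pieces meet at a point of both sides. Equality of the sides is excluded by `Next`, so
    -- the parameters are related by the reflection.
    rcases sidePt_eq (hy.symm.trans hx') with ⟨h1, -⟩ | ⟨-, -, rfl⟩
    · exact absurd h1.symm hP.2
    -- If `a` is the frame of the entering pinning, the leaving one has frame `a * w.elt`. The two
    -- Wilson lines meet in `a * w.elt * w.elt * a⁻¹`, which is `1`.
    · rw [h.sidePinning_opp hP.1 hP.2, Pinning.frame_opp]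
      have hw := w.mul_self
      generalize (sidePinning D g (P'.tri, P'.enter) t.refl).frame = a
      have h1 : a * w.elt * w.elt * a⁻¹ = 1 := by rw [mul_assoc a, hw]; group
      calc _ = (sidePinning D g (P.tri, P.enter) s).frame⁻¹ *
            A.hol (Path.Homotopic.Quotient.mk γ) * 1 * A.hol c *
            (sidePinning D g (Q.tri, Q.leave) t').frame * w.elt := by group
        _ = _ := by rw [← h1]; group

end

/-- The decomposition formula for Wilson lines. -/
lemma IsGluingMap.wilson_comp [FiniteDimensional ℂ 𝔤] {q : (Δ.T → Moduli w triangle) → Moduli w Sf} (hq : Δ.IsGluingMap q)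
    (dot : Δ.T → ZMod 3) {E E' : Sf.Edge} {c : ArcClass Sf E E'} {l : List Δ.Passage}
    (hc : Δ.ArcTraverses c l) :
    wilson c ∘ q = fun d => (l.map fun P => basicWilson P.turn
      ((Conf.cyc ^ (P.corner - dot P.tri).valMinAbs)
        (toConf (dot P.tri) (d P.tri)))).prod := by
  funext d
  obtain ⟨D, A, g, hD, hA, h⟩ := hq d
  obtain ⟨c', rfl, hc⟩ := hc
  obtain ⟨P, Q, -, s, t, hx, hy, he⟩ := h.hol_traverses dot hc
  -- The ends of the arc lie on boundary intervals, where the transported pinnings are those of `A`;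
  -- the identity for paths between sides then becomes the one for the Wilson line.
  obtain ⟨h1, rfl⟩ := eq_bdry_of_sidePt hx
  obtain ⟨h2, rfl⟩ := eq_bdry_of_sidePt hy
  rw [h1, h2, h.sidePinning_bdry, h.sidePinning_bdry] at he
  obtain rfl : (fun τ => Moduli.mk (D τ)) = d := funext hD
  rw [Function.comp_apply, ← hA]
  exact he

end IdealTriangulation

end

end

end WilsonLine

open WilsonLine in
theorem theorem3p17 {S 𝔤 : Type*} [Finite S] [LieRing 𝔤] [LieAlgebra ℂ 𝔤] [FiniteDimensional ℂ 𝔤]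
    [LieAlgebra.IsSimple ℂ 𝔤] {𝔥 : LieSubalgebra ℂ 𝔤} (b : LieAlgebra.Basis S 𝔥)
    (Sf : MarkedSurface) (Δ : IdealTriangulation Sf) (dot : Δ.T → ZMod 3) :
    (∃ q : (Δ.T → Moduli (longestLift b) triangle) → Moduli (longestLift b) Sf,
      Δ.IsGluingMap q) ∧
    ∀ q : (Δ.T → Moduli (longestLift b) triangle) → Moduli (longestLift b) Sf, Δ.IsGluingMap q →
      ∀ (E E' : Sf.Edge) (c : ArcClass Sf E E') (l : List Δ.Passage), Δ.ArcTraverses c l →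
        wilson c ∘ q = fun d => (l.map fun P => basicWilson P.turn
          ((Conf.cyc ^ (P.corner - dot P.tri).valMinAbs)
            (triangle.toConf (dot P.tri) (d P.tri)))).prod := by
  exact ⟨Δ.exists_isGluingMap, fun _ hq _ _ _ _ hc => hq.wilson_comp dot hc⟩
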